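/- Let $d\ge 1$, let $\mathbb H=\mathbb R^{d-1}\times(0,\infty)$, and let $\mathcal O\subset\mathbb H$ be a bounded open set. Let $\Sigma\subseteq\partial\mathcal O\cap\partial\mathbb H$. Let $\mathfrak w\in C(\mathcal O)\cap L^1(\mathcal O)$ and $\vartheta\in C(\bar{\mathcal O})$ be positive on $\mathcal O$ with $\vartheta\mathfrak w\in L^1(\mathcal O)$, and suppose that there are constants $0\le\alpha<2$, $\beta>0$ and $c_\vartheta,c_{\mathfrak w}\in(0,1)$ such that, on $\mathcal O$, $$c_\vartheta x_d^\alpha\le\vartheta\le c_\vartheta^{-1}x_d^\alpha,\qquad c_{\mathfrak w}x_d^{\beta-1}\le\mathfrak w\le c_{\mathfrak w}^{-1}x_d^{\beta-1}.$$ For $\mathcal O\subseteq T\subseteq\bar{\mathcal O}$, let $C_0^\infty(T)$ be the set of smooth functions on $\mathcal O$ all of whose derivatives are bounded and uniformly continuous on $\mathcal O$ and whose support is a compact subset of $T$. Let $H^1(\mathcal O,\mathfrak w)$ be the completion of $C_0^\infty(\bar{\mathcal O})$ in the norm $$\|u\|^2=\int_{\mathcal O}\left(\vartheta|Du|^2+(1+\vartheta)|u|^2\right)\mathfrak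 w\,dx,$$ and let $H^1_0(\mathcal O\cup\Sigma,\mathfrak w)$ be the closure of $C_0^\infty(\mathcal O\cup\Sigma)$ in it. For $l\in\mathbb R$ and $u\in H^1(\mathcal O,\mathfrak w)$, say that $u\le l$ on $\partial\mathcal O\setminus\Sigma$ in the sense of $H^1(\mathcal O,\mathfrak w)$ if $(u-l)^+\in H^1_0(\mathcal O\cup\Sigma,\mathfrak w)$, and let $\sup_{\partial\mathcal O\setminus\Sigma}u\in[-\infty,\infty]$ be the infimum of all such $l$; the term $\sup_{\partial\mathcal O\setminus\Sigma}u$ is omitted from $0\vee\sup_{\partial\mathcal O\setminus\Sigma}u$ when $\partial\mathcal O\setminus\Sigma=\emptyset$. Let $a=(a^{ij})$, $b=(b^i)$, $d=(d^j)$, $c$ be measurable on $\mathcal O$, with $a$ symmetric and non-negative definite, and suppose that for some constant $K>0$, for a.e. $x\in\mathcal O$ and all $\eta\in\mathbb R^d$, $$\vartheta|\eta|^2\le\langle a\eta,\eta\rangle\le K\vartheta|\eta|^2,\quad |\langle d,\eta\rangle|\le K\vartheta|\eta|,\quad |\langle b,\eta\rangle|\le K\vartheta|\eta|,\quad |c|\le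 K(1+\vartheta).$$ For $u,v\in H^1(\mathcal O,\mathfrak w)$ let $$\mathfrak a(u,v)=\int_{\mathcal O}\left(a^{ij}u_{x_i}v_{x_j}+d^juv_{x_j}-b^iu_{x_i}v+cuv\right)\mathfrak w\,dx,$$ and suppose that $\mathfrak a(1,v)\ge 0$ for all $v\in H^1_0(\mathcal O\cup\Sigma,\mathfrak w)$ with $v\ge 0$ a.e. on $\mathcal O$. If $u\in H^1(\mathcal O,\mathfrak w)$ satisfies $\mathfrak a(u,v)\le 0$ for all $v\in H^1_0(\mathcal O\cup\Sigma,\mathfrak w)$ with $v\ge 0$ a.e. on $\mathcal O$, then $$\operatorname*{ess\,sup}_{\mathcal O}u\le 0\vee\sup_{\partial\mathcal O\setminus\Sigma}u.$$ Moreover, $\mathfrak a$ has the weak maximum principle property on $\mathcal O\cup\Sigma$ for $H^1(\mathcal O,\mathfrak w)$: whenever $u\in H^1(\mathcal O,\mathfrak w)$ satisfies $\mathfrak a(u,v)\le 0$ for all $v\in H^1_0(\mathcal O\cup\Sigma,\mathfrak w)$ with $v\ge0$ a.e. on $\mathcal O$, and $u\le 0$ on $\partial\mathcal O\setminus\Sigma$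 in the sense of $H^1(\mathcal O,\mathfrak w)$, then $u\le 0$ a.e. on $\mathcal O$. -/

import Mathlib

open MeasureTheory Set Filter Topology
open scoped ContDiff ENNReal

noncomputable section

namespace WeightedWMP

/-- Euclidean space of dimension `n + 1`, so every dimension at least one. -/
abbrev Sp (n : ℕ) : Type := EuclideanSpace ℝ (Fin (n + 1))

/-- The last coordinate `x_d` of a point, where `d = n + 1`. -/
def lastCoord {n : ℕ} (x : Sp n) : ℝ := x (Fin.last n)

/-- The open upper half-space. -/
def halfSpace (n : ℕ) : Set (Sp n) := {x | 0 < lastCoord x}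

/-- A weight function on `O`: continuous, integrable and positive on `O`. -/
structure IsWeight {n : ℕ} (O : Set (Sp n)) (w : Sp n → ℝ) : Prop where
  continuousOn : ContinuousOn w O
  integrableOn : IntegrableOn w O
  pos : ∀ x ∈ O, 0 < w x

/-- A degeneracy coefficient on `O`: continuous up to the boundary and positive on `O`. -/
structure IsDegeneracyCoeff {n : ℕ} (O : Set (Sp n)) (θ : Sp n → ℝ) : Prop where
  continuousOn : ContinuousOn θ (closure O)
  pos : ∀ x ∈ O, 0 < θ x

/-- `φ` belongs to `C₀^∞(T)` for `O ⊆ T ⊆ closure O`: it is smooth on `O`, all its derivatives are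
bounded and uniformly continuous on `O` (thus extend continuously to `closure O`), and its support
is a compact subset of `T`. Only the values of `φ` on the open set `O` matter. -/
structure IsTestFunction {n : ℕ} (O T : Set (Sp n)) (φ : Sp n → ℝ) : Prop where
  contDiffOn : ContDiffOn ℝ ∞ φ O
  uniformContinuousOn : ∀ k : ℕ, UniformContinuousOn (iteratedFDeriv ℝ k φ) O
  bounded : ∀ k : ℕ, ∃ C : ℝ, ∀ x ∈ O, ‖iteratedFDeriv ℝ k φ x‖ ≤ C
  isCompact : IsCompact (closure (O ∩ Function.support φ))
  subset : closure (O ∩ Function.support φ) ⊆ T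

/-- The measure `ρ dx` on `O`. -/
def weightedMeasure {n : ℕ} (O : Set (Sp n)) (ρ : Sp n → ℝ) : Measure (Sp n) :=
  (volume.restrict O).withDensity (fun x => ENNReal.ofReal (ρ x))

/-- Pairs `(u, G)` with `u ∈ L²(O, (1 + θ) w)` and `G ∈ L²(O, θ w; ℝᵈ)`, with the Hilbert norm
`‖(u, G)‖² = ∫_O (θ |G|² + (1 + θ) |u|²) w dx`. -/
abbrev Pairs {n : ℕ} (O : Set (Sp n)) (θ w : Sp n → ℝ) : Type :=
  WithLp 2 (Lp ℝ 2 (weightedMeasure O (fun x => (1 + θ x) * w x)) ×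
    Lp (Sp n) 2 (weightedMeasure O (fun x => θ x * w x)))

/-- The pairs `(φ, Dφ)` with `φ ∈ C₀^∞(T)`. -/
def testPairs {n : ℕ} (O T : Set (Sp n)) (θ w : Sp n → ℝ) : Set (Pairs O θ w) :=
  {p | ∃ φ : Sp n → ℝ, IsTestFunction O T φ ∧
    (∀ᵐ x ∂weightedMeasure O (fun x => (1 + θ x) * w x), p.fst x = φ x) ∧
    (∀ᵐ x ∂weightedMeasure O (fun x => θ x * w x), p.snd x = gradient φ x)}

/-- The weighted Sobolev space `H¹(O, w)`: the completion of `C₀^∞(closure O)` in the norm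
`‖u‖² = ∫_O (θ |Du|² + (1 + θ) |u|²) w dx`, realized as the closure of the set of pairs `(φ, Dφ)`.
An element `u` is the pair of the function `u.fst` and its gradient `u.snd`. -/
def H1 {n : ℕ} (O : Set (Sp n)) (θ w : Sp n → ℝ) : Set (Pairs O θ w) :=
  closure (testPairs O (closure O) θ w)

/-- `H¹₀(O ∪ S, w)`: the closure of `C₀^∞(O ∪ S)` in `H¹(O, w)`. -/
def H10 {n : ℕ} (O S : Set (Sp n)) (θ w : Sp n → ℝ) : Set (Pairs O θ w) :=
  closure (testPairs O (O ∪ S) θ w)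

/-- `v ≥ 0` a.e. on `O`. -/
def NonnegAE {n : ℕ} {O : Set (Sp n)} {θ w : Sp n → ℝ} (v : Pairs O θ w) : Prop :=
  ∀ᵐ x ∂volume.restrict O, 0 ≤ v.fst x

/-- `u ≤ l` on `∂O ∖ S` in the sense of `H¹(O, w)`: the function `(u - l)⁺` belongs to
`H¹₀(O ∪ S, w)`. -/
def LeOnBoundary {n : ℕ} {O : Set (Sp n)} (S : Set (Sp n)) {θ w : Sp n → ℝ}
    (u : Pairs O θ w) (l : ℝ) : Prop :=
  ∃ v ∈ H10 O S θ w, ∀ᵐ x ∂volume.restrict O, v.fst x = max (u.fst x - l) 0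

/-- `sup_{∂O ∖ S} u`, the infimum of all real `l` with `u ≤ l` on `∂O ∖ S` in the sense of
`H¹(O, w)`, as an extended real (so `⊤` when there is no such `l`). -/
def boundarySup {n : ℕ} {O : Set (Sp n)} (S : Set (Sp n)) {θ w : Sp n → ℝ}
    (u : Pairs O θ w) : EReal :=
  sInf {L : EReal | ∃ l : ℝ, L = (l : EReal) ∧ LeOnBoundary S u l}

open Classical in
/-- `0 ∨ sup_{∂O ∖ S} u`, with the boundary term omitted when `∂O ∖ S` is empty. -/
def zeroMaxBoundarySup {n : ℕ} {O : Set (Sp n)} (S : Set (Sp n)) {θ w : Sp n → ℝ}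
    (u : Pairs O θ w) : EReal :=
  if frontier O \ S = ∅ then 0 else max 0 (boundarySup S u)

/-- The coefficients of a bilinear form. -/
structure Coeffs (n : ℕ) where
  a : Sp n → Matrix (Fin (n + 1)) (Fin (n + 1)) ℝ
  b : Sp n → Sp n
  d : Sp n → Sp n
  c : Sp n → ℝ

/-- The integral `∫_O (a^{ij} u_{x_i} v_{x_j} + d^j u v_{x_j} - b^i u_{x_i} v + c u v) w dx`, for
functions `u`, `v` with gradients `Du`, `Dv`. -/
def Coeffs.form {n : ℕ} (A : Coeffs n) (O : Set (Sp n)) (w : Sp n → ℝ)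
    (u : Sp n → ℝ) (Du : Sp n → Sp n) (v : Sp n → ℝ) (Dv : Sp n → Sp n) : ℝ :=
  ∫ x in O, ((∑ i, ∑ j, A.a x i j * Du x i * Dv x j) + (∑ j, A.d x j * u x * Dv x j)
    - (∑ i, A.b x i * Du x i * v x) + A.c x * u x * v x) * w x

/-- The bilinear map `(u, v) ↦ a(u, v)` on `H¹(O, w)`. -/
def Coeffs.bilin {n : ℕ} (A : Coeffs n) {O : Set (Sp n)} {θ w : Sp n → ℝ}
    (u v : Pairs O θ w) : ℝ :=
  A.form O w u.fst u.snd v.fst v.snd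

/-- `a(u, v) ≤ 0` for all `v ∈ H¹₀(O ∪ S, w)` with `v ≥ 0` a.e. on `O`. -/
def IsSubsolution {n : ℕ} {O : Set (Sp n)} (S : Set (Sp n)) {θ w : Sp n → ℝ}
    (B : Pairs O θ w → Pairs O θ w → ℝ) (u : Pairs O θ w) : Prop :=
  ∀ v ∈ H10 O S θ w, NonnegAE v → B u v ≤ 0

/-- The weak maximum principle property on `O ∪ S` for a cone `K` contained in `H¹(O, w)`: if
`u ∈ K` is a subsolution with `u ≤ 0` on `∂O ∖ S` in the sense of `H¹(O, w)`, then `u ≤ 0` a.e. -/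
def WeakMaxPrinciple {n : ℕ} {O : Set (Sp n)} (S : Set (Sp n)) {θ w : Sp n → ℝ}
    (B : Pairs O θ w → Pairs O θ w → ℝ) (K : Set (Pairs O θ w)) : Prop :=
  ∀ u ∈ K, IsSubsolution S B u → LeOnBoundary S u 0 → ∀ᵐ x ∂volume.restrict O, u.fst x ≤ 0

end WeightedWMP

end

open WeightedWMP

/-! Write `μ = θ w dx`. Its density is comparable to `x_d ^ γ` with `γ = α + β - 1 > -1`. Suppose
`u` is a subsolution with `u ≤ l` on the boundary part, and take a level `m ≥ max l 0`. The
truncation `v = (u - m)⁺` lies in `H¹₀(O ∪ S)`, so it yields admissible test functions. Formally,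
test the inequality for `u` with `v` and the inequality for the constant `1` with `(v + m) v`, then
subtract. The terms with `c` and with `(v + m) d · Dv` cancel, and ellipticity leaves `∫ |Dv|² dμ ≤
2K ∫ v |Dv| dμ`. Because `(v + m) v` need not lie in `H¹`, the argument uses `F(v)` and `(v + m)
F(v)` with a bounded `F`, and lets `F` tend to the identity (`truncated_energy_le`, `energy_le`).

The product `v |Dv|` vanishes off `E_m = {u > m, Du ≠ 0}`, so Young's inequality gives `∫ |Dv|² dμ ≤
4K² ∫_{E_m} v² dμ` (`caccioppoli`). No Sobolev embedding is needed to exploit this. It is enough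
that `∫_E φ² dμ ≤ ε ∫ |Dφ|² dμ` whenever `μ E` is small, uniformly in `φ`
(`IsPowerWeight.exists_uniformIntegrable`). That bound has two sources: a Hardy inequality in thin
strips along `x_d = 0`, whose constant tends to zero because `γ > -1`, and averaging over small
translations away from `x_d = 0`. Hence if `μ E_m` is below a threshold independent of `m`, then `Dv
= 0`, and the Poincaré inequality gives `u ≤ m` (`exists_forall_le_of_measure_le`).

To conclude, let `m₀` be the least upper bound for `u` among levels at least `max l 0`. It is
finite, since the sets `E_m` decrease to the empty set as `m → ∞`. If `m₀ > max l 0`, then as `m ↑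
m₀` the sets `E_m` decrease, up to null sets, to `{u = m₀, Du ≠ 0}`. This set is null because
gradients vanish on level sets (`IsSobolev.gradient_eq_zero_of_eq`). Some level below `m₀` is then
also an upper bound, a contradiction (`ae_le_of_leOnBoundary`).

Elements of `H¹` are limits of pairs `(φ, Dφ)`, so the calculus used above (chain rule, positive
parts, uniqueness of the gradient) is first derived from this definition. -/

namespace WeightedWMP

noncomputable section

/-! ### Weighted measures and Sobolev pairs -/

section Sobolev

variable {n : ℕ} {O T : Set (Sp n)} {θ w ρ : Sp n → ℝ}

lemma IsWeight.aemeasurable (h : IsWeight O ρ) (hO : IsOpen O) :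
    AEMeasurable (fun x => ENNReal.ofReal (ρ x)) (volume.restrict O) :=
  (h.continuousOn.aemeasurable hO.measurableSet).ennreal_ofReal

/-- Positivity of `ρ` on `O` makes the weighted measure and Lebesgue measure on `O` have the same
null sets. Both components of a pair can therefore be handled with a.e. statements for a single
measure. -/
lemma IsWeight.ae_iff (h : IsWeight O ρ) (hO : IsOpen O) {P : Sp n → Prop} :
    (∀ᵐ x ∂weightedMeasure O ρ, P x) ↔ ∀ᵐ x ∂volume.restrict O, P x := by
  rw [weightedMeasure, ae_withDensity_iff' (h.aemeasurable hO)]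
  constructor
  · intro hP
    filter_upwards [hP, ae_restrict_mem hO.measurableSet] with x hx hxO
    exact hx (by simpa using h.pos x hxO)
  · intro hP
    filter_upwards [hP] with x hx _ using hx

lemma IsWeight.ae_eq (h : IsWeight O ρ) (hO : IsOpen O) :
    ae (weightedMeasure O ρ) = ae (volume.restrict O) := by
  ext s
  exact h.ae_iff hO (P := fun x => x ∈ s)

lemma IsWeight.isFiniteMeasure (h : IsWeight O ρ) : IsFiniteMeasure (weightedMeasure O ρ) :=
  isFiniteMeasure_withDensity_ofReal h.integrableOn.2

lemma IsWeight.lintegral_eq (h : IsWeight O ρ) (hO : IsOpen O) (f : Sp n → ℝ≥0∞) :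
    ∫⁻ x, f x ∂weightedMeasure O ρ = ∫⁻ x in O, ENNReal.ofReal (ρ x) * f x := by
  rw [weightedMeasure, lintegral_withDensity_eq_lintegral_mul_non_measurable₀ _ (h.aemeasurable hO)
    (Eventually.of_forall fun x => ENNReal.ofReal_lt_top)]
  rfl

lemma IsWeight.aestronglyMeasurable_iff (h : IsWeight O ρ) (hO : IsOpen O) {E : Type*}
    [TopologicalSpace E] {f : Sp n → E} :
    AEStronglyMeasurable f (weightedMeasure O ρ) ↔ AEStronglyMeasurable f (volume.restrict O) := by
  have h1 : weightedMeasure O ρ ≪ volume.restrict O :=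
    Measure.ae_le_iff_absolutelyContinuous.1 (h.ae_eq hO).le
  have h2 : volume.restrict O ≪ weightedMeasure O ρ :=
    Measure.ae_le_iff_absolutelyContinuous.1 (h.ae_eq hO).ge
  exact ⟨fun hf => hf.mono_ac h2, fun hf => hf.mono_ac h1⟩

lemma tendsto_eLpNorm_two_zero_iff {X E : Type*} [MeasurableSpace X] [NormedAddCommGroup E]
    {μ : Measure X} {ι : Type*} {l : Filter ι} (f : ι → X → E) :
    Tendsto (fun k => eLpNorm (f k) 2 μ) l (𝓝 0) ↔
      Tendsto (fun k => ∫⁻ x, ‖f k x‖ₑ ^ 2 ∂μ) l (𝓝 0) := by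
  have key : ∀ k, (eLpNorm (f k) 2 μ) ^ 2 = ∫⁻ x, ‖f k x‖ₑ ^ 2 ∂μ := by
    intro k
    simpa using eLpNorm_nnreal_pow_eq_lintegral (f := f k) (μ := μ) (p := 2) (by norm_num)
  simp_rw [← key]
  constructor
  · intro h
    simpa [Function.comp_def] using (ENNReal.continuous_pow 2).tendsto 0 |>.comp h
  · intro h
    have := (ENNReal.continuous_rpow_const (y := 1/2)).tendsto 0 |>.comp h
    simp only [Function.comp_def] at this
    convert this using 2 with k
    · rw [← ENNReal.rpow_natCast, ← ENNReal.rpow_mul]; norm_num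
    · norm_num

/-- Dominated convergence in `L²`. -/
lemma tendsto_eLpNorm_two_of_dominated {X E : Type*} [MeasurableSpace X] [NormedAddCommGroup E]
    {μ : Measure X} {f : ℕ → X → E} {g : X → ℝ} (hf : ∀ k, AEStronglyMeasurable (f k) μ)
    (hg : MemLp g 2 μ) (hfg : ∀ k, ∀ᵐ x ∂μ, ‖f k x‖ ≤ ‖g x‖)
    (hlim : ∀ᵐ x ∂μ, Tendsto (fun k => f k x) atTop (𝓝 0)) :
    Tendsto (fun k => eLpNorm (f k) 2 μ) atTop (𝓝 0) := by
  rw [tendsto_eLpNorm_two_zero_iff]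
  have h0 : (0 : ℝ≥0∞) = ∫⁻ _, 0 ∂μ := by simp
  rw [h0]
  refine tendsto_lintegral_of_dominated_convergence' (fun x => ‖g x‖ₑ ^ 2)
    (fun k => (hf k).enorm.pow_const 2) (fun k => ?_) ?_ ?_
  · filter_upwards [hfg k] with x hx
    gcongr
    exact enorm_le_iff_norm_le.2 hx
  · have := eLpNorm_nnreal_pow_eq_lintegral (f := g) (μ := μ) (p := 2) (by norm_num)
    simp only [ENNReal.coe_ofNat, NNReal.coe_ofNat, ENNReal.rpow_ofNat] at this
    rw [← this]
    exact ENNReal.pow_ne_top hg.2.ne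
  · filter_upwards [hlim] with x hx
    have := ((ENNReal.continuous_pow 2).comp continuous_enorm).tendsto (0 : E) |>.comp hx
    simpa [Function.comp_def] using this

/-- The function `f` with gradient `G` is represented by an element of the closure of the
pairs `(φ, Dφ)`, `φ ∈ C₀^∞(T)`. -/
def IsSobolev (O T : Set (Sp n)) (θ w : Sp n → ℝ) (f : Sp n → ℝ) (G : Sp n → Sp n) : Prop :=
  ∃ p ∈ closure (testPairs O T θ w), p.fst =ᵐ[volume.restrict O] f ∧
    p.snd =ᵐ[volume.restrict O] G

/-- The weights that occur in the norm of `H¹(O, w)`. -/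
structure NormWeights (O : Set (Sp n)) (θ w : Sp n → ℝ) : Prop where
  isOpen : IsOpen O
  fst : IsWeight O (fun x => (1 + θ x) * w x)
  snd : IsWeight O (fun x => θ x * w x)

lemma IsSobolev.of_mem {p : Pairs O θ w} (hp : p ∈ closure (testPairs O T θ w)) :
    IsSobolev O T θ w p.fst p.snd :=
  ⟨p, hp, EventuallyEq.rfl, EventuallyEq.rfl⟩

lemma IsSobolev.congr {f f' : Sp n → ℝ} {G G' : Sp n → Sp n} (h : IsSobolev O T θ w f G)
    (hf : f =ᵐ[volume.restrict O] f') (hG : G =ᵐ[volume.restrict O] G') :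
    IsSobolev O T θ w f' G' := by
  obtain ⟨p, hp, h1, h2⟩ := h
  exact ⟨p, hp, h1.trans hf, h2.trans hG⟩

lemma IsSobolev.memLp_fst {f : Sp n → ℝ} {G : Sp n → Sp n} (h : IsSobolev O T θ w f G)
    (W : NormWeights O θ w) : MemLp f 2 (weightedMeasure O (fun x => (1 + θ x) * w x)) := by
  obtain ⟨p, -, h1, -⟩ := h
  refine (memLp_congr_ae ?_).1 (Lp.memLp p.fst)
  exact (W.fst.ae_iff W.isOpen).2 h1

lemma IsSobolev.memLp_snd {f : Sp n → ℝ} {G : Sp n → Sp n} (h : IsSobolev O T θ w f G)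
    (W : NormWeights O θ w) : MemLp G 2 (weightedMeasure O (fun x => θ x * w x)) := by
  obtain ⟨p, -, -, h1⟩ := h
  refine (memLp_congr_ae ?_).1 (Lp.memLp p.snd)
  exact (W.snd.ae_iff W.isOpen).2 h1

lemma IsSobolev.aesm_fst {f : Sp n → ℝ} {G : Sp n → Sp n} (h : IsSobolev O T θ w f G)
    (W : NormWeights O θ w) : AEStronglyMeasurable f (volume.restrict O) :=
  (W.fst.aestronglyMeasurable_iff W.isOpen).1 (h.memLp_fst W).1

lemma IsSobolev.aesm_snd {f : Sp n → ℝ} {G : Sp n → Sp n} (h : IsSobolev O T θ w f G)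
    (W : NormWeights O θ w) : AEStronglyMeasurable G (volume.restrict O) :=
  (W.snd.aestronglyMeasurable_iff W.isOpen).1 (h.memLp_snd W).1

lemma memLp_two_of_tendsto {X E : Type*} [MeasurableSpace X] [NormedAddCommGroup E]
    {μ : Measure X} {f : ℕ → X → E} {g : X → E} (hf : ∀ k, MemLp (f k) 2 μ)
    (hg : AEStronglyMeasurable g μ)
    (h : Tendsto (fun k => eLpNorm (f k - g) 2 μ) atTop (𝓝 0)) : MemLp g 2 μ := by
  obtain ⟨k, hk⟩ := (h.eventually (gt_mem_nhds (zero_lt_one (α := ℝ≥0∞)))).exists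
  have : MemLp (f k - g) 2 μ := ⟨(hf k).1.sub hg, hk.trans ENNReal.one_lt_top⟩
  simpa using (hf k).sub this

/-- Closedness of the space under convergence in the norm, stated for functions rather than classes.
The limit only has to be measurable, as its square integrability follows from being at finite
distance from a term of the sequence. -/
lemma IsSobolev.of_tendsto (W : NormWeights O θ w) {f : ℕ → Sp n → ℝ} {G : ℕ → Sp n → Sp n}
    {f' : Sp n → ℝ} {G' : Sp n → Sp n} (h : ∀ k, IsSobolev O T θ w (f k) (G k))
    (hfm : AEStronglyMeasurable f' (volume.restrict O))
    (hGm : AEStronglyMeasurable G' (volume.restrict O))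
    (hf : Tendsto (fun k => eLpNorm (f k - f') 2
      (weightedMeasure O (fun x => (1 + θ x) * w x))) atTop (𝓝 0))
    (hG : Tendsto (fun k => eLpNorm (G k - G') 2
      (weightedMeasure O (fun x => θ x * w x))) atTop (𝓝 0)) :
    IsSobolev O T θ w f' G' := by
  have mf := memLp_two_of_tendsto (fun k => (h k).memLp_fst W)
    ((W.fst.aestronglyMeasurable_iff W.isOpen).2 hfm) hf
  have mG := memLp_two_of_tendsto (fun k => (h k).memLp_snd W)
    ((W.snd.aestronglyMeasurable_iff W.isOpen).2 hGm) hG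
  choose p hp hp1 hp2 using h
  refine ⟨WithLp.toLp 2 (mf.toLp f', mG.toLp G'), ?_, (W.fst.ae_iff W.isOpen).1 mf.coeFn_toLp,
    (W.snd.ae_iff W.isOpen).1 mG.coeFn_toLp⟩
  rw [← closure_closure]
  refine mem_closure_of_tendsto (f := p) (b := atTop) ?_ (Eventually.of_forall hp)
  have e1 : Tendsto (fun k => (p k).fst) atTop (𝓝 (mf.toLp f')) := by
    rw [Lp.tendsto_Lp_iff_tendsto_eLpNorm]
    refine hf.congr fun k => eLpNorm_congr_ae ?_
    filter_upwards [(W.fst.ae_iff W.isOpen).2 (hp1 k)] with x hx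
    simp [hx]
  have e2 : Tendsto (fun k => (p k).snd) atTop (𝓝 (mG.toLp G')) := by
    rw [Lp.tendsto_Lp_iff_tendsto_eLpNorm]
    refine hG.congr fun k => eLpNorm_congr_ae ?_
    filter_upwards [(W.snd.ae_iff W.isOpen).2 (hp2 k)] with x hx
    simp [hx]
  exact ((WithLp.prod_continuous_toLp 2 _ _).tendsto _).comp (e1.prodMk_nhds e2)

lemma exists_subseq_ae_tendsto {X E : Type*} [MeasurableSpace X] [NormedAddCommGroup E]
    {μ : Measure X} {f : ℕ → X → E} {g : X → E} (hf : ∀ k, AEStronglyMeasurable (f k) μ)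
    (hg : AEStronglyMeasurable g μ)
    (h : Tendsto (fun k => eLpNorm (f k - g) 2 μ) atTop (𝓝 0)) :
    ∃ ns : ℕ → ℕ, StrictMono ns ∧
      ∀ᵐ x ∂μ, Tendsto (fun k => f (ns k) x) atTop (𝓝 (g x)) :=
  (tendstoInMeasure_of_tendsto_eLpNorm two_ne_zero hf hg h).exists_seq_tendsto_ae

lemma gradient_norm (φ : Sp n → ℝ) (x : Sp n) : ‖gradient φ x‖ = ‖fderiv ℝ φ x‖ := by
  simp [gradient]

lemma IsTestFunction.differentiableAt {φ : Sp n → ℝ} (h : IsTestFunction O T φ) (hO : IsOpen O)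
    {x : Sp n} (hx : x ∈ O) : DifferentiableAt ℝ φ x :=
  (h.contDiffOn.contDiffAt (hO.mem_nhds hx)).differentiableAt (by simp)

lemma IsTestFunction.continuousOn_fderiv {φ : Sp n → ℝ} (h : IsTestFunction O T φ)
    (hO : IsOpen O) : ContinuousOn (fderiv ℝ φ) O :=
  h.contDiffOn.continuousOn_fderiv_of_isOpen hO (by simp)

lemma IsTestFunction.continuousOn_gradient {φ : Sp n → ℝ} (h : IsTestFunction O T φ)
    (hO : IsOpen O) : ContinuousOn (gradient φ) O :=
  (InnerProductSpace.toDual ℝ (Sp n)).symm.continuous.comp_continuousOn (h.continuousOn_fderiv hO)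

lemma IsTestFunction.exists_bound {φ : Sp n → ℝ} (h : IsTestFunction O T φ) :
    ∃ C, ∀ x ∈ O, |φ x| ≤ C := by
  obtain ⟨C, hC⟩ := h.bounded 0
  exact ⟨C, fun x hx => by simpa using hC x hx⟩

lemma IsTestFunction.exists_bound_gradient {φ : Sp n → ℝ} (h : IsTestFunction O T φ) :
    ∃ C, ∀ x ∈ O, ‖gradient φ x‖ ≤ C := by
  obtain ⟨C, hC⟩ := h.bounded 1
  refine ⟨C, fun x hx => ?_⟩
  rw [gradient_norm, ← norm_iteratedFDeriv_one]
  exact hC x hx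

lemma IsTestFunction.aesm {φ : Sp n → ℝ} (h : IsTestFunction O T φ) (hO : IsOpen O) :
    AEStronglyMeasurable φ (volume.restrict O) :=
  h.contDiffOn.continuousOn.aestronglyMeasurable hO.measurableSet

lemma IsTestFunction.aesm_gradient {φ : Sp n → ℝ} (h : IsTestFunction O T φ) (hO : IsOpen O) :
    AEStronglyMeasurable (gradient φ) (volume.restrict O) :=
  (h.continuousOn_gradient hO).aestronglyMeasurable hO.measurableSet

lemma IsWeight.memLp_of_bounded (h : IsWeight O ρ) (hO : IsOpen O) {E : Type*}
    [NormedAddCommGroup E] {f : Sp n → E} (hf : AEStronglyMeasurable f (volume.restrict O))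
    {C : ℝ} (hC : ∀ᵐ x ∂volume.restrict O, ‖f x‖ ≤ C) : MemLp f 2 (weightedMeasure O ρ) :=
  haveI := h.isFiniteMeasure
  MemLp.of_bound ((h.aestronglyMeasurable_iff hO).2 hf) C ((h.ae_iff hO).2 hC)

lemma IsTestFunction.isSobolev {φ : Sp n → ℝ} (h : IsTestFunction O T φ)
    (W : NormWeights O θ w) : IsSobolev O T θ w φ (gradient φ) := by
  obtain ⟨C, hC⟩ := h.exists_bound
  obtain ⟨C', hC'⟩ := h.exists_bound_gradient
  have m1 : MemLp φ 2 (weightedMeasure O (fun x => (1 + θ x) * w x)) :=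
    W.fst.memLp_of_bounded W.isOpen (h.aesm W.isOpen)
      ((ae_restrict_mem W.isOpen.measurableSet).mono hC)
  have m2 : MemLp (gradient φ) 2 (weightedMeasure O (fun x => θ x * w x)) :=
    W.snd.memLp_of_bounded W.isOpen (h.aesm_gradient W.isOpen)
      ((ae_restrict_mem W.isOpen.measurableSet).mono hC')
  exact ⟨WithLp.toLp 2 (m1.toLp φ, m2.toLp _),
    subset_closure ⟨φ, h, m1.coeFn_toLp, m2.coeFn_toLp⟩,
    (W.fst.ae_iff W.isOpen).1 m1.coeFn_toLp, (W.snd.ae_iff W.isOpen).1 m2.coeFn_toLp⟩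

/-- Approximation by test functions, in the norm and almost everywhere. -/
lemma IsSobolev.exists_seq {f : Sp n → ℝ} {G : Sp n → Sp n} (h : IsSobolev O T θ w f G)
    (W : NormWeights O θ w) : ∃ φ : ℕ → Sp n → ℝ, (∀ k, IsTestFunction O T (φ k)) ∧
      Tendsto (fun k => eLpNorm (φ k - f) 2
        (weightedMeasure O (fun x => (1 + θ x) * w x))) atTop (𝓝 0) ∧
      Tendsto (fun k => eLpNorm (gradient (φ k) - G) 2
        (weightedMeasure O (fun x => θ x * w x))) atTop (𝓝 0) ∧
      (∀ᵐ x ∂volume.restrict O, Tendsto (fun k => φ k x) atTop (𝓝 (f x))) ∧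
      (∀ᵐ x ∂volume.restrict O, Tendsto (fun k => gradient (φ k) x) atTop (𝓝 (G x))) := by
  have mf := h.memLp_fst W
  have mG := h.memLp_snd W
  obtain ⟨p, hp, h1, h2⟩ := h
  obtain ⟨q, hq, hqp⟩ := mem_closure_iff_seq_limit.1 hp
  choose φ hφ hφ1 hφ2 using hq
  have e1 : Tendsto (fun k => eLpNorm (φ k - f) 2
        (weightedMeasure O (fun x => (1 + θ x) * w x))) atTop (𝓝 0) := by
    have := ((WithLp.prod_continuous_ofLp 2 _ _).fst.tendsto _).comp hqp
    have := (Lp.tendsto_Lp_iff_tendsto_eLpNorm' _ _).1 this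
    refine this.congr fun k => eLpNorm_congr_ae ?_
    filter_upwards [(W.fst.ae_iff W.isOpen).2 h1, hφ1 k] with x hx hx'
    simp only [Function.comp_apply, Pi.sub_apply]
    rw [← hx, ← hx']
    rfl
  have e2 : Tendsto (fun k => eLpNorm (gradient (φ k) - G) 2
        (weightedMeasure O (fun x => θ x * w x))) atTop (𝓝 0) := by
    have := ((WithLp.prod_continuous_ofLp 2 _ _).snd.tendsto _).comp hqp
    have := (Lp.tendsto_Lp_iff_tendsto_eLpNorm' _ _).1 this
    refine this.congr fun k => eLpNorm_congr_ae ?_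
    filter_upwards [(W.snd.ae_iff W.isOpen).2 h2, hφ2 k] with x hx hx'
    simp only [Function.comp_apply, Pi.sub_apply]
    rw [← hx, ← hx']
    rfl
  -- Two successive extractions: one for a.e. convergence of the functions, then a further one for
  -- the gradients.
  obtain ⟨ns, hns, hae⟩ := exists_subseq_ae_tendsto (fun k =>
    (W.fst.aestronglyMeasurable_iff W.isOpen).2 ((hφ k).aesm W.isOpen)) mf.1 e1
  obtain ⟨ms, hms, hae'⟩ := exists_subseq_ae_tendsto (fun k =>
    (W.snd.aestronglyMeasurable_iff W.isOpen).2 ((hφ (ns k)).aesm_gradient W.isOpen)) mG.1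
    (e2.comp hns.tendsto_atTop)
  refine ⟨fun k => φ (ns (ms k)), fun k => hφ _, e1.comp (hns.comp hms).tendsto_atTop,
    e2.comp (hns.comp hms).tendsto_atTop, ?_, (W.snd.ae_iff W.isOpen).1 hae'⟩
  filter_upwards [(W.fst.ae_iff W.isOpen).1 hae] with x hx
  exact hx.comp hms.tendsto_atTop
end Sobolev

/-! ### Leibniz estimate for differences of derivatives -/

section Products

variable {E : Type*} [NormedAddCommGroup E] [NormedSpace ℝ E]

/-- Translation turns derivatives at two different points into derivatives at the common point `0`,
where the product rule applies to a difference of translates. -/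
lemma iteratedFDerivWithin_translate {φ : E → ℝ} {s : Set E} (hs : IsOpen s) (h0 : (0 : E) ∈ s)
    (x : E) (k : ℕ) :
    iteratedFDerivWithin ℝ k (fun z => φ (x + z)) s 0 = iteratedFDeriv ℝ k φ x := by
  rw [iteratedFDerivWithin_of_isOpen k hs h0, iteratedFDeriv_comp_add_left]
  simp

/-- Leibniz bound for the difference of the derivatives of a product at two points. -/
lemma norm_iteratedFDeriv_mul_sub_le {φ ψ : E → ℝ} {O : Set E} (hO : IsOpen O)
    (hφ : ContDiffOn ℝ ∞ φ O) (hψ : ContDiffOn ℝ ∞ ψ O) {x y : E} (hx : x ∈ O) (hy : y ∈ O)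
    (k : ℕ) :
    ‖iteratedFDeriv ℝ k (fun z => φ z * ψ z) x - iteratedFDeriv ℝ k (fun z => φ z * ψ z) y‖ ≤
      (∑ i ∈ Finset.range (k + 1), (k.choose i : ℝ) *
        ‖iteratedFDeriv ℝ i φ x - iteratedFDeriv ℝ i φ y‖ * ‖iteratedFDeriv ℝ (k - i) ψ x‖) +
      ∑ i ∈ Finset.range (k + 1), (k.choose i : ℝ) * ‖iteratedFDeriv ℝ i φ y‖ *
        ‖iteratedFDeriv ℝ (k - i) ψ x - iteratedFDeriv ℝ (k - i) ψ y‖ := by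
  set s : Set E := (fun z => x + z) ⁻¹' O ∩ (fun z => y + z) ⁻¹' O with hs_def
  have hs : IsOpen s := (hO.preimage (by fun_prop)).inter (hO.preimage (by fun_prop))
  have h0 : (0 : E) ∈ s := by simp [hs_def, hx, hy]
  have hu := hs.uniqueDiffOn (𝕜 := ℝ)
  have cx : ∀ {f : E → ℝ}, ContDiffOn ℝ ∞ f O → ContDiffOn ℝ ∞ (fun z => f (x + z)) s :=
    fun hf => hf.comp (by fun_prop) fun z hz => hz.1
  have cy : ∀ {f : E → ℝ}, ContDiffOn ℝ ∞ f O → ContDiffOn ℝ ∞ (fun z => f (y + z)) s :=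
    fun hf => hf.comp (by fun_prop) fun z hz => hz.2
  have hsub : ∀ (f : E → ℝ), ContDiffOn ℝ ∞ f O → ∀ j : ℕ,
      iteratedFDerivWithin ℝ j ((fun z => f (x + z)) - fun z => f (y + z)) s 0 =
        iteratedFDeriv ℝ j f x - iteratedFDeriv ℝ j f y := by
    intro f hf j
    rw [iteratedFDerivWithin_sub_apply ((cx hf).of_le (by exact_mod_cast le_top) 0 h0)
      ((cy hf).of_le (by exact_mod_cast le_top) 0 h0) hu h0,
      iteratedFDerivWithin_translate hs h0, iteratedFDerivWithin_translate hs h0]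
  rw [← hsub _ (hφ.mul hψ) k]
  -- Add and subtract `φ (y + z) * ψ (x + z)`, so that each summand is a product with one factor a
  -- difference.
  have hdec : ((fun z => φ (x + z) * ψ (x + z)) - fun z => φ (y + z) * ψ (y + z)) =
      (fun z => ((fun z => φ (x + z)) - fun z => φ (y + z)) z * ψ (x + z)) +
      fun z => φ (y + z) * ((fun z => ψ (x + z)) - fun z => ψ (y + z)) z := by
    funext z; simp; ring
  have c1 : ContDiffOn ℝ ∞ ((fun z => φ (x + z)) - fun z => φ (y + z)) s := (cx hφ).sub (cy hφ)
  have c2 : ContDiffOn ℝ ∞ ((fun z => ψ (x + z)) - fun z => ψ (y + z)) s := (cx hψ).sub (cy hψ)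
  rw [hdec, iteratedFDerivWithin_add_apply ((c1.mul (cx hψ)).of_le (by exact_mod_cast le_top) 0 h0)
    (((cy hφ).mul c2).of_le (by exact_mod_cast le_top) 0 h0) hu h0]
  refine (norm_add_le _ _).trans (add_le_add ?_ ?_)
  · refine (norm_iteratedFDerivWithin_mul_le c1 (cx hψ) hu h0
      (n := k) (by exact_mod_cast le_top)).trans (Finset.sum_le_sum fun i _ => ?_)
    rw [hsub φ hφ, iteratedFDerivWithin_translate hs h0]
  · refine (norm_iteratedFDerivWithin_mul_le (cy hφ) c2 hu h0
      (n := k) (by exact_mod_cast le_top)).trans (Finset.sum_le_sum fun i _ => ?_)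
    rw [hsub ψ hψ, iteratedFDerivWithin_translate hs h0]

lemma uniformContinuousOn_iff_tendsto_norm {X F : Type*} [PseudoMetricSpace X]
    [NormedAddCommGroup F] {f : X → F} {s : Set X} : UniformContinuousOn f s ↔
      Tendsto (fun p : X × X => ‖f p.1 - f p.2‖) (uniformity X ⊓ 𝓟 (s ×ˢ s)) (𝓝 0) := by
  rw [UniformContinuousOn, tendsto_uniformity_iff_dist_tendsto_zero]
  simp [dist_eq_norm]

end Products

/-! ### Algebraic closure properties of test functions -/

section TestFunctions

variable {n : ℕ} {O T : Set (Sp n)} {φ ψ : Sp n → ℝ}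

lemma IsTestFunction.of_support (hφ : IsTestFunction O T φ)
    (hψ : ContDiffOn ℝ ∞ ψ O)
    (hu : ∀ k : ℕ, UniformContinuousOn (iteratedFDeriv ℝ k ψ) O)
    (hb : ∀ k : ℕ, ∃ C : ℝ, ∀ x ∈ O, ‖iteratedFDeriv ℝ k ψ x‖ ≤ C)
    (hs : ∀ x ∈ O, φ x = 0 → ψ x = 0) : IsTestFunction O T ψ := by
  have : closure (O ∩ Function.support ψ) ⊆ closure (O ∩ Function.support φ) :=
    closure_mono fun x hx => ⟨hx.1, fun h => hx.2 (hs x hx.1 h)⟩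
  exact ⟨hψ, hu, hb, hφ.isCompact.of_isClosed_subset isClosed_closure this, this.trans hφ.subset⟩

/-- In the Leibniz bound every term pairs a bounded derivative with a difference of derivatives that
is uniformly small, which gives uniform continuity of all derivatives of the product. -/
lemma IsTestFunction.mul (hO : IsOpen O) (hφ : IsTestFunction O T φ) (hψ : IsTestFunction O T ψ) :
    IsTestFunction O T (fun x => φ x * ψ x) := by
  choose Cφ hCφ using hφ.bounded
  choose Cψ hCψ using hψ.bounded
  refine hφ.of_support (hφ.contDiffOn.mul hψ.contDiffOn) (fun k => ?_) (fun k => ?_)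
    (fun x _ h => by simp [h])
  · rw [uniformContinuousOn_iff_tendsto_norm]
    have hev : ∀ᶠ p : Sp n × Sp n in uniformity (Sp n) ⊓ 𝓟 (O ×ˢ O), p ∈ O ×ˢ O :=
      mem_inf_of_right (mem_principal_self _)
    refine squeeze_zero' (g := fun p =>
      (∑ i ∈ Finset.range (k + 1), (k.choose i : ℝ) *
        ‖iteratedFDeriv ℝ i φ p.1 - iteratedFDeriv ℝ i φ p.2‖ * Cψ (k - i)) +
      ∑ i ∈ Finset.range (k + 1), (k.choose i : ℝ) * Cφ i *
        ‖iteratedFDeriv ℝ (k - i) ψ p.1 - iteratedFDeriv ℝ (k - i) ψ p.2‖)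
      (Eventually.of_forall fun p => norm_nonneg _) ?_ ?_
    · filter_upwards [hev] with p hp
      refine (norm_iteratedFDeriv_mul_sub_le hO hφ.contDiffOn hψ.contDiffOn hp.1 hp.2 k).trans ?_
      gcongr with i _ i _
      · exact hCψ _ _ hp.1
      · exact hCφ _ _ hp.2
    · have t1 := fun i => uniformContinuousOn_iff_tendsto_norm.1 (hφ.uniformContinuousOn i)
      have t2 := fun i => uniformContinuousOn_iff_tendsto_norm.1 (hψ.uniformContinuousOn i)
      have := (tendsto_finsetSum (Finset.range (k + 1)) fun i _ =>
        ((t1 i).const_mul (k.choose i : ℝ)).mul_const (Cψ (k - i))).add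
        (tendsto_finsetSum (Finset.range (k + 1)) fun i _ =>
        ((t2 (k - i)).const_mul ((k.choose i : ℝ) * Cφ i)))
      simpa using this
  · refine ⟨∑ i ∈ Finset.range (k + 1), (k.choose i : ℝ) * Cφ i * Cψ (k - i), fun x hx => ?_⟩
    have := norm_iteratedFDerivWithin_mul_le hφ.contDiffOn hψ.contDiffOn hO.uniqueDiffOn hx
      (n := k) (by exact_mod_cast le_top)
    simp only [iteratedFDerivWithin_of_isOpen _ hO hx] at this
    refine this.trans ?_
    have hnn : ∀ i, 0 ≤ Cφ i := fun i => (norm_nonneg _).trans (hCφ i x hx)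
    gcongr with i _
    · exact mul_nonneg (Nat.cast_nonneg _) (hnn i)
    · exact hCφ _ _ hx
    · exact hCψ _ _ hx

lemma IsTestFunction.add (hO : IsOpen O) (hφ : IsTestFunction O T φ) (hψ : IsTestFunction O T ψ) :
    IsTestFunction O T (fun x => φ x + ψ x) := by
  have hd : ∀ k : ℕ, ∀ x ∈ O, iteratedFDeriv ℝ k (fun x => φ x + ψ x) x =
      iteratedFDeriv ℝ k φ x + iteratedFDeriv ℝ k ψ x := fun k x hx =>
    iteratedFDeriv_add_apply
      ((hφ.contDiffOn.contDiffAt (hO.mem_nhds hx)).of_le (by exact_mod_cast le_top))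
      ((hψ.contDiffOn.contDiffAt (hO.mem_nhds hx)).of_le (by exact_mod_cast le_top))
  have hsub : closure (O ∩ Function.support fun x => φ x + ψ x) ⊆
      closure (O ∩ Function.support φ) ∪ closure (O ∩ Function.support ψ) := by
    rw [← closure_union]
    refine closure_mono fun x hx => ?_
    by_contra hcon
    simp only [mem_union, mem_inter_iff, Function.mem_support, not_or, not_and, not_not] at hcon
    exact hx.2 (by simp [hcon.1 hx.1, hcon.2 hx.1])
  refine ⟨hφ.contDiffOn.add hψ.contDiffOn, fun k => ?_, fun k => ?_,
    (hφ.isCompact.union hψ.isCompact).of_isClosed_subset isClosed_closure hsub,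
    hsub.trans (union_subset hφ.subset hψ.subset)⟩
  · have h1 := uniformContinuousOn_iff_restrict.1 (hφ.uniformContinuousOn k)
    have h2 := uniformContinuousOn_iff_restrict.1 (hψ.uniformContinuousOn k)
    rw [uniformContinuousOn_iff_restrict]
    convert h1.add h2 using 1
    funext x
    exact hd k x x.2
  · obtain ⟨C, hC⟩ := hφ.bounded k
    obtain ⟨C', hC'⟩ := hψ.bounded k
    refine ⟨C + C', fun x hx => ?_⟩
    rw [hd k x hx]
    exact (norm_add_le _ _).trans (add_le_add (hC x hx) (hC' x hx))

lemma IsTestFunction.const_mul (hO : IsOpen O) (hφ : IsTestFunction O T φ) (c : ℝ) :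
    IsTestFunction O T (fun x => c * φ x) := by
  have hd : ∀ k : ℕ, ∀ x ∈ O, iteratedFDeriv ℝ k (fun x => c * φ x) x =
      c • iteratedFDeriv ℝ k φ x := fun k x hx =>
    iteratedFDeriv_const_smul_apply (a := c)
      ((hφ.contDiffOn.contDiffAt (hO.mem_nhds hx)).of_le (by exact_mod_cast le_top))
  refine hφ.of_support (contDiffOn_const.mul hφ.contDiffOn) (fun k => ?_) (fun k => ?_)
    (fun x _ h => by simp [h])
  · have h1 := uniformContinuousOn_iff_restrict.1 (hφ.uniformContinuousOn k)
    rw [uniformContinuousOn_iff_restrict]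
    convert h1.const_smul c using 1
    funext x
    exact hd k x x.2
  · obtain ⟨C, hC⟩ := hφ.bounded k
    refine ⟨‖c‖ * C, fun x hx => ?_⟩
    rw [hd k x hx, norm_smul]
    exact mul_le_mul_of_nonneg_left (hC x hx) (norm_nonneg _)

lemma IsTestFunction.pow (hO : IsOpen O) (hφ : IsTestFunction O T φ) (k : ℕ) :
    IsTestFunction O T (fun x => φ x ^ (k + 1)) := by
  induction k with
  | zero => simpa using hφ
  | succ k ih =>
    have := ih.mul hO hφ
    simpa only [← pow_succ] using this

/-- A polynomial without constant term, composed with a test function, is a test function. -/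
lemma IsTestFunction.polynomial (hO : IsOpen O) (hφ : IsTestFunction O T φ)
    (p : Polynomial ℝ) : IsTestFunction O T (fun x => (Polynomial.X * p).eval (φ x)) := by
  induction p using Polynomial.induction_on' with
  | add p q hp hq =>
    have := hp.add hO hq
    simpa [mul_add] using this
  | monomial k a =>
    have := (hφ.pow hO k).const_mul hO a
    convert this using 2 with x
    rw [Polynomial.X_mul_monomial, Polynomial.eval_monomial]

lemma gradient_comp {g : ℝ → ℝ} {g' : ℝ} {x : Sp n} (hg : HasDerivAt g g' (φ x))
    (hφ : DifferentiableAt ℝ φ x) : gradient (fun y => g (φ y)) x = g' • gradient φ x := by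
  have : HasFDerivAt (fun y => g (φ y)) (g' • fderiv ℝ φ x) x :=
    hg.comp_hasFDerivAt x hφ.hasFDerivAt
  rw [gradient, gradient, this.fderiv]
  simp

/-- The antiderivative is normalized to vanish at `0`. A constant term would destroy the condition
that the support be a compact subset of `T`. -/
lemma exists_polynomial_derivative_eq (q : Polynomial ℝ) :
    ∃ p : Polynomial ℝ, (Polynomial.X * p).derivative = q := by
  induction q using Polynomial.induction_on' with
  | add p q hp hq =>
    obtain ⟨p', rfl⟩ := hp
    obtain ⟨q', rfl⟩ := hq
    exact ⟨p' + q', by simp [mul_add]⟩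
  | monomial k a =>
    refine ⟨Polynomial.monomial k (a / (k + 1)), ?_⟩
    rw [Polynomial.X_mul_monomial, Polynomial.derivative_monomial]
    congr 1
    push_cast
    field_simp

end TestFunctions

/-! ### Chain rule and positive parts -/

section Composition

variable {n : ℕ} {O T : Set (Sp n)} {θ w : Sp n → ℝ}

/-- The primitive of `g` that vanishes at the origin. -/
def primitive (g : ℝ → ℝ) (s : ℝ) : ℝ := ∫ t in (0 : ℝ)..s, g t

lemma hasDerivAt_primitive {g : ℝ → ℝ} (hg : Continuous g) (s : ℝ) :
    HasDerivAt (primitive g) (g s) s :=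
  intervalIntegral.integral_hasDerivAt_right (hg.intervalIntegrable _ _)
    (hg.stronglyMeasurableAtFilter _ _) hg.continuousAt

lemma continuous_primitive {g : ℝ → ℝ} (hg : Continuous g) : Continuous (primitive g) :=
  continuous_iff_continuousAt.2 fun s => (hasDerivAt_primitive hg s).continuousAt

lemma abs_primitive_sub_le {g : ℝ → ℝ} {L : ℝ} (hg : Continuous g) (hL : ∀ t, |g t| ≤ L)
    (a b : ℝ) : |primitive g a - primitive g b| ≤ L * |a - b| := by
  rw [primitive, primitive, intervalIntegral.integral_interval_sub_left
    (hg.intervalIntegrable _ _) (hg.intervalIntegrable _ _)]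
  exact intervalIntegral.norm_integral_le_of_norm_le_const (f := g) fun t _ => hL t

lemma abs_primitive_le {g : ℝ → ℝ} {L : ℝ} (hL : ∀ t, |g t| ≤ L)
    (a : ℝ) : |primitive g a| ≤ L * |a| := by
  simpa [primitive] using intervalIntegral.norm_integral_le_of_norm_le_const (a := 0) (b := a)
    (f := g) fun t _ => hL t

lemma primitive_eq_of_hasDerivAt {f g : ℝ → ℝ} (hg : Continuous g) (hf : ∀ s, HasDerivAt f (g s) s)
    (h0 : f 0 = 0) : primitive g = f := by
  funext s
  rw [primitive, intervalIntegral.integral_eq_sub_of_hasDerivAt (fun t _ => hf t)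
    (hg.intervalIntegrable _ _), h0, sub_zero]

/-- For merely continuous `g`, the composition is not a test function. Weierstrass approximation of
`g` on the range of `φ` gives polynomial compositions, which are test functions and converge with
their gradients. -/
lemma IsTestFunction.isSobolev_primitive {φ : Sp n → ℝ} (hφ : IsTestFunction O T φ)
    (W : NormWeights O θ w) {g : ℝ → ℝ} (hg : Continuous g) :
    IsSobolev O T θ w (fun x => primitive g (φ x)) (fun x => g (φ x) • gradient φ x) := by
  have hO := W.isOpen
  obtain ⟨M, hM⟩ := hφ.exists_bound
  obtain ⟨M', hM'⟩ := hφ.exists_bound_gradient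
  have hpoly := fun k : ℕ => exists_polynomial_near_of_continuousOn (-M) M g hg.continuousOn
    (1 / (k + 1 : ℝ)) (by positivity)
  choose q hq using hpoly
  choose p hp using fun k => exists_polynomial_derivative_eq (q k)
  have hP : ∀ k s, HasDerivAt (fun s => (Polynomial.X * p k).eval s) ((q k).eval s) s := by
    intro k s
    rw [← hp k]
    exact (Polynomial.X * p k).hasDerivAt s
  -- Both functions are primitives vanishing at `0`, so their distance is at most `|s|` times the
  -- uniform distance of the integrands.
  have hclose : ∀ k : ℕ, ∀ s ∈ Icc (-M) M,
      |(Polynomial.X * p k).eval s - primitive g s| ≤ 1 / (k + 1 : ℝ) * |s| := by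
    intro k s hs
    have hs' := congrFun (primitive_eq_of_hasDerivAt (q k).continuous (hP k) (by simp)) s
    rw [← hs', primitive, primitive,
      ← intervalIntegral.integral_sub ((q k).continuous.intervalIntegrable _ _)
        (hg.intervalIntegrable _ _)]
    have := intervalIntegral.norm_integral_le_of_norm_le_const (a := 0) (b := s)
      (f := fun t => (q k).eval t - g t) (C := 1 / (k + 1 : ℝ)) (fun t ht => (hq k t ?_).le)
    · simpa using this
    · have h0 : (0 : ℝ) ∈ Icc (-M) M := by
        have : 0 ≤ M := by linarith [hs.1, hs.2]
        exact ⟨by linarith, this⟩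
      exact (convex_Icc (-M) M).ordConnected.uIcc_subset h0 hs (uIoc_subset_uIcc ht)
  have hmem : ∀ x ∈ O, φ x ∈ Icc (-M) M := fun x hx => abs_le.1 (hM x hx)
  have hone : ∀ k : ℕ, 1 / (k + 1 : ℝ) ≤ 1 := fun k => by
    rw [div_le_one (by positivity)]; linarith [(Nat.cast_nonneg k : (0 : ℝ) ≤ k)]
  have hSob : ∀ k, IsSobolev O T θ w (fun x => (Polynomial.X * p k).eval (φ x))
      (fun x => (q k).eval (φ x) • gradient φ x) := fun k =>
    ((hφ.polynomial hO (p k)).isSobolev W).congr EventuallyEq.rfl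
      ((ae_restrict_mem hO.measurableSet).mono fun x hx =>
        gradient_comp (hP k _) (hφ.differentiableAt hO hx))
  have mφ := hφ.aesm hO
  have mg := hφ.aesm_gradient hO
  have m1 : AEStronglyMeasurable (fun x => primitive g (φ x)) (volume.restrict O) :=
    (continuous_primitive hg).comp_aestronglyMeasurable mφ
  have m2 : AEStronglyMeasurable (fun x => g (φ x) • gradient φ x) (volume.restrict O) :=
    (hg.comp_aestronglyMeasurable mφ).smul mg
  refine IsSobolev.of_tendsto W hSob m1 m2 ?_ ?_
  · have := W.fst.isFiniteMeasure
    refine tendsto_eLpNorm_two_of_dominated (g := fun _ => M) (fun k => ?_) (memLp_const _)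
      (fun k => ?_) ?_
    · exact ((hSob k).memLp_fst W).1.sub ((W.fst.aestronglyMeasurable_iff hO).2 m1)
    · rw [W.fst.ae_iff hO]
      filter_upwards [ae_restrict_mem hO.measurableSet] with x hx
      refine (hclose k _ (hmem x hx)).trans ?_
      calc 1 / (k + 1 : ℝ) * |φ x| ≤ 1 * M :=
            mul_le_mul (hone k) (hM x hx) (abs_nonneg _) zero_le_one
        _ ≤ ‖M‖ := by rw [one_mul]; exact le_abs_self M
    · rw [W.fst.ae_iff hO]
      filter_upwards [ae_restrict_mem hO.measurableSet] with x hx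
      refine squeeze_zero_norm (fun k => hclose k _ (hmem x hx)) ?_
      simpa using (tendsto_one_div_add_atTop_nhds_zero_nat (𝕜 := ℝ)).mul_const |φ x|
  · have := W.snd.isFiniteMeasure
    have hb : ∀ k : ℕ, ∀ x ∈ O, ‖(q k).eval (φ x) • gradient φ x - g (φ x) • gradient φ x‖ ≤
        1 / (k + 1 : ℝ) * ‖gradient φ x‖ := by
      intro k x hx
      rw [← sub_smul, norm_smul]
      gcongr
      exact (hq k _ (hmem x hx)).le
    refine tendsto_eLpNorm_two_of_dominated (g := fun _ => M') (fun k => ?_) (memLp_const _)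
      (fun k => ?_) ?_
    · exact ((hSob k).memLp_snd W).1.sub ((W.snd.aestronglyMeasurable_iff hO).2 m2)
    · rw [W.snd.ae_iff hO]
      filter_upwards [ae_restrict_mem hO.measurableSet] with x hx
      refine (hb k x hx).trans ?_
      calc 1 / (k + 1 : ℝ) * ‖gradient φ x‖ ≤ 1 * M' :=
            mul_le_mul (hone k) (hM' x hx) (norm_nonneg _) zero_le_one
        _ ≤ ‖M'‖ := by rw [one_mul]; exact le_abs_self M'
    · rw [W.snd.ae_iff hO]
      filter_upwards [ae_restrict_mem hO.measurableSet] with x hx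
      refine squeeze_zero_norm (fun k => hb k x hx) ?_
      simpa using (tendsto_one_div_add_atTop_nhds_zero_nat (𝕜 := ℝ)).mul_const ‖gradient φ x‖

lemma tendsto_eLpNorm_of_norm_le_mul {X E F : Type*} [MeasurableSpace X] [NormedAddCommGroup E]
    [NormedAddCommGroup F] {μ : Measure X} {f : ℕ → X → E} {g : ℕ → X → F} {L : ℝ}
    (h : ∀ k, ∀ᵐ x ∂μ, ‖f k x‖ ≤ L * ‖g k x‖)
    (hg : Tendsto (fun k => eLpNorm (g k) 2 μ) atTop (𝓝 0)) :
    Tendsto (fun k => eLpNorm (f k) 2 μ) atTop (𝓝 0) := by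
  have h2 : Tendsto (fun k => ENNReal.ofReal L * eLpNorm (g k) 2 μ) atTop (𝓝 0) := by
    simpa using ENNReal.Tendsto.const_mul hg (Or.inr ENNReal.ofReal_ne_top)
  exact tendsto_of_tendsto_of_tendsto_of_le_of_le tendsto_const_nhds h2 (fun _ => zero_le)
    fun k => eLpNorm_le_mul_eLpNorm_of_ae_le_mul (h k) 2

/-- Pass from test functions `φ k` to their limit `f`. The functions converge by the Lipschitz
bound. The gradient error splits into `g (φ k) • (Dφ k - G)`, controlled by norm convergence, and
`(g (φ k) - g f) • G`, controlled by dominated convergence. -/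
lemma IsSobolev.primitive_of_continuous {f : Sp n → ℝ} {G : Sp n → Sp n}
    (h : IsSobolev O T θ w f G) (W : NormWeights O θ w) {g : ℝ → ℝ} (hg : Continuous g) {L : ℝ}
    (hL : ∀ t, |g t| ≤ L) :
    IsSobolev O T θ w (fun x => primitive g (f x)) (fun x => g (f x) • G x) := by
  have hO := W.isOpen
  obtain ⟨φ, hφ, e1, e2, a1, -⟩ := h.exists_seq W
  have mf := h.aesm_fst W
  have mG := h.aesm_snd W
  have m1 : AEStronglyMeasurable (fun x => primitive g (f x)) (volume.restrict O) :=
    (continuous_primitive hg).comp_aestronglyMeasurable mf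
  have m2 : AEStronglyMeasurable (fun x => g (f x) • G x) (volume.restrict O) :=
    (hg.comp_aestronglyMeasurable mf).smul mG
  refine IsSobolev.of_tendsto W (fun k => (hφ k).isSobolev_primitive W hg) m1 m2 ?_ ?_
  · refine tendsto_eLpNorm_of_norm_le_mul (L := L) (fun k => Eventually.of_forall fun x => ?_) e1
    exact abs_primitive_sub_le hg hL _ _
  · have mk := fun k => hg.comp_aestronglyMeasurable ((hφ k).aesm hO)
    have t1 : Tendsto (fun k => eLpNorm (fun x => g (φ k x) • (gradient (φ k) x - G x)) 2
        (weightedMeasure O (fun x => θ x * w x))) atTop (𝓝 0) := by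
      refine tendsto_eLpNorm_of_norm_le_mul (L := L)
        (fun k => Eventually.of_forall fun x => ?_) e2
      rw [norm_smul, Pi.sub_apply]
      gcongr
      exact hL _
    have t2 : Tendsto (fun k => eLpNorm (fun x => (g (φ k x) - g (f x)) • G x) 2
        (weightedMeasure O (fun x => θ x * w x))) atTop (𝓝 0) := by
      refine tendsto_eLpNorm_two_of_dominated (g := fun x => 2 * L * ‖G x‖) (fun k => ?_)
        ((h.memLp_snd W).norm.const_mul _) (fun k => Eventually.of_forall fun x => ?_) ?_
      · exact (W.snd.aestronglyMeasurable_iff hO).2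
          (((mk k).sub (hg.comp_aestronglyMeasurable mf)).smul mG)
      · have h1 := hL (φ k x)
        have h2 := hL (f x)
        have h3 : |g (φ k x) - g (f x)| ≤ 2 * L := (abs_sub _ _).trans (by linarith)
        rw [norm_smul]
        refine le_trans ?_ (le_abs_self _)
        gcongr
        exact h3
      · rw [W.snd.ae_iff hO]
        filter_upwards [a1] with x hx
        have := ((hg.tendsto _).comp hx).sub_const (g (f x))
        simpa using this.smul_const (G x)
    have t3 := t1.add t2
    rw [add_zero] at t3
    refine tendsto_of_tendsto_of_tendsto_of_le_of_le tendsto_const_nhds t3 (fun _ => zero_le)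
      fun k => ?_
    have hdec : ((fun x => g (φ k x) • gradient (φ k) x) - fun x => g (f x) • G x) =
        (fun x => g (φ k x) • (gradient (φ k) x - G x)) +
          fun x => (g (φ k x) - g (f x)) • G x := by
      funext x
      simp only [Pi.sub_apply, Pi.add_apply, smul_sub, sub_smul]
      abel
    simp only [hdec]
    refine eLpNorm_add_le ?_ ?_ one_le_two
    · exact (W.snd.aestronglyMeasurable_iff hO).2
        ((mk k).smul (((hφ k).aesm_gradient hO).sub mG))
    · exact (W.snd.aestronglyMeasurable_iff hO).2
          (((mk k).sub (hg.comp_aestronglyMeasurable mf)).smul mG)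

/-- Chain rule for a Lipschitz function whose derivative `g` is a bounded pointwise limit of
continuous functions. -/
lemma IsSobolev.primitive_of_tendsto {f : Sp n → ℝ} {G : Sp n → Sp n}
    (h : IsSobolev O T θ w f G) (W : NormWeights O θ w) {g : ℕ → ℝ → ℝ} {g' : ℝ → ℝ}
    (hg : ∀ k, Continuous (g k)) {L : ℝ} (hL : ∀ k t, |g k t| ≤ L)
    (hlim : ∀ t, Tendsto (fun k => g k t) atTop (𝓝 (g' t))) :
    IsSobolev O T θ w (fun x => primitive g' (f x)) (fun x => g' (f x) • G x) := by
  have hO := W.isOpen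
  have mf := h.aesm_fst W
  have mG := h.aesm_snd W
  have hL' : ∀ t, |g' t| ≤ L := fun t => le_of_tendsto (hlim t).abs (Eventually.of_forall (hL · t))
  have hp : ∀ s, Tendsto (fun k => primitive (g k) s) atTop (𝓝 (primitive g' s)) := by
    intro s
    refine intervalIntegral.tendsto_integral_filter_of_dominated_convergence (fun _ => L)
      (Eventually.of_forall fun k => (hg k).aestronglyMeasurable)
      (Eventually.of_forall fun k => Eventually.of_forall fun t _ => hL k t) (by simp)
      (Eventually.of_forall fun t _ => hlim t)
  have m1 : AEStronglyMeasurable (fun x => primitive g' (f x)) (volume.restrict O) :=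
    aestronglyMeasurable_of_tendsto_ae atTop
      (fun k => (continuous_primitive (hg k)).comp_aestronglyMeasurable mf)
      (Eventually.of_forall fun x => hp (f x))
  have m2 : AEStronglyMeasurable (fun x => g' (f x) • G x) (volume.restrict O) :=
    aestronglyMeasurable_of_tendsto_ae atTop
      (fun k => ((hg k).comp_aestronglyMeasurable mf).smul mG)
      (Eventually.of_forall fun x => (hlim (f x)).smul_const (G x))
  have hS := fun k => h.primitive_of_continuous W (hg k) (hL k)
  refine IsSobolev.of_tendsto W hS m1 m2 ?_ ?_
  · refine tendsto_eLpNorm_two_of_dominated (g := fun x => 2 * L * |f x|) (fun k => ?_)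
      ((h.memLp_fst W).norm.const_mul _) (fun k => Eventually.of_forall fun x => ?_) ?_
    · exact ((hS k).memLp_fst W).1.sub ((W.fst.aestronglyMeasurable_iff hO).2 m1)
    · refine le_trans ((abs_sub _ _).trans ?_) (le_abs_self _)
      linarith [abs_primitive_le (hL k) (f x), abs_primitive_le hL' (f x)]
    · refine Eventually.of_forall fun x => ?_
      simpa using (hp (f x)).sub_const (primitive g' (f x))
  · refine tendsto_eLpNorm_two_of_dominated (g := fun x => 2 * L * ‖G x‖) (fun k => ?_)
      ((h.memLp_snd W).norm.const_mul _) (fun k => Eventually.of_forall fun x => ?_) ?_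
    · exact ((hS k).memLp_snd W).1.sub ((W.snd.aestronglyMeasurable_iff hO).2 m2)
    · have h3 : |g k (f x) - g' (f x)| ≤ 2 * L :=
        (abs_sub _ _).trans (by linarith [hL k (f x), hL' (f x)])
      rw [Pi.sub_apply, ← sub_smul, norm_smul]
      refine le_trans ?_ (le_abs_self _)
      gcongr
      exact h3
    · refine Eventually.of_forall fun x => ?_
      simpa using ((hlim (f x)).smul_const (G x)).sub_const (g' (f x) • G x)

/-- Chain rule for a `C¹` function with bounded derivative that vanishes at the origin. -/
lemma IsSobolev.comp {f : Sp n → ℝ} {G : Sp n → Sp n} (h : IsSobolev O T θ w f G)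
    (W : NormWeights O θ w) {F g : ℝ → ℝ} (hF : ∀ s, HasDerivAt F (g s) s) (hF0 : F 0 = 0)
    (hg : Continuous g) {L : ℝ} (hL : ∀ t, |g t| ≤ L) :
    IsSobolev O T θ w (fun x => F (f x)) (fun x => g (f x) • G x) := by
  simpa only [primitive_eq_of_hasDerivAt hg hF hF0] using h.primitive_of_continuous W hg hL

lemma primitive_indicator_Ioi {m : ℝ} (hm : 0 ≤ m) (s : ℝ) :
    primitive ((Ioi m).indicator fun _ => 1) s = max (s - m) 0 := by
  rw [primitive]
  rcases le_or_gt s m with hs | hs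
  · rw [max_eq_right (by linarith)]
    refine intervalIntegral.integral_zero_ae (Eventually.of_forall fun t ht => ?_)
    exact indicator_of_notMem (notMem_Ioi.2 (ht.2.trans (max_le hm hs))) _
  · rw [max_eq_left (by linarith), intervalIntegral.integral_of_le (by linarith),
      setIntegral_indicator measurableSet_Ioi]
    have : Ioc 0 s ∩ Ioi m = Ioc m s := by
      ext t
      simp only [mem_inter_iff, mem_Ioc, mem_Ioi]
      constructor
      · rintro ⟨⟨_, h2⟩, h3⟩
        exact ⟨h3, h2⟩
      · rintro ⟨h1, h2⟩
        exact ⟨⟨by linarith, h2⟩, h1⟩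
    simp [this, hs.le]

/-- Changing the integrand at the single point `m` does not change the primitive. This is why `(f -
m)⁺` will acquire two expressions for its gradient, differing exactly on `{f = m}`. -/
lemma primitive_indicator_Ici {m : ℝ} (hm : 0 ≤ m) (s : ℝ) :
    primitive ((Ici m).indicator fun _ => 1) s = max (s - m) 0 := by
  rw [← primitive_indicator_Ioi hm]
  refine intervalIntegral.integral_congr_ae ?_
  filter_upwards [compl_mem_ae_iff.2 (measure_singleton m)] with t ht _
  have : t ≠ m := ht
  simp [indicator, le_iff_lt_or_eq, this.symm]

/-- The positive part `(f - m)⁺`, `m ≥ 0`, with gradient `1_{f > m} G`. -/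
lemma IsSobolev.posPart {f : Sp n → ℝ} {G : Sp n → Sp n} (h : IsSobolev O T θ w f G)
    (W : NormWeights O θ w) {m : ℝ} (hm : 0 ≤ m) :
    IsSobolev O T θ w (fun x => max (f x - m) 0)
      (fun x => (Ioi m).indicator (fun _ => (1 : ℝ)) (f x) • G x) := by
  -- These ramps rise to the right of `m`, so their limit at `t = m` is `0`.
  have := h.primitive_of_tendsto W (g := fun k t => min (max (k * (t - m)) 0) 1)
    (g' := (Ioi m).indicator fun _ => 1) (L := 1) (fun k => by fun_prop) (fun k t => ?_)
    (fun t => ?_)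
  · simpa only [primitive_indicator_Ioi hm] using this
  · rw [abs_le]
    constructor
    · exact (by norm_num : (-1 : ℝ) ≤ 0).trans (le_min (le_max_right _ _) zero_le_one)
    · exact min_le_right _ _
  · by_cases ht : m < t
    · have h1 : Tendsto (fun k : ℕ => (k : ℝ) * (t - m)) atTop atTop :=
        tendsto_natCast_atTop_atTop.atTop_mul_const (sub_pos.2 ht)
      refine tendsto_const_nhds.congr' ?_
      filter_upwards [h1.eventually_ge_atTop 1] with k hk
      rw [indicator_of_mem (show t ∈ Ioi m from ht), max_eq_left (by linarith), min_eq_right hk]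
    · rw [indicator_of_notMem (show t ∉ Ioi m from ht)]
      refine tendsto_const_nhds.congr fun k => ?_
      rw [max_eq_right, min_eq_left zero_le_one]
      exact mul_nonpos_of_nonneg_of_nonpos (Nat.cast_nonneg _) (by linarith)

/-- The positive part `(f - m)⁺`, `m ≥ 0`, with gradient `1_{f ≥ m} G`. -/
lemma IsSobolev.posPart' {f : Sp n → ℝ} {G : Sp n → Sp n} (h : IsSobolev O T θ w f G)
    (W : NormWeights O θ w) {m : ℝ} (hm : 0 ≤ m) :
    IsSobolev O T θ w (fun x => max (f x - m) 0)
      (fun x => (Ici m).indicator (fun _ => (1 : ℝ)) (f x) • G x) := by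
  -- These ramps rise to the left of `m` and already equal `1` at `t = m`, so the limit includes the
  -- endpoint.
  have := h.primitive_of_tendsto W (g := fun k t => min (max (k * (t - m) + 1) 0) 1)
    (g' := (Ici m).indicator fun _ => 1) (L := 1) (fun k => by fun_prop) (fun k t => ?_)
    (fun t => ?_)
  · simpa only [primitive_indicator_Ici hm] using this
  · rw [abs_le]
    constructor
    · exact (by norm_num : (-1 : ℝ) ≤ 0).trans (le_min (le_max_right _ _) zero_le_one)
    · exact min_le_right _ _
  · by_cases ht : m ≤ t
    · refine tendsto_const_nhds.congr fun k => ?_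
      have : 0 ≤ (k : ℝ) * (t - m) := mul_nonneg (Nat.cast_nonneg _) (by linarith)
      rw [indicator_of_mem (show t ∈ Ici m from ht), max_eq_left (by linarith),
        min_eq_right (by linarith)]
    · have h1 : Tendsto (fun k : ℕ => (k : ℝ) * (m - t)) atTop atTop :=
        tendsto_natCast_atTop_atTop.atTop_mul_const (by linarith)
      rw [indicator_of_notMem (show t ∉ Ici m from ht)]
      refine tendsto_const_nhds.congr' ?_
      filter_upwards [h1.eventually_ge_atTop 1] with k hk
      rw [max_eq_right (by linarith), min_eq_left zero_le_one]

end Composition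

/-! ### Integration by parts and uniqueness of the gradient -/

section WeakDerivative

variable {n : ℕ} {O T T' : Set (Sp n)} {θ w ρ : Sp n → ℝ}

/-- A continuous positive weight is bounded below on compact subsets of `O`, so degeneracy at the
boundary is invisible to compactly supported test functions. -/
lemma IsWeight.exists_one_le_mul (h : IsWeight O ρ) {K : Set (Sp n)} (hK : IsCompact K)
    (hKO : K ⊆ O) : ∃ C, 0 ≤ C ∧ ∀ x ∈ K, 1 ≤ C * ρ x := by
  rcases K.eq_empty_or_nonempty with rfl | hne
  · exact ⟨0, le_rfl, by simp⟩
  obtain ⟨x₀, hx₀, hmin⟩ := hK.exists_isMinOn hne (h.continuousOn.mono hKO)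
  have hpos := h.pos x₀ (hKO hx₀)
  refine ⟨(ρ x₀)⁻¹, (inv_pos.2 hpos).le, fun x hx => ?_⟩
  rw [inv_mul_eq_div, one_le_div hpos]
  exact hmin hx

lemma IsWeight.exists_abs_le_mul (h : IsWeight O ρ) {ψ : Sp n → ℝ} (hψ : Continuous ψ)
    (hc : HasCompactSupport ψ) (hs : tsupport ψ ⊆ O) : ∃ C, 0 ≤ C ∧ ∀ x ∈ O, |ψ x| ≤ C * ρ x := by
  obtain ⟨C, hC0, hC⟩ := h.exists_one_le_mul hc hs
  obtain ⟨M, hM⟩ := hc.exists_bound_of_continuous hψ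
  have hM0 : 0 ≤ M := (norm_nonneg _).trans (hM 0)
  refine ⟨M * C, mul_nonneg hM0 hC0, fun x hx => ?_⟩
  by_cases hxs : x ∈ tsupport ψ
  · rw [mul_assoc]
    exact (hM x).trans (le_mul_of_one_le_right hM0 (hC x hxs))
  · rw [image_eq_zero_of_notMem_tsupport hxs, abs_zero]
    exact mul_nonneg (mul_nonneg hM0 hC0) (h.pos x hx).le

/-- The factor `η` is absorbed into the weight, and Cauchy–Schwarz on the weighted measure does the
rest. Convergence in weighted `L²` thus implies convergence of unweighted integrals against `η`. -/
lemma IsWeight.lintegral_mul_le (h : IsWeight O ρ) (hO : IsOpen O) {η : Sp n → ℝ} {C : ℝ}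
    (hη : ∀ x ∈ O, |η x| ≤ C * ρ x) {F : Sp n → ℝ}
    (hF : AEStronglyMeasurable F (volume.restrict O)) :
    ∫⁻ x in O, ‖η x * F x‖ₑ ≤ ENNReal.ofReal C *
      (eLpNorm F 2 (weightedMeasure O ρ) * weightedMeasure O ρ univ ^ (1 / 2 : ℝ)) := by
  have h1 : eLpNorm F 1 (weightedMeasure O ρ) ≤
      eLpNorm F 2 (weightedMeasure O ρ) * weightedMeasure O ρ univ ^ (1 / 2 : ℝ) := by
    have := eLpNorm_le_eLpNorm_mul_rpow_measure_univ (p := 1) (q := 2) one_le_two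
      ((h.aestronglyMeasurable_iff hO).2 hF)
    convert this using 3
    norm_num
  refine le_trans ?_ (mul_le_mul_right h1 _)
  rw [eLpNorm_one_eq_lintegral_enorm, h.lintegral_eq hO,
    ← lintegral_const_mul' _ _ ENNReal.ofReal_ne_top]
  refine lintegral_mono_ae ?_
  filter_upwards [ae_restrict_mem hO.measurableSet] with x hx
  have hC : 0 ≤ C := by
    have := (abs_nonneg _).trans (hη x hx)
    exact nonneg_of_mul_nonneg_left this (h.pos x hx)
  rw [enorm_mul, ← mul_assoc, ← ENNReal.ofReal_mul hC]
  gcongr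
  rw [Real.enorm_eq_ofReal_abs]
  exact ENNReal.ofReal_le_ofReal (hη x hx)

lemma IsWeight.integrableOn_mul (h : IsWeight O ρ) (hO : IsOpen O) {η : Sp n → ℝ} {C : ℝ}
    (hη : ∀ x ∈ O, |η x| ≤ C * ρ x) (hm : AEStronglyMeasurable η (volume.restrict O))
    {F : Sp n → ℝ} (hF : MemLp F 2 (weightedMeasure O ρ)) :
    IntegrableOn (fun x => η x * F x) O := by
  have hF' := (h.aestronglyMeasurable_iff hO).1 hF.1
  have := h.isFiniteMeasure
  refine ⟨hm.mul hF', lt_of_le_of_lt (h.lintegral_mul_le hO hη hF') ?_⟩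
  exact ENNReal.mul_lt_top ENNReal.ofReal_lt_top
    (ENNReal.mul_lt_top hF.2 (ENNReal.rpow_lt_top_of_nonneg (by norm_num) (measure_ne_top _ _)))

lemma IsWeight.tendsto_integral_mul (h : IsWeight O ρ) (hO : IsOpen O) {η : Sp n → ℝ} {C : ℝ}
    (hη : ∀ x ∈ O, |η x| ≤ C * ρ x) (hm : AEStronglyMeasurable η (volume.restrict O))
    {F : ℕ → Sp n → ℝ} {F' : Sp n → ℝ} (hF : ∀ k, MemLp (F k) 2 (weightedMeasure O ρ))
    (hF' : MemLp F' 2 (weightedMeasure O ρ))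
    (hlim : Tendsto (fun k => eLpNorm (F k - F') 2 (weightedMeasure O ρ)) atTop (𝓝 0)) :
    Tendsto (fun k => ∫ x in O, η x * F k x) atTop (𝓝 (∫ x in O, η x * F' x)) := by
  have := h.isFiniteMeasure
  refine tendsto_integral_of_L1 _ (h.integrableOn_mul hO hη hm hF').1
    (Eventually.of_forall fun k => h.integrableOn_mul hO hη hm (hF k)) ?_
  have hz : Tendsto (fun k => ENNReal.ofReal C * (eLpNorm (F k - F') 2 (weightedMeasure O ρ) *
      weightedMeasure O ρ univ ^ (1 / 2 : ℝ))) atTop (𝓝 0) := by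
    have h1 := ENNReal.Tendsto.mul_const (b := weightedMeasure O ρ univ ^ (1 / 2 : ℝ)) hlim
      (Or.inr (ENNReal.rpow_lt_top_of_nonneg (by norm_num) (measure_ne_top _ _)).ne)
    have h2 := ENNReal.Tendsto.const_mul (a := ENNReal.ofReal C) h1
      (Or.inr ENNReal.ofReal_ne_top)
    simpa using h2
  refine tendsto_of_tendsto_of_tendsto_of_le_of_le tendsto_const_nhds hz (fun _ => zero_le)
    fun k => ?_
  have := h.lintegral_mul_le hO hη ((h.aestronglyMeasurable_iff hO).1 ((hF k).sub hF').1)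
  simpa only [Pi.sub_apply, mul_sub] using this

lemma IsTestFunction.integral_mul_inner_gradient {φ ψ : Sp n → ℝ} (hφ : IsTestFunction O T φ)
    (hO : IsOpen O) (hψ : ContDiff ℝ ∞ ψ) (hc : HasCompactSupport ψ) (hs : tsupport ψ ⊆ O)
    (e : Sp n) :
    ∫ x in O, ψ x * inner ℝ (gradient φ x) e = -∫ x in O, fderiv ℝ ψ x e * φ x := by
  have hψ' : Continuous fun x => fderiv ℝ ψ x e :=
    (hψ.continuous_fderiv (by simp)).clm_apply continuous_const
  have hs' : tsupport (fun x => fderiv ℝ ψ x e) ⊆ tsupport ψ := by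
    refine closure_minimal (fun x hx => ?_) isClosed_closure
    by_contra hcon
    refine hx ?_
    have : fderiv ℝ ψ x = 0 := by
      by_contra hne
      exact hcon (support_fderiv_subset ℝ hne)
    simp [this]
  -- Although `F` is controlled only on `O`, the product is continuous on the whole space because
  -- `η` vanishes near every point outside `O`.
  have key : ∀ {η F : Sp n → ℝ}, Continuous η → tsupport η ⊆ tsupport ψ → ContinuousOn F O →
      Integrable (fun x => η x * F x) := by
    intro η F hη hηs hF
    have hcts : Continuous fun x => η x * F x := by
      refine continuous_iff_continuousAt.2 fun x => ?_
      by_cases hx : x ∈ O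
      · exact hη.continuousAt.mul (hF.continuousAt (hO.mem_nhds hx))
      · have : x ∉ tsupport η := fun h => hx (hs (hηs h))
        have hev := notMem_tsupport_iff_eventuallyEq.1 this
        refine (continuousAt_const (y := (0 : ℝ))).congr ?_
        filter_upwards [hev] with y hy
        simp [hy]
    refine hcts.integrable_of_hasCompactSupport (HasCompactSupport.mul_right ?_)
    exact hc.of_isClosed_subset (isClosed_tsupport _) hηs
  have hout : ∀ {η F : Sp n → ℝ}, tsupport η ⊆ tsupport ψ → ∀ x, x ∉ O → η x * F x = 0 := by
    intro η F hη x hx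
    rw [image_eq_zero_of_notMem_tsupport fun h => hx (hs (hη h)), zero_mul]
  rw [setIntegral_eq_integral_of_forall_compl_eq_zero (hout subset_rfl),
    setIntegral_eq_integral_of_forall_compl_eq_zero (hout hs')]
  have hin : ∀ x, inner ℝ (gradient φ x) e = fderiv ℝ φ x e := fun x => by
    simp [gradient]
  simp only [hin]
  have cφ' : ContinuousOn (fun x => fderiv ℝ φ x e) O :=
    (hφ.continuousOn_fderiv hO).clm_apply continuousOn_const
  exact integral_bilinear_fderiv_right_eq_neg_left_of_integrable (μ := volume)
    (B := ContinuousLinearMap.mul ℝ ℝ) (f := ψ) (g := φ) (v := e)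
    (key hψ' hs' hφ.contDiffOn.continuousOn) (key hψ.continuous subset_rfl cφ')
    (key hψ.continuous subset_rfl hφ.contDiffOn.continuousOn)
    (fun x _ => hψ.differentiable (by simp) x)
    (fun x hx => hφ.differentiableAt hO (hs hx))

/-- Integration by parts for test functions passes to the limit on both sides, because `ψ` and its
derivative are dominated by multiples of the two weights. -/
lemma IsSobolev.integral_mul_inner {f : Sp n → ℝ} {G : Sp n → Sp n} (h : IsSobolev O T θ w f G)
    (W : NormWeights O θ w) {ψ : Sp n → ℝ} (hψ : ContDiff ℝ ∞ ψ) (hc : HasCompactSupport ψ)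
    (hs : tsupport ψ ⊆ O) (e : Sp n) :
    ∫ x in O, ψ x * inner ℝ (G x) e = -∫ x in O, fderiv ℝ ψ x e * f x := by
  have hO := W.isOpen
  have hψ' : Continuous fun x => fderiv ℝ ψ x e :=
    (hψ.continuous_fderiv (by simp)).clm_apply continuous_const
  have hsup : Function.support (fun x => fderiv ℝ ψ x e) ⊆ tsupport ψ := by
    intro x hx
    refine support_fderiv_subset ℝ (f := ψ) fun h0 => hx ?_
    simp [h0]
  have hs' : tsupport (fun x => fderiv ℝ ψ x e) ⊆ tsupport ψ :=
    closure_minimal hsup isClosed_closure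
  have hc' : HasCompactSupport fun x => fderiv ℝ ψ x e :=
    hc.of_isClosed_subset (isClosed_tsupport _) hs'
  obtain ⟨φ, hφ, e1, e2, -, -⟩ := h.exists_seq W
  obtain ⟨C1, -, hC1⟩ := W.snd.exists_abs_le_mul hψ.continuous hc hs
  obtain ⟨C2, -, hC2⟩ := W.fst.exists_abs_le_mul hψ' hc' (hs'.trans hs)
  have l1 := W.snd.tendsto_integral_mul hO hC1 hψ.continuous.aestronglyMeasurable
    (F := fun k x => inner ℝ (gradient (φ k) x) e) (F' := fun x => inner ℝ (G x) e)
    (fun k => (((hφ k).isSobolev W).memLp_snd W).inner_const e)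
    ((h.memLp_snd W).inner_const e) (by
      refine tendsto_eLpNorm_of_norm_le_mul (L := ‖e‖)
        (fun k => Eventually.of_forall fun x => ?_) e2
      simp only [Pi.sub_apply]
      rw [← inner_sub_left, mul_comm]
      exact norm_inner_le_norm _ _)
  have l2 := W.fst.tendsto_integral_mul hO hC2 hψ'.aestronglyMeasurable
    (fun k => ((hφ k).isSobolev W).memLp_fst W) (h.memLp_fst W) e1
  refine tendsto_nhds_unique l1 (l2.neg.congr fun k => ?_)
  exact ((hφ k).integral_mul_inner_gradient hO hψ hc hs e).symm

/-- The gradient of an element of `H¹` is determined by the function. -/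
lemma IsSobolev.gradient_unique {f : Sp n → ℝ} {G G' : Sp n → Sp n}
    (h : IsSobolev O T θ w f G) (h' : IsSobolev O T' θ w f G') (W : NormWeights O θ w) :
    G =ᵐ[volume.restrict O] G' := by
  have hO := W.isOpen
  have hcoord : ∀ e : Sp n, ∀ᵐ x ∂volume.restrict O, inner ℝ (G x - G' x) e = 0 := by
    intro e
    have hmem : MemLp (fun x => inner ℝ (G x - G' x) e) 2
        (weightedMeasure O (fun x => θ x * w x)) :=
      ((h.memLp_snd W).sub (h'.memLp_snd W)).inner_const e
    rw [ae_restrict_iff' hO.measurableSet]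
    refine hO.ae_eq_zero_of_integral_contDiff_smul_eq_zero ?_ fun ψ hψ hc hs => ?_
    · rw [locallyIntegrableOn_iff hO.isLocallyClosed]
      intro K hKO hK
      obtain ⟨C, hC0, hC⟩ := W.snd.exists_one_le_mul hK hKO
      have := W.snd.integrableOn_mul hO (η := K.indicator 1) (C := C) (fun x hx => ?_)
        ((aestronglyMeasurable_const (b := (1 : ℝ))).indicator hK.measurableSet) hmem
      · refine (this.mono_set hKO).congr_fun (fun x hx => ?_) hK.measurableSet
        simp [hx]
      · by_cases hxK : x ∈ K
        · simpa [hxK] using hC x hxK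
        · simpa [hxK] using mul_nonneg hC0 (W.snd.pos x hx).le
    · obtain ⟨C1, -, hC1⟩ := W.snd.exists_abs_le_mul hψ.continuous hc hs
      have i1 := W.snd.integrableOn_mul hO hC1 hψ.continuous.aestronglyMeasurable
        ((h.memLp_snd W).inner_const e)
      have i2 := W.snd.integrableOn_mul hO hC1 hψ.continuous.aestronglyMeasurable
        ((h'.memLp_snd W).inner_const e)
      rw [← setIntegral_eq_integral_of_forall_compl_eq_zero (s := O)]
      · have := integral_sub i1 i2
        rw [h.integral_mul_inner W hψ hc hs, h'.integral_mul_inner W hψ hc hs, sub_self] at this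
        simpa only [smul_eq_mul, inner_sub_left, mul_sub] using this
      · intro x hx
        rw [image_eq_zero_of_notMem_tsupport fun hx' => hx (hs hx'), zero_smul]
  have hall : ∀ᵐ x ∂volume.restrict O, ∀ i : Fin (n + 1),
      inner ℝ (G x - G' x) (EuclideanSpace.single i (1 : ℝ)) = 0 :=
    ae_all_iff.2 fun i => hcoord _
  filter_upwards [hall] with x hx
  ext i
  have := hx i
  simpa [EuclideanSpace.inner_single_right, sub_eq_zero] using this

/-- The gradient vanishes almost everywhere on level sets. -/
lemma IsSobolev.gradient_eq_zero_of_eq {f : Sp n → ℝ} {G : Sp n → Sp n}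
    (h : IsSobolev O T θ w f G) (W : NormWeights O θ w) {m : ℝ} (hm : 0 ≤ m) :
    ∀ᵐ x ∂volume.restrict O, f x = m → G x = 0 := by
  -- The same function `(f - m)⁺` has gradients `1_{f > m} G` and `1_{f ≥ m} G`; where `f = m` these
  -- are `0` and `G`.
  filter_upwards [(h.posPart W hm).gradient_unique (h.posPart' W hm) W] with x hx hxm
  simpa [hxm] using hx.symm

end WeakDerivative

/-! ### Hardy and translation estimates on the half-space -/

section HalfSpace

variable {n : ℕ} {O : Set (Sp n)} {g : Sp n → ℝ}

lemma continuous_lastCoord : Continuous (lastCoord : Sp n → ℝ) := by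
  unfold lastCoord; fun_prop

@[simp] lemma lastCoord_add (x y : Sp n) : lastCoord (x + y) = lastCoord x + lastCoord y := rfl

@[simp] lemma lastCoord_smul (c : ℝ) (x : Sp n) : lastCoord (c • x) = c * lastCoord x := rfl

lemma abs_lastCoord_le (x : Sp n) : |lastCoord x| ≤ ‖x‖ :=
  PiLp.norm_apply_le x (Fin.last n)

lemma isOpen_halfSpace : IsOpen (halfSpace n) :=
  isOpen_lt continuous_const continuous_lastCoord

lemma enorm_sq_eq_zero_of_eq_zero {A : Sp n →L[ℝ] ℝ} (h : A = 0) : ‖A‖ₑ ^ 2 = 0 := by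
  rw [← ofReal_norm, h, norm_zero]
  simp

lemma sq_lintegral_le {X : Type*} [MeasurableSpace X] {μ : Measure X} {f : X → ℝ}
    (hf : AEStronglyMeasurable f μ) :
    (∫⁻ x, ‖f x‖ₑ ∂μ) ^ 2 ≤ μ univ * ∫⁻ x, ‖f x‖ₑ ^ 2 ∂μ := by
  have h1 := eLpNorm_le_eLpNorm_mul_rpow_measure_univ (p := 1) (q := 2) one_le_two hf
  have h2 : (eLpNorm f 2 μ) ^ 2 = ∫⁻ x, ‖f x‖ₑ ^ 2 ∂μ := by
    simpa using eLpNorm_nnreal_pow_eq_lintegral (f := f) (μ := μ) (p := 2) (by norm_num)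
  rw [eLpNorm_one_eq_lintegral_enorm] at h1
  calc (∫⁻ x, ‖f x‖ₑ ∂μ) ^ 2 ≤ (eLpNorm f 2 μ * μ univ ^ (1 / 2 : ℝ)) ^ 2 := by
        gcongr
        convert h1 using 3
        norm_num
    _ = μ univ * ∫⁻ x, ‖f x‖ₑ ^ 2 ∂μ := by
        rw [mul_pow, h2, ← ENNReal.rpow_natCast, ← ENNReal.rpow_mul, mul_comm]
        norm_num

/-- The fundamental theorem of calculus along the segment, followed by Cauchy–Schwarz in `t`. -/
lemma enorm_add_smul_sub_sq_le (hg : ContDiffOn ℝ 1 g (halfSpace n)) {x z : Sp n} {l : ℝ}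
    (hl : 0 ≤ l) (hseg : ∀ t ∈ Icc 0 l, x + t • z ∈ halfSpace n) :
    ‖g (x + l • z) - g x‖ₑ ^ 2 ≤
      ENNReal.ofReal l * ‖z‖ₑ ^ 2 * ∫⁻ t in Ioc 0 l, ‖fderiv ℝ g (x + t • z)‖ₑ ^ 2 := by
  have hd : ∀ t ∈ uIcc 0 l,
      HasDerivAt (fun t => g (x + t • z)) (fderiv ℝ g (x + t • z) z) t := by
    intro t ht
    rw [uIcc_of_le hl] at ht
    have h1 : HasFDerivAt g (fderiv ℝ g (x + t • z)) (x + t • z) :=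
      ((hg.contDiffAt (isOpen_halfSpace.mem_nhds (hseg t ht))).differentiableAt
        (by simp)).hasFDerivAt
    have h2 : HasDerivAt (fun t : ℝ => x + t • z) z t := by
      simpa using ((hasDerivAt_id t).smul_const z).const_add x
    exact h1.comp_hasDerivAt t h2
  have hc : ContinuousOn (fun t => fderiv ℝ g (x + t • z) z) (Icc 0 l) := by
    refine ContinuousOn.clm_apply ?_ continuousOn_const
    exact (hg.continuousOn_fderiv_of_isOpen isOpen_halfSpace (by simp)).comp
      (by fun_prop) hseg
  have hint : IntervalIntegrable (fun t => fderiv ℝ g (x + t • z) z) volume 0 l :=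
    (by rwa [uIcc_of_le hl] : ContinuousOn _ (uIcc 0 l)).intervalIntegrable
  have heq := intervalIntegral.integral_eq_sub_of_hasDerivAt hd hint
  rw [zero_smul, add_zero, intervalIntegral.integral_of_le hl] at heq
  rw [← heq]
  have hm : AEStronglyMeasurable (fun t => fderiv ℝ g (x + t • z) z)
      (volume.restrict (Ioc 0 l)) := hint.1.1
  calc ‖∫ t in Ioc 0 l, fderiv ℝ g (x + t • z) z‖ₑ ^ 2
      ≤ (∫⁻ t in Ioc 0 l, ‖fderiv ℝ g (x + t • z) z‖ₑ) ^ 2 := by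
        gcongr
        exact enorm_integral_le_lintegral_enorm _
    _ ≤ volume.restrict (Ioc 0 l) univ * ∫⁻ t in Ioc 0 l, ‖fderiv ℝ g (x + t • z) z‖ₑ ^ 2 :=
        sq_lintegral_le hm
    _ ≤ ENNReal.ofReal l *
        ∫⁻ t in Ioc 0 l, ‖z‖ₑ ^ 2 * ‖fderiv ℝ g (x + t • z)‖ₑ ^ 2 := by
        rw [Measure.restrict_apply_univ, Real.volume_Ioc, sub_zero]
        gcongr with t
        rw [← mul_pow, mul_comm]
        gcongr
        exact ContinuousLinearMap.le_opENorm _ _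
    _ = _ := by
        rw [lintegral_const_mul' _ _ (by simp), mul_assoc]

lemma measurable_enorm_fderiv_sq (g : Sp n → ℝ) :
    Measurable fun x => ‖fderiv ℝ g x‖ₑ ^ 2 :=
  (measurable_fderiv ℝ g).enorm.pow_const 2

/-- `L²` continuity of translations, on sets away from the boundary of the half-space. -/
lemma lintegral_translate_sub_sq_le (hg : ContDiffOn ℝ 1 g (halfSpace n)) {δ r : ℝ}
    (hδ : 0 < δ) (hr : 2 * r ≤ δ) {z : Sp n} (hz : ‖z‖ < r) :
    ∫⁻ x in {x | δ ≤ lastCoord x}, ‖g (x + z) - g x‖ₑ ^ 2 ≤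
      ENNReal.ofReal r ^ 2 * ∫⁻ y in {y | δ / 2 < lastCoord y}, ‖fderiv ℝ g y‖ₑ ^ 2 := by
  set Γ : Sp n → ℝ≥0∞ := fun x => ‖fderiv ℝ g x‖ₑ ^ 2 with hΓ
  have hΓm : Measurable Γ := measurable_enorm_fderiv_sq g
  have hmS : MeasurableSet {y : Sp n | δ / 2 < lastCoord y} :=
    (isOpen_lt continuous_const continuous_lastCoord).measurableSet
  have hmT : MeasurableSet {y : Sp n | δ ≤ lastCoord y} :=
    (isClosed_le continuous_const continuous_lastCoord).measurableSet
  set Γ' : Sp n → ℝ≥0∞ := {y : Sp n | δ / 2 < lastCoord y}.indicator Γ with hΓ'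
  have hΓm' : Measurable Γ' := hΓm.indicator hmS
  -- Since `‖z‖ < r ≤ δ / 2`, the whole segment stays at height more than `δ / 2`. After exchanging
  -- integrals, translation invariance removes `t • z`.
  have hcoord : ∀ x : Sp n, δ ≤ lastCoord x → ∀ t ∈ Icc (0 : ℝ) 1,
      δ / 2 < lastCoord (x + t • z) := by
    intro x hx t ht
    have h1 : |t * lastCoord z| < r := by
      rw [abs_mul, abs_of_nonneg ht.1]
      calc t * |lastCoord z| ≤ 1 * ‖z‖ :=
            mul_le_mul ht.2 (abs_lastCoord_le z) (abs_nonneg _) zero_le_one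
        _ < r := by rwa [one_mul]
    have := (abs_lt.1 h1).1
    simp only [lastCoord_add, lastCoord_smul]
    linarith
  have hz2 : ‖z‖ₑ ^ 2 ≤ ENNReal.ofReal r ^ 2 := by
    gcongr
    rw [← ofReal_norm]
    exact ENNReal.ofReal_le_ofReal hz.le
  calc ∫⁻ x in {x | δ ≤ lastCoord x}, ‖g (x + z) - g x‖ₑ ^ 2
      ≤ ∫⁻ x in {x | δ ≤ lastCoord x},
          ENNReal.ofReal r ^ 2 * ∫⁻ t in Ioc (0 : ℝ) 1, Γ' (x + t • z) := by
        refine setLIntegral_mono' hmT fun x hx => ?_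
        have := enorm_add_smul_sub_sq_le hg (x := x) (z := z) zero_le_one
          (fun t ht => (half_pos hδ).trans (hcoord x hx t ht))
        rw [one_smul, ENNReal.ofReal_one, one_mul] at this
        refine this.trans (mul_le_mul' hz2 ?_)
        refine setLIntegral_mono' measurableSet_Ioc fun t ht => ?_
        have hmem : x + t • z ∈ {y : Sp n | δ / 2 < lastCoord y} :=
          hcoord x hx t ⟨ht.1.le, ht.2⟩
        rw [hΓ', indicator_of_mem hmem]
    _ = ENNReal.ofReal r ^ 2 * ∫⁻ x in {x | δ ≤ lastCoord x},
          ∫⁻ t in Ioc (0 : ℝ) 1, Γ' (x + t • z) := lintegral_const_mul' _ _ (by simp)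
    _ ≤ ENNReal.ofReal r ^ 2 * ∫⁻ x, ∫⁻ t in Ioc (0 : ℝ) 1, Γ' (x + t • z) := by
        gcongr
        exact Measure.restrict_le_self
    _ = ENNReal.ofReal r ^ 2 * ∫⁻ t in Ioc (0 : ℝ) 1, ∫⁻ x, Γ' (x + t • z) := by
        rw [lintegral_lintegral_swap]
        exact (hΓm'.comp (by fun_prop)).aemeasurable
    _ = ENNReal.ofReal r ^ 2 * ∫⁻ x, Γ' x := by
        simp only [lintegral_add_right_eq_self, lintegral_const, Measure.restrict_apply_univ,
          Real.volume_Ioc]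
        simp
    _ = _ := by rw [hΓ', lintegral_indicator hmS]

lemma enorm_sq_le_two_mul (a b : ℝ) : ‖a‖ₑ ^ 2 ≤ 2 * ‖b - a‖ₑ ^ 2 + 2 * ‖b‖ₑ ^ 2 := by
  have h2 : (2 : ℝ≥0∞) = ENNReal.ofReal 2 := by simp
  rw [Real.enorm_eq_ofReal_abs, Real.enorm_eq_ofReal_abs, Real.enorm_eq_ofReal_abs,
    ← ENNReal.ofReal_pow (abs_nonneg _), ← ENNReal.ofReal_pow (abs_nonneg _),
    ← ENNReal.ofReal_pow (abs_nonneg _), h2, ← ENNReal.ofReal_mul (by norm_num),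
    ← ENNReal.ofReal_mul (by norm_num), ← ENNReal.ofReal_add (by positivity) (by positivity),
    sq_abs, sq_abs, sq_abs]
  refine ENNReal.ofReal_le_ofReal ?_
  nlinarith [sq_nonneg (a - 2 * b)]

/-- Interior estimate: the integral of `g²` over a small set away from the boundary. -/
lemma lintegral_sq_interior_le (hg : ContDiffOn ℝ 1 g (halfSpace n)) (hgm : Measurable g)
    {δ r : ℝ} (hδ : 0 < δ) (hr : 2 * r ≤ δ) {E : Set (Sp n)}
    (hE : MeasurableSet E) (hEδ : ∀ x ∈ E, δ ≤ lastCoord x) :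
    volume (Metric.ball (0 : Sp n) r) * ∫⁻ x in E, ‖g x‖ₑ ^ 2 ≤
      2 * (volume (Metric.ball (0 : Sp n) r) * (ENNReal.ofReal r ^ 2 *
        ∫⁻ y in {y | δ / 2 < lastCoord y}, ‖fderiv ℝ g y‖ₑ ^ 2)) +
      2 * (volume E * ∫⁻ y in {y | δ / 2 < lastCoord y}, ‖g y‖ₑ ^ 2) := by
  have hmS : MeasurableSet {y : Sp n | δ / 2 < lastCoord y} :=
    (isOpen_lt continuous_const continuous_lastCoord).measurableSet
  set B := Metric.ball (0 : Sp n) r with hB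
  have hm1 : Measurable fun p : Sp n × Sp n => ‖g (p.2 + p.1)‖ₑ ^ 2 :=
    (hgm.comp (by fun_prop)).enorm.pow_const 2
  -- Average `g(x)² ≤ 2 (g(x + z) - g(x))² + 2 g(x + z)²` over `z` in the ball `B`. The first term
  -- is small through `r`; the second, integrated in `z` first, is small through the volume of `E`.
  calc volume B * ∫⁻ x in E, ‖g x‖ₑ ^ 2
      = ∫⁻ _ in B, ∫⁻ x in E, ‖g x‖ₑ ^ 2 := by
        rw [lintegral_const, Measure.restrict_apply_univ, mul_comm]
    _ ≤ ∫⁻ z in B, ((2 * ∫⁻ x in E, ‖g (x + z) - g x‖ₑ ^ 2) +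
          2 * ∫⁻ x in E, ‖g (x + z)‖ₑ ^ 2) := by
        refine lintegral_mono fun z => ?_
        rw [← lintegral_const_mul' _ _ (by simp), ← lintegral_const_mul' _ _ (by simp),
          ← lintegral_add_right]
        · exact lintegral_mono fun x => enorm_sq_le_two_mul _ _
        · exact ((hgm.comp (by fun_prop)).enorm.pow_const 2).const_mul 2
    _ = (2 * ∫⁻ z in B, ∫⁻ x in E, ‖g (x + z) - g x‖ₑ ^ 2) +
          2 * ∫⁻ z in B, ∫⁻ x in E, ‖g (x + z)‖ₑ ^ 2 := by
        rw [lintegral_add_right _ ((hm1.lintegral_prod_right').const_mul 2),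
          lintegral_const_mul' _ _ (by simp), lintegral_const_mul' _ _ (by simp)]
    _ ≤ _ := by
        gcongr ?_ + ?_
        · gcongr
          calc ∫⁻ z in B, ∫⁻ x in E, ‖g (x + z) - g x‖ₑ ^ 2
              ≤ ∫⁻ z in B, (ENNReal.ofReal r ^ 2 *
                  ∫⁻ y in {y | δ / 2 < lastCoord y}, ‖fderiv ℝ g y‖ₑ ^ 2) := by
                refine setLIntegral_mono' Metric.isOpen_ball.measurableSet fun z hz => ?_
                refine (lintegral_mono_set hEδ).trans ?_
                exact lintegral_translate_sub_sq_le hg hδ hr (by simpa [hB] using hz)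
            _ = _ := by
                rw [lintegral_const, Measure.restrict_apply_univ, mul_comm]
        · gcongr
          calc ∫⁻ z in B, ∫⁻ x in E, ‖g (x + z)‖ₑ ^ 2
              = ∫⁻ x in E, ∫⁻ z in B, ‖g (x + z)‖ₑ ^ 2 := by
                rw [lintegral_lintegral_swap]
                exact hm1.aemeasurable
            _ ≤ ∫⁻ x in E, ∫⁻ y in {y | δ / 2 < lastCoord y}, ‖g y‖ₑ ^ 2 := by
                refine setLIntegral_mono' hE fun x hx => ?_
                rw [← lintegral_indicator Metric.isOpen_ball.measurableSet,
                  ← lintegral_indicator hmS,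
                  ← lintegral_add_left_eq_self
                    ({y : Sp n | δ / 2 < lastCoord y}.indicator fun y => ‖g y‖ₑ ^ 2) x]
                refine lintegral_mono fun z => ?_
                by_cases hz : z ∈ B
                · have hmem : x + z ∈ {y : Sp n | δ / 2 < lastCoord y} := by
                    have h1 : ‖z‖ < r := by simpa [hB] using hz
                    have h2 := (abs_le.1 (abs_lastCoord_le z)).1
                    have h3 := hEδ x hx
                    simp only [mem_ofPred_eq, lastCoord_add]
                    linarith
                  rw [indicator_of_mem hz, indicator_of_mem hmem]
                · rw [indicator_of_notMem hz]
                  exact zero_le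
            _ = _ := by
                rw [lintegral_const, Measure.restrict_apply_univ, mul_comm]

/-- The vertical unit vector. -/
def vertical (n : ℕ) : Sp n := EuclideanSpace.single (Fin.last n) 1

@[simp] lemma lastCoord_vertical : lastCoord (vertical n) = 1 := by
  simp [lastCoord, vertical]

lemma enorm_vertical : ‖vertical n‖ₑ = 1 := by
  rw [← ofReal_norm]
  simp [vertical]

/-- The function `1 + (t / M) ^ γ`. -/
def comparison (γ M t : ℝ) : ℝ≥0∞ := ENNReal.ofReal (1 + t ^ γ * M ^ (-γ))

lemma measurable_comparison (γ M : ℝ) : Measurable (comparison γ M) := by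
  unfold comparison; fun_prop

/-- Transports the weight from height `t` up to height `y`. For `γ ≥ 0` monotonicity of the power
suffices, via the summand `1`. For `γ < 0`, `y ^ γ ≥ M ^ γ`, and the summand `(t / M) ^ γ` suffices.
-/
lemma rpow_le_mul_comparison {γ M t y : ℝ} (ht : 0 < t) (hty : t ≤ y) (hyM : y ≤ M) :
    ENNReal.ofReal (t ^ γ) ≤ ENNReal.ofReal (y ^ γ) * comparison γ M t := by
  have hy : 0 < y := ht.trans_le hty
  have hM : 0 < M := hy.trans_le hyM
  have p1 := Real.rpow_pos_of_pos ht γ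
  have p2 := Real.rpow_pos_of_pos hy γ
  have p3 := Real.rpow_pos_of_pos hM (-γ)
  rw [comparison, ← ENNReal.ofReal_mul p2.le]
  refine ENNReal.ofReal_le_ofReal ?_
  rcases le_or_gt 0 γ with hγ | hγ
  · have : t ^ γ ≤ y ^ γ := Real.rpow_le_rpow ht.le hty hγ
    nlinarith [mul_pos p2 (mul_pos p1 p3)]
  · have h1 : M ^ γ ≤ y ^ γ := Real.rpow_le_rpow_of_nonpos hy hyM hγ.le
    have h2 : M ^ γ * M ^ (-γ) = 1 := by
      rw [← Real.rpow_add hM]; simp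
    have h3 : 1 ≤ y ^ γ * M ^ (-γ) := by
      rw [← h2]; gcongr
    nlinarith

lemma lintegral_comparison_ne_top {γ M : ℝ} (hγ : -1 < γ) :
    ∫⁻ t in Ioo 0 M, comparison γ M t ≠ ⊤ := by
  have h1 : IntegrableOn (fun t : ℝ => 1 + t ^ γ * M ^ (-γ)) (Ioo 0 M) := by
    have h2 : IntegrableOn (fun t : ℝ => t ^ γ) (Ioo 0 M) :=
      (intervalIntegral.intervalIntegrable_rpow' (a := 0) (b := M) hγ).1.mono_set
        Ioo_subset_Ioc_self
    exact Integrable.add (by simp) (h2.mul_const (M ^ (-γ)))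
  exact h1.lintegral_lt_top.ne

/-- Integrability of `t ^ γ` at `0`, which is what `γ > -1` provides, together with absolute
continuity of the integral. Consequently the Hardy constant of a strip of width `δ` tends to zero.
-/
lemma tendsto_lintegral_comparison {γ M : ℝ} (hγ : -1 < γ) (hM : 0 < M) :
    Tendsto (fun δ => ∫⁻ t in Ioo 0 δ, comparison γ M t) (𝓝[>] 0) (𝓝 0) := by
  have h := tendsto_setLIntegral_zero (μ := volume.restrict (Ioo 0 M))
    (f := comparison γ M) (lintegral_comparison_ne_top hγ) (l := 𝓝[>] (0 : ℝ))
    (s := fun δ => Ioo 0 δ) (by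
      have : Tendsto (fun δ : ℝ => ENNReal.ofReal δ) (𝓝[>] 0) (𝓝 0) := by
        have := (ENNReal.continuous_ofReal.tendsto 0).mono_left
          (nhdsWithin_le_nhds (s := Ioi (0 : ℝ)))
        simpa using this
      refine tendsto_of_tendsto_of_tendsto_of_le_of_le tendsto_const_nhds this
        (fun _ => zero_le) fun δ => ?_
      refine (Measure.restrict_apply_le _ _).trans ?_
      simp)
  refine h.congr' ?_
  have : Iio M ∈ 𝓝[>] (0 : ℝ) := mem_nhdsWithin_of_mem_nhds (Iio_mem_nhds hM)
  filter_upwards [this] with δ hδ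
  rw [Measure.restrict_restrict measurableSet_Ioo, inter_eq_left.2 (Ioo_subset_Ioo le_rfl hδ.le)]

/-- Weighted Hardy inequality in a strip along the boundary of the half-space. -/
lemma lintegral_sq_strip_le (hg : ContDiffOn ℝ 1 g (halfSpace n))
    {M γ δ : ℝ} (hM : 0 < M)
    (hzero : ∀ x ∈ halfSpace n, M ≤ lastCoord x → g x = 0 ∧ fderiv ℝ g x = 0) :
    ∫⁻ x in {x | 0 < lastCoord x ∧ lastCoord x < δ},
        ENNReal.ofReal (lastCoord x ^ γ) * ‖g x‖ₑ ^ 2 ≤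
      ENNReal.ofReal M * (∫⁻ t in Ioo 0 δ, comparison γ M t) *
        ∫⁻ y in halfSpace n, ENNReal.ofReal (lastCoord y ^ γ) * ‖fderiv ℝ g y‖ₑ ^ 2 := by
  set e := vertical n
  set Γ : Sp n → ℝ≥0∞ := fun x => ‖fderiv ℝ g x‖ₑ ^ 2 with hΓ
  have hΓm : Measurable Γ := measurable_enorm_fderiv_sq g
  have hlm : Measurable (lastCoord : Sp n → ℝ) := continuous_lastCoord.measurable
  have hmT : MeasurableSet {x : Sp n | 0 < lastCoord x ∧ lastCoord x < δ} :=
    (measurableSet_lt measurable_const hlm).inter (measurableSet_lt hlm measurable_const)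
  set q : ℝ → ℝ≥0∞ := (Ioo 0 δ).indicator fun t => ENNReal.ofReal (t ^ γ) with hq
  have hqm : Measurable q := Measurable.indicator (by fun_prop) measurableSet_Ioo
  set κ : ℝ → ℝ≥0∞ := (Ioo 0 δ).indicator (comparison γ M) with hκ
  have hκm : Measurable κ := (measurable_comparison γ M).indicator measurableSet_Ioo
  have hmH : MeasurableSet (halfSpace n) := isOpen_halfSpace.measurableSet
  have hpt : ∀ x : Sp n, 0 < lastCoord x ∧ lastCoord x < δ →
      ENNReal.ofReal (lastCoord x ^ γ) * ‖g x‖ₑ ^ 2 ≤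
        -- Integrate downwards from height at least `M`, where `g` vanishes. No condition at `x_d =
        -- 0` is required.
        ENNReal.ofReal M * ∫⁻ t in Ioc 0 M, q (lastCoord x) * Γ (x + t • e) := by
    intro x hx
    have hin : ∀ t ∈ Icc 0 M, x + t • e ∈ halfSpace n := fun t ht => by
      have : 0 < lastCoord x + t * 1 := by linarith [hx.1, ht.1]
      simpa [halfSpace, e] using this
    have h1 := enorm_add_smul_sub_sq_le hg hM.le hin
    have h2 : g (x + M • e) = 0 := by
      refine (hzero _ (hin M ⟨hM.le, le_rfl⟩) ?_).1
      have : M ≤ lastCoord x + M * 1 := by linarith [hx.1]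
      simpa [e] using this
    rw [h2, zero_sub, enorm_neg, enorm_vertical, one_pow, mul_one] at h1
    have h3 : q (lastCoord x) = ENNReal.ofReal (lastCoord x ^ γ) :=
      indicator_of_mem (show lastCoord x ∈ Ioo 0 δ from hx) _
    rw [lintegral_const_mul' _ _ (by rw [h3]; exact ENNReal.ofReal_ne_top), h3, mul_left_comm]
    gcongr
  calc ∫⁻ x in {x | 0 < lastCoord x ∧ lastCoord x < δ},
        ENNReal.ofReal (lastCoord x ^ γ) * ‖g x‖ₑ ^ 2
      ≤ ∫⁻ x in {x | 0 < lastCoord x ∧ lastCoord x < δ},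
          ENNReal.ofReal M * ∫⁻ t in Ioc 0 M, q (lastCoord x) * Γ (x + t • e) :=
        setLIntegral_mono' hmT hpt
    _ ≤ ∫⁻ x, ENNReal.ofReal M * ∫⁻ t in Ioc 0 M, q (lastCoord x) * Γ (x + t • e) :=
        setLIntegral_le_lintegral _ _
    _ = ENNReal.ofReal M * ∫⁻ t in Ioc 0 M, ∫⁻ x, q (lastCoord x) * Γ (x + t • e) := by
        rw [lintegral_const_mul' _ _ ENNReal.ofReal_ne_top, lintegral_lintegral_swap]
        exact ((hqm.comp (hlm.comp measurable_fst)).mul (hΓm.comp (by fun_prop))).aemeasurable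
    -- Substitute `y = x + t • e`: the point where the gradient is evaluated becomes the outer
    -- variable, and `t` then enters only through the weight at height `y_d - t`.
    _ = ENNReal.ofReal M * ∫⁻ t in Ioc 0 M, ∫⁻ y, q (lastCoord y - t) * Γ y := by
        congr 1
        refine lintegral_congr fun t => ?_
        rw [← lintegral_add_right_eq_self (fun y => q (lastCoord y - t) * Γ y) (t • e)]
        refine lintegral_congr fun x => ?_
        simp [e]
    _ = ENNReal.ofReal M * ∫⁻ y, ∫⁻ t in Ioc 0 M, q (lastCoord y - t) * Γ y := by
        rw [lintegral_lintegral_swap]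
        exact ((hqm.comp ((hlm.comp measurable_snd).sub measurable_fst)).mul
          (hΓm.comp measurable_snd)).aemeasurable
    _ ≤ ENNReal.ofReal M * ∫⁻ y, (∫⁻ t in Ioo 0 δ, comparison γ M t) *
          (halfSpace n).indicator (fun y => ENNReal.ofReal (lastCoord y ^ γ) * Γ y) y := by
        gcongr with y
        by_cases hy : y ∈ halfSpace n ∧ lastCoord y < M
        · rw [indicator_of_mem hy.1]
          calc ∫⁻ t in Ioc 0 M, q (lastCoord y - t) * Γ y
              ≤ ∫⁻ t in Ioc 0 M, κ (lastCoord y - t) *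
                  (ENNReal.ofReal (lastCoord y ^ γ) * Γ y) := by
                refine setLIntegral_mono' measurableSet_Ioc fun t ht => ?_
                rw [← mul_assoc]
                gcongr
                by_cases hmem : lastCoord y - t ∈ Ioo 0 δ
                · rw [hq, hκ, indicator_of_mem hmem, indicator_of_mem hmem, mul_comm]
                  exact rpow_le_mul_comparison hmem.1 (by linarith [ht.1]) hy.2.le
                · rw [hq, indicator_of_notMem hmem]
                  exact zero_le
            _ = (∫⁻ t in Ioc 0 M, κ (lastCoord y - t)) *
                  (ENNReal.ofReal (lastCoord y ^ γ) * Γ y) :=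
                lintegral_mul_const _ (hκm.comp (by fun_prop))
            _ ≤ (∫⁻ t, κ (lastCoord y - t)) * (ENNReal.ofReal (lastCoord y ^ γ) * Γ y) := by
                gcongr
                exact Measure.restrict_le_self
            _ = _ := by
                rw [lintegral_sub_left_eq_self, hκ, lintegral_indicator measurableSet_Ioo]
        · have hz : ∀ t ∈ Ioc 0 M, q (lastCoord y - t) * Γ y = 0 := by
            intro t ht
            by_cases hy1 : y ∈ halfSpace n
            · have hy2 : M ≤ lastCoord y := not_lt.1 fun h => hy ⟨hy1, h⟩
              have hΓ0 : Γ y = 0 :=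
                enorm_sq_eq_zero_of_eq_zero (hzero y hy1 hy2).2
              rw [hΓ0, mul_zero]
            · have hy2 : ¬ 0 < lastCoord y := hy1
              have : lastCoord y - t ∉ Ioo 0 δ := fun h => hy2 (by linarith [h.1, ht.1])
              rw [hq, indicator_of_notMem this, zero_mul]
          rw [setLIntegral_congr_fun measurableSet_Ioc hz, lintegral_zero]
          exact zero_le
    _ ≤ _ := by
        rw [lintegral_const_mul _ (Measurable.indicator (by fun_prop) hmH),
          lintegral_indicator hmH, mul_assoc]

end HalfSpace

/-! ### Poincaré inequality and uniform integrability for power weights -/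

section UniformIntegrability

variable {n : ℕ} {O S : Set (Sp n)} {θ w ρ φ : Sp n → ℝ}

lemma IsWeight.setLIntegral_eq (h : IsWeight O ρ) (hO : IsOpen O) {E : Set (Sp n)}
    (hE : MeasurableSet E) (f : Sp n → ℝ≥0∞) :
    ∫⁻ x in E, f x ∂weightedMeasure O ρ = ∫⁻ x in E ∩ O, ENNReal.ofReal (ρ x) * f x := by
  rw [← lintegral_indicator hE, h.lintegral_eq hO, ← Measure.restrict_restrict hE,
    ← lintegral_indicator hE]
  refine lintegral_congr fun x => ?_
  by_cases hx : x ∈ E <;> simp [hx]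

/-- The data of a weight comparable to a power of the distance to the boundary of the half-space,
on a bounded open subset of the half-space. -/
structure IsPowerWeight (O : Set (Sp n)) (ρ : Sp n → ℝ) (γ c M : ℝ) : Prop where
  isWeight : IsWeight O ρ
  isOpen : IsOpen O
  subset : O ⊆ halfSpace n
  pos : 0 < c
  pos' : 0 < M
  lt : ∀ x ∈ O, lastCoord x < M
  exponent : -1 < γ
  lower : ∀ x ∈ O, c * lastCoord x ^ γ ≤ ρ x
  upper : ∀ x ∈ O, ρ x ≤ c⁻¹ * lastCoord x ^ γ

/-- The closed support lies in `O ∪ S`, and `S` does not meet the open half-space. A point of the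
half-space outside `O` is therefore off the closed support, and extension by zero is smooth there.
-/
lemma IsTestFunction.eventually_indicator_eq_zero (hφ : IsTestFunction O (O ∪ S) φ)
    (hSH : ∀ x ∈ S, lastCoord x = 0) {x : Sp n} (hx : x ∈ halfSpace n) (hxO : x ∉ O) :
    O.indicator φ =ᶠ[𝓝 x] fun _ => 0 := by
  have hn : x ∉ closure (O ∩ Function.support φ) := by
    intro h
    rcases hφ.subset h with h | h
    · exact hxO h
    · exact hx.ne' (hSH x h)
  filter_upwards [isClosed_closure.isOpen_compl.mem_nhds hn] with y hy
  by_cases hyO : y ∈ O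
  · rw [indicator_of_mem hyO]
    by_contra hne
    exact hy (subset_closure ⟨hyO, hne⟩)
  · rw [indicator_of_notMem hyO]

lemma eventually_indicator_eq (hO : IsOpen O) {x : Sp n} (hx : x ∈ O) :
    O.indicator φ =ᶠ[𝓝 x] φ := by
  filter_upwards [hO.mem_nhds hx] with y hy using indicator_of_mem hy _

lemma IsTestFunction.contDiffOn_indicator (hφ : IsTestFunction O (O ∪ S) φ) (hO : IsOpen O)
    (hSH : ∀ x ∈ S, lastCoord x = 0) : ContDiffOn ℝ 1 (O.indicator φ) (halfSpace n) := by
  intro x hx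
  refine ContDiffAt.contDiffWithinAt ?_
  by_cases hxO : x ∈ O
  · refine ContDiffAt.congr_of_eventuallyEq ?_ (eventually_indicator_eq hO hxO)
    exact (hφ.contDiffOn.contDiffAt (hO.mem_nhds hxO)).of_le (by simp)
  · exact contDiffAt_const.congr_of_eventuallyEq (hφ.eventually_indicator_eq_zero hSH hx hxO)

lemma IsTestFunction.fderiv_indicator_eq_zero (hφ : IsTestFunction O (O ∪ S) φ)
    (hSH : ∀ x ∈ S, lastCoord x = 0) {x : Sp n} (hx : x ∈ halfSpace n) (hxO : x ∉ O) :
    fderiv ℝ (O.indicator φ) x = 0 := by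
  rw [(hφ.eventually_indicator_eq_zero hSH hx hxO).fderiv_eq]
  simp

lemma IsTestFunction.measurable_indicator {T : Set (Sp n)} (hφ : IsTestFunction O T φ)
    (hO : IsOpen O) : Measurable (O.indicator φ) := by
  classical
  rw [← piecewise_eq_indicator]
  exact hφ.contDiffOn.continuousOn.measurable_piecewise continuousOn_const hO.measurableSet

lemma enorm_gradient (φ : Sp n → ℝ) (x : Sp n) : ‖gradient φ x‖ₑ = ‖fderiv ℝ φ x‖ₑ := by
  rw [← ofReal_norm, ← ofReal_norm, gradient_norm]

lemma IsTestFunction.setLIntegral_fderiv_indicator (hφ : IsTestFunction O (O ∪ S) φ)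
    (hO : IsOpen O) (hSH : ∀ x ∈ S, lastCoord x = 0) {H : Set (Sp n)}
    (hH : MeasurableSet H) (hHs : H ⊆ halfSpace n) (q : Sp n → ℝ≥0∞) :
    ∫⁻ x in H, q x * ‖fderiv ℝ (O.indicator φ) x‖ₑ ^ 2 =
      ∫⁻ x in H ∩ O, q x * ‖gradient φ x‖ₑ ^ 2 := by
  rw [← lintegral_indicator hH, ← lintegral_indicator (hH.inter hO.measurableSet)]
  refine lintegral_congr fun x => ?_
  by_cases hxH : x ∈ H
  · by_cases hxO : x ∈ O
    · rw [indicator_of_mem hxH, indicator_of_mem (show x ∈ H ∩ O from ⟨hxH, hxO⟩),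
        (eventually_indicator_eq hO hxO).fderiv_eq, enorm_gradient]
    · have h0 : ‖fderiv ℝ (O.indicator φ) x‖ₑ ^ 2 = 0 :=
        enorm_sq_eq_zero_of_eq_zero (hφ.fderiv_indicator_eq_zero hSH (hHs hxH) hxO)
      rw [indicator_of_mem hxH, indicator_of_notMem (fun h => hxO h.2), h0, mul_zero]
  · rw [indicator_of_notMem hxH, indicator_of_notMem (fun h => hxH h.1)]

/-- The strip Hardy inequality for the extension by zero. Replacing `ρ` by the power and back costs
one factor `c⁻¹` on each side. -/
lemma IsPowerWeight.lintegral_strip_le {γ c M : ℝ} (P : IsPowerWeight O ρ γ c M)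
    (hSH : ∀ x ∈ S, lastCoord x = 0) (hφ : IsTestFunction O (O ∪ S) φ) {δ : ℝ} :
    ∫⁻ x in {x | lastCoord x < δ} ∩ O, ENNReal.ofReal (ρ x) * ‖φ x‖ₑ ^ 2 ≤
      ENNReal.ofReal c⁻¹ ^ 2 * (ENNReal.ofReal M * ∫⁻ t in Ioo 0 δ, comparison γ M t) *
        ∫⁻ x in O, ENNReal.ofReal (ρ x) * ‖gradient φ x‖ₑ ^ 2 := by
  have hO := P.isOpen
  have hc : 0 < c⁻¹ := inv_pos.2 P.pos
  have hlm : Measurable (lastCoord : Sp n → ℝ) := continuous_lastCoord.measurable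
  have hms : MeasurableSet ({x : Sp n | lastCoord x < δ} ∩ O) :=
    (measurableSet_lt hlm measurable_const).inter hO.measurableSet
  have h1 := lintegral_sq_strip_le (hφ.contDiffOn_indicator hO hSH) (γ := γ) (δ := δ) P.pos'
    (fun x hx hxM => by
      have hxO : x ∉ O := fun h => (P.lt x h).not_ge hxM
      exact ⟨indicator_of_notMem hxO _, hφ.fderiv_indicator_eq_zero hSH hx hxO⟩)
  rw [hφ.setLIntegral_fderiv_indicator hO hSH isOpen_halfSpace.measurableSet
    subset_rfl, inter_eq_right.2 P.subset] at h1
  have h2 : ∫⁻ x in O, ENNReal.ofReal (lastCoord x ^ γ) * ‖gradient φ x‖ₑ ^ 2 ≤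
      ENNReal.ofReal c⁻¹ * ∫⁻ x in O, ENNReal.ofReal (ρ x) * ‖gradient φ x‖ₑ ^ 2 := by
    rw [← lintegral_const_mul' _ _ ENNReal.ofReal_ne_top]
    refine setLIntegral_mono' hO.measurableSet fun x hx => ?_
    rw [← mul_assoc, ← ENNReal.ofReal_mul hc.le]
    gcongr
    rw [inv_mul_eq_div, le_div_iff₀ P.pos, mul_comm]
    exact P.lower x hx
  calc ∫⁻ x in {x | lastCoord x < δ} ∩ O, ENNReal.ofReal (ρ x) * ‖φ x‖ₑ ^ 2
      ≤ ∫⁻ x in {x | lastCoord x < δ} ∩ O, ENNReal.ofReal c⁻¹ *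
          (ENNReal.ofReal (lastCoord x ^ γ) * ‖O.indicator φ x‖ₑ ^ 2) := by
        refine setLIntegral_mono' hms fun x hx => ?_
        rw [indicator_of_mem hx.2, ← mul_assoc, ← ENNReal.ofReal_mul hc.le]
        gcongr
        exact P.upper x hx.2
    _ = ENNReal.ofReal c⁻¹ * ∫⁻ x in {x | lastCoord x < δ} ∩ O,
          ENNReal.ofReal (lastCoord x ^ γ) * ‖O.indicator φ x‖ₑ ^ 2 :=
        lintegral_const_mul' _ _ ENNReal.ofReal_ne_top
    _ ≤ ENNReal.ofReal c⁻¹ * ∫⁻ x in {x | 0 < lastCoord x ∧ lastCoord x < δ},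
          ENNReal.ofReal (lastCoord x ^ γ) * ‖O.indicator φ x‖ₑ ^ 2 := by
        gcongr
        exact fun x hx => ⟨P.subset hx.2, hx.1⟩
    _ ≤ ENNReal.ofReal c⁻¹ * (ENNReal.ofReal M * (∫⁻ t in Ioo 0 δ, comparison γ M t) *
          (ENNReal.ofReal c⁻¹ * ∫⁻ x in O, ENNReal.ofReal (ρ x) * ‖gradient φ x‖ₑ ^ 2)) := by
        gcongr
        exact h1.trans (by gcongr)
    _ = _ := by ring

/-- Away from height `0` the power is bounded above and below on `[δ, M]`, so weighted and Lebesgue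
integrals can be exchanged at the cost of a constant. -/
lemma IsPowerWeight.exists_comparable {γ c M : ℝ} (P : IsPowerWeight O ρ γ c M) {δ : ℝ}
    (hδ : 0 < δ) : ∃ L : ℝ, 0 < L ∧ ∀ x ∈ O, δ < lastCoord x → 1 ≤ L * ρ x ∧ ρ x ≤ L := by
  have hcont : ∀ e : ℝ, ContinuousOn (fun t : ℝ => t ^ e) (Icc δ M) := fun e t ht =>
    (Real.continuousAt_rpow_const t e (Or.inl (hδ.trans_le ht.1).ne')).continuousWithinAt
  obtain ⟨A, hA⟩ := isCompact_Icc.exists_bound_of_continuousOn (hcont γ)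
  obtain ⟨B, hB⟩ := isCompact_Icc.exists_bound_of_continuousOn (hcont (-γ))
  set L₀ := max (max A B) 1
  have hL₀ : 0 < L₀ := zero_lt_one.trans_le (le_max_right _ _)
  have hc := P.pos
  refine ⟨L₀ / c, by positivity, fun x hx hδx => ?_⟩
  have hmem : lastCoord x ∈ Icc δ M := ⟨hδx.le, (P.lt x hx).le⟩
  have hpos : 0 < lastCoord x := hδ.trans hδx
  have h1 : lastCoord x ^ γ ≤ L₀ :=
    (le_abs_self _).trans ((hA _ hmem).trans ((le_max_left _ _).trans (le_max_left _ _)))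
  have h2 : lastCoord x ^ (-γ) ≤ L₀ :=
    (le_abs_self _).trans ((hB _ hmem).trans ((le_max_right _ _).trans (le_max_left _ _)))
  have h3 : lastCoord x ^ γ * lastCoord x ^ (-γ) = 1 := by
    rw [← Real.rpow_add hpos]; simp
  have h4 := Real.rpow_pos_of_pos hpos γ
  constructor
  · calc 1 = lastCoord x ^ (-γ) * lastCoord x ^ γ := by rw [mul_comm, h3]
      _ ≤ L₀ * (ρ x / c) := by
          gcongr
          rw [le_div_iff₀ hc, mul_comm]
          exact P.lower x hx
      _ = L₀ / c * ρ x := by ring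
  · calc ρ x ≤ c⁻¹ * lastCoord x ^ γ := P.upper x hx
      _ ≤ c⁻¹ * L₀ := by gcongr
      _ = L₀ / c := by ring

/-- Poincaré inequality for test functions that vanish near the part of the boundary that lies in
the open half-space. -/
lemma IsPowerWeight.exists_poincare {γ c M : ℝ} (P : IsPowerWeight O ρ γ c M)
    (hSH : ∀ x ∈ S, lastCoord x = 0) : ∃ C : ℝ≥0∞, C ≠ ⊤ ∧ ∀ φ, IsTestFunction O (O ∪ S) φ →
      ∫⁻ x in O, ENNReal.ofReal (ρ x) * ‖φ x‖ₑ ^ 2 ≤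
        C * ∫⁻ x in O, ENNReal.ofReal (ρ x) * ‖gradient φ x‖ₑ ^ 2 := by
  refine ⟨ENNReal.ofReal c⁻¹ ^ 2 * (ENNReal.ofReal M * ∫⁻ t in Ioo 0 M, comparison γ M t),
    ?_, fun φ hφ => ?_⟩
  · exact ENNReal.mul_ne_top (by simp)
      (ENNReal.mul_ne_top (by simp) (lintegral_comparison_ne_top P.exponent))
  · have := P.lintegral_strip_le hSH hφ (δ := M)
    rwa [inter_eq_right.2 (show O ⊆ {x | lastCoord x < M} from P.lt)] at this

/-- Split `E` at height `δ`. The Hardy constant makes the strip contribute at most `ε / 2`; above it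
the weight is comparable to a constant and the translation estimate gives the other `ε / 2`. The
constants are fixed in the order `δ`, `r`, `η`. -/
lemma IsPowerWeight.exists_uniformIntegrable {γ c M : ℝ} (P : IsPowerWeight O ρ γ c M)
    (hSH : ∀ x ∈ S, lastCoord x = 0) {ε : ℝ≥0∞} (hε : ε ≠ 0) :
    ∃ η : ℝ≥0∞, η ≠ 0 ∧ ∀ φ, IsTestFunction O (O ∪ S) φ → ∀ E, MeasurableSet E →
      weightedMeasure O ρ E ≤ η →
      ∫⁻ x in E, ‖φ x‖ₑ ^ 2 ∂weightedMeasure O ρ ≤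
        ε * ∫⁻ x, ‖gradient φ x‖ₑ ^ 2 ∂weightedMeasure O ρ := by
  have hO := P.isOpen
  have hlm : Measurable (lastCoord : Sp n → ℝ) := continuous_lastCoord.measurable
  obtain ⟨C, hC, hCP⟩ := P.exists_poincare hSH
  have hε2 : ε / 2 ≠ 0 := by simp [hε]
  have hε4 : ε / 2 / 2 ≠ 0 := by simp [hε]
  obtain ⟨δ, hδ, hδε⟩ : ∃ δ : ℝ, 0 < δ ∧ ENNReal.ofReal c⁻¹ ^ 2 *
      (ENNReal.ofReal M * ∫⁻ t in Ioo 0 δ, comparison γ M t) < ε / 2 := by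
    have h1 := ENNReal.Tendsto.const_mul (a := ENNReal.ofReal c⁻¹ ^ 2)
      (ENNReal.Tendsto.const_mul (a := ENNReal.ofReal M)
        (tendsto_lintegral_comparison P.exponent P.pos') (Or.inr (by simp))) (Or.inr (by simp))
    rw [mul_zero, mul_zero] at h1
    obtain ⟨δ, h2, h3⟩ := ((h1.eventually (gt_mem_nhds (pos_iff_ne_zero.2 hε2))).and
      self_mem_nhdsWithin).exists
    exact ⟨δ, h3, h2⟩
  obtain ⟨L, hL, hLρ⟩ := P.exists_comparable (half_pos hδ)
  set l := ENNReal.ofReal L with hl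
  have hl1 : l ≠ ⊤ := ENNReal.ofReal_ne_top
  -- The factor `2 * l ^ 2` is the coefficient of `r ^ 2` in the final interior bound. Since `r ≤
  -- 1`, `r ^ 2 ≤ r ≤ r'`.
  obtain ⟨r', hr', hr'ε⟩ := ENNReal.exists_nnreal_pos_mul_lt (a := 2 * l ^ 2) (b := ε / 2 / 2)
    (by finiteness) hε4
  set r : ℝ := min r' (min (δ / 2) 1) with hr
  have hr0 : 0 < r := lt_min hr' (lt_min (half_pos hδ) one_pos)
  have hrδ : 2 * r ≤ δ := by
    have : r ≤ δ / 2 := (min_le_right _ _).trans (min_le_left _ _)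
    linarith
  have hr2 : ENNReal.ofReal r ^ 2 ≤ r' := by
    have h1 : r ≤ 1 := (min_le_right _ _).trans (min_le_right _ _)
    have h2 : r ≤ r' := min_le_left _ _
    rw [← ENNReal.ofReal_pow hr0.le, ← ENNReal.ofReal_coe_nnreal]
    exact ENNReal.ofReal_le_ofReal (by nlinarith)
  set b := volume (Metric.ball (0 : Sp n) r) with hb
  have hb0 : b ≠ 0 := (Metric.measure_ball_pos volume 0 hr0).ne'
  have hb1 : b ≠ ⊤ := measure_ball_lt_top.ne
  -- In the term with the volume of `E₁`, one `l` restores the weight on the left, one converts `μ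
  -- E` into volume, and one comes with the Poincaré bound for `∫ φ²`; `b⁻¹` comes from averaging
  -- over the ball.
  obtain ⟨η, hη, hηε⟩ := ENNReal.exists_nnreal_pos_mul_lt (a := 2 * l ^ 3 * C * b⁻¹)
    (b := ε / 2 / 2) (by
      have : b⁻¹ ≠ ⊤ := ENNReal.inv_ne_top.2 hb0
      finiteness) hε4
  refine ⟨η, by simpa using hη.ne', fun φ hφ E hE hEη => ?_⟩
  set D := ∫⁻ x in O, ENNReal.ofReal (ρ x) * ‖gradient φ x‖ₑ ^ 2 with hD
  rw [P.isWeight.setLIntegral_eq hO hE, P.isWeight.lintegral_eq hO]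
  set E₁ := (E ∩ {x | δ ≤ lastCoord x}) ∩ O with hE₁
  have hmE₁ : MeasurableSet E₁ :=
    (hE.inter (measurableSet_le measurable_const hlm)).inter hO.measurableSet
  have hsplit : E ∩ O ⊆ ({x | lastCoord x < δ} ∩ O) ∪ E₁ := by
    rintro x ⟨hxE, hxO⟩
    rcases lt_or_ge (lastCoord x) δ with h | h
    · exact Or.inl ⟨h, hxO⟩
    · exact Or.inr ⟨⟨hxE, h⟩, hxO⟩
  have hstrip := (P.lintegral_strip_le hSH hφ (δ := δ)).trans (mul_le_mul_left hδε.le D)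
  have hmh : MeasurableSet {y : Sp n | δ / 2 < lastCoord y} := measurableSet_lt measurable_const hlm
  have hint := lintegral_sq_interior_le (hφ.contDiffOn_indicator hO hSH)
    (hφ.measurable_indicator hO) hδ hrδ hmE₁ (fun x hx => hx.1.2)
  have hX : ∫⁻ y in {y | δ / 2 < lastCoord y}, ‖fderiv ℝ (O.indicator φ) y‖ₑ ^ 2 ≤ l * D := by
    have h1 := hφ.setLIntegral_fderiv_indicator hO hSH hmh
      (fun x hx => (half_pos hδ).trans hx) (fun _ => 1)
    simp only [one_mul] at h1
    rw [h1, hD, ← lintegral_const_mul' _ _ hl1]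
    refine (setLIntegral_mono' (hmh.inter hO.measurableSet) (fun x hx => ?_)).trans
      (lintegral_mono_set inter_subset_right)
    rw [← mul_assoc, hl, ← ENNReal.ofReal_mul hL.le]
    refine le_mul_of_one_le_left zero_le ?_
    rw [ENNReal.one_le_ofReal]
    exact (hLρ x hx.2 hx.1).1
  have hY : ∫⁻ y in {y | δ / 2 < lastCoord y}, ‖O.indicator φ y‖ₑ ^ 2 ≤ l * (C * D) := by
    refine le_trans ?_ (mul_le_mul_right (hCP φ hφ) l)
    rw [← lintegral_const_mul' _ _ hl1, ← lintegral_indicator hmh,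
      ← lintegral_indicator hO.measurableSet]
    refine lintegral_mono fun x => ?_
    by_cases hxO : x ∈ O
    · by_cases hxδ : x ∈ {y : Sp n | δ / 2 < lastCoord y}
      · rw [indicator_of_mem hxδ, indicator_of_mem hxO, indicator_of_mem hxO, ← mul_assoc, hl,
          ← ENNReal.ofReal_mul hL.le]
        refine le_mul_of_one_le_left zero_le ?_
        rw [ENNReal.one_le_ofReal]
        exact (hLρ x hxO hxδ).1
      · rw [indicator_of_notMem hxδ]
        exact zero_le
    · refine le_of_eq_of_le ?_ zero_le
      by_cases hxδ : x ∈ {y : Sp n | δ / 2 < lastCoord y}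
      · rw [indicator_of_mem hxδ, indicator_of_notMem hxO]
        simp
      · rw [indicator_of_notMem hxδ]
  have hV : volume E₁ ≤ l * η := by
    refine le_trans ?_ (mul_le_mul_right hEη l)
    have h1 := P.isWeight.setLIntegral_eq hO hE (fun _ => 1)
    rw [setLIntegral_one] at h1
    rw [h1, ← lintegral_const_mul' _ _ hl1, ← setLIntegral_one]
    refine (setLIntegral_mono' hmE₁ fun x hx => ?_).trans
      (lintegral_mono_set (inter_subset_inter_left _ inter_subset_left))
    rw [mul_one, hl, ← ENNReal.ofReal_mul hL.le, ENNReal.one_le_ofReal]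
    exact (hLρ x hx.2 ((half_lt_self hδ).trans_le hx.1.2)).1
  have hZ : ∫⁻ x in E₁, ENNReal.ofReal (ρ x) * ‖φ x‖ₑ ^ 2 ≤
      l * ∫⁻ x in E₁, ‖O.indicator φ x‖ₑ ^ 2 := by
    rw [← lintegral_const_mul' _ _ hl1]
    refine setLIntegral_mono' hmE₁ fun x hx => ?_
    rw [indicator_of_mem hx.2]
    gcongr
    exact ENNReal.ofReal_le_ofReal (hLρ x hx.2 ((half_lt_self hδ).trans_le hx.1.2)).2
  have hbb : b⁻¹ * b = 1 := ENNReal.inv_mul_cancel hb0 hb1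
  have hI : ∫⁻ x in E₁, ‖O.indicator φ x‖ₑ ^ 2 ≤
      2 * (r' * (l * D)) + b⁻¹ * (2 * ((l * η) * (l * (C * D)))) := by
    calc ∫⁻ x in E₁, ‖O.indicator φ x‖ₑ ^ 2
        = b⁻¹ * (b * ∫⁻ x in E₁, ‖O.indicator φ x‖ₑ ^ 2) := by
          rw [← mul_assoc, hbb, one_mul]
      _ ≤ b⁻¹ * (2 * (b * (r' * (l * D))) + 2 * ((l * η) * (l * (C * D)))) := by
          refine mul_le_mul_right (hint.trans ?_) _
          gcongr
      _ = (b⁻¹ * b) * (2 * (r' * (l * D))) + b⁻¹ * (2 * ((l * η) * (l * (C * D)))) := by ring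
      _ = _ := by rw [hbb, one_mul]
  calc ∫⁻ x in E ∩ O, ENNReal.ofReal (ρ x) * ‖φ x‖ₑ ^ 2
      ≤ (∫⁻ x in {x | lastCoord x < δ} ∩ O, ENNReal.ofReal (ρ x) * ‖φ x‖ₑ ^ 2) +
          ∫⁻ x in E₁, ENNReal.ofReal (ρ x) * ‖φ x‖ₑ ^ 2 :=
        (lintegral_mono_set hsplit).trans (lintegral_union_le _ _ _)
    _ ≤ ε / 2 * D + l * (2 * (r' * (l * D)) + b⁻¹ * (2 * ((l * η) * (l * (C * D))))) := by
        gcongr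
        exact hZ.trans (by gcongr)
    _ = ε / 2 * D + (r' * (2 * l ^ 2) + η * (2 * l ^ 3 * C * b⁻¹)) * D := by ring
    _ ≤ ε / 2 * D + (ε / 2 / 2 + ε / 2 / 2) * D := by gcongr
    _ = ε * D := by rw [ENNReal.add_halves, ← add_mul, ENNReal.add_halves]

end UniformIntegrability

/-! ### Limits of quadratic estimates and formulas for the form -/

section Energy

variable {n : ℕ} {O S T : Set (Sp n)} {θ w ρ : Sp n → ℝ}

lemma IsWeight.integrable_iff (h : IsWeight O ρ) (hO : IsOpen O) {f : Sp n → ℝ} :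
    Integrable f (weightedMeasure O ρ) ↔ IntegrableOn (fun x => ρ x * f x) O := by
  rw [weightedMeasure, integrable_withDensity_iff_integrable_smul₀' (h.aemeasurable hO)
    (Eventually.of_forall fun x => ENNReal.ofReal_lt_top)]
  refine integrable_congr ?_
  filter_upwards [ae_restrict_mem hO.measurableSet] with x hx
  rw [ENNReal.toReal_ofReal (h.pos x hx).le, smul_eq_mul]

lemma IsWeight.integral_eq (h : IsWeight O ρ) (hO : IsOpen O) (f : Sp n → ℝ) :
    ∫ x, f x ∂weightedMeasure O ρ = ∫ x in O, ρ x * f x := by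
  rw [weightedMeasure, integral_withDensity_eq_integral_toReal_smul₀ (h.aemeasurable hO)
    (Eventually.of_forall fun x => ENNReal.ofReal_lt_top)]
  refine integral_congr_ae ?_
  filter_upwards [ae_restrict_mem hO.measurableSet] with x hx
  rw [ENNReal.toReal_ofReal (h.pos x hx).le, smul_eq_mul]

/-- Quadratic estimates for test functions extend to the closure. -/
lemma IsSobolev.lintegral_sq_le {f : Sp n → ℝ} {G : Sp n → Sp n} (h : IsSobolev O T θ w f G)
    (W : NormWeights O θ w) {E : Set (Sp n)} {C : ℝ≥0∞} (hC : C ≠ ⊤)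
    (htest : ∀ φ, IsTestFunction O T φ →
      ∫⁻ x in E, ‖φ x‖ₑ ^ 2 ∂weightedMeasure O (fun x => θ x * w x) ≤
        C * ∫⁻ x, ‖gradient φ x‖ₑ ^ 2 ∂weightedMeasure O (fun x => θ x * w x)) :
    ∫⁻ x in E, ‖f x‖ₑ ^ 2 ∂weightedMeasure O (fun x => θ x * w x) ≤
      C * ∫⁻ x, ‖G x‖ₑ ^ 2 ∂weightedMeasure O (fun x => θ x * w x) := by
  have hO := W.isOpen
  obtain ⟨φ, hφ, -, e2, a1, -⟩ := h.exists_seq W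
  set μ := weightedMeasure O (fun x => θ x * w x) with hμ
  have key : ∀ F : Sp n → Sp n, ∫⁻ x, ‖F x‖ₑ ^ 2 ∂μ = (eLpNorm F 2 μ) ^ 2 := fun F => by
    simpa using (eLpNorm_nnreal_pow_eq_lintegral (f := F) (μ := μ) (p := 2) (by norm_num)).symm
  have hN : eLpNorm G 2 μ ≠ ⊤ := (h.memLp_snd W).2.ne
  have hlim : Tendsto (fun k => C * (eLpNorm (gradient (φ k) - G) 2 μ + eLpNorm G 2 μ) ^ 2)
      atTop (𝓝 (C * ∫⁻ x, ‖G x‖ₑ ^ 2 ∂μ)) := by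
    rw [key]
    refine ENNReal.Tendsto.const_mul ?_ (Or.inr hC)
    have h1 := e2.add_const (eLpNorm G 2 μ)
    rw [zero_add] at h1
    exact ((ENNReal.continuous_pow 2).tendsto _).comp h1
  have ha : ∀ᵐ x ∂μ.restrict E, Tendsto (fun k => ‖φ k x‖ₑ ^ 2) atTop (𝓝 (‖f x‖ₑ ^ 2)) := by
    refine ae_restrict_of_ae ((W.snd.ae_iff hO).2 ?_)
    filter_upwards [a1] with x hx
    exact (((ENNReal.continuous_pow 2).comp continuous_enorm).tendsto _).comp hx
  -- Fatou's lemma on the left, using a.e. convergence; norm convergence of the gradients on the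
  -- right.
  calc ∫⁻ x in E, ‖f x‖ₑ ^ 2 ∂μ
      = ∫⁻ x in E, liminf (fun k => ‖φ k x‖ₑ ^ 2) atTop ∂μ :=
        lintegral_congr_ae (ha.mono fun x hx => hx.liminf_eq.symm)
    _ ≤ liminf (fun k => ∫⁻ x in E, ‖φ k x‖ₑ ^ 2 ∂μ) atTop := by
        refine lintegral_liminf_le' fun k => ?_
        exact (((W.snd.aestronglyMeasurable_iff hO).2
          ((hφ k).aesm hO)).enorm.pow_const 2).mono_measure Measure.restrict_le_self
    _ ≤ liminf (fun k => C * (eLpNorm (gradient (φ k) - G) 2 μ + eLpNorm G 2 μ) ^ 2) atTop := by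
        refine liminf_le_liminf (Eventually.of_forall fun k => ?_)
        refine (htest _ (hφ k)).trans ?_
        rw [key]
        gcongr
        have h1 := (((hφ k).isSobolev W).memLp_snd W).1
        have h2 := (h.memLp_snd W).1
        calc eLpNorm (gradient (φ k)) 2 μ = eLpNorm ((gradient (φ k) - G) + G) 2 μ := by
              rw [sub_add_cancel]
          _ ≤ _ := eLpNorm_add_le (h1.sub h2) h2 one_le_two
    _ = _ := hlim.liminf_eq

/-- The structural conditions on the coefficients. -/
structure Coeffs.IsAdmissible (A : Coeffs n) (O : Set (Sp n)) (θ : Sp n → ℝ) (K : ℝ) : Prop where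
  pos : 0 < K
  measurable_a : ∀ i j, AEMeasurable (fun x => A.a x i j) (volume.restrict O)
  measurable_b : AEMeasurable A.b (volume.restrict O)
  measurable_d : AEMeasurable A.d (volume.restrict O)
  measurable_c : AEMeasurable A.c (volume.restrict O)
  lower : ∀ᵐ x ∂volume.restrict O, ∀ η : Sp n,
    θ x * ‖η‖ ^ 2 ≤ ∑ i, ∑ j, A.a x i j * η i * η j
  upper : ∀ᵐ x ∂volume.restrict O, ∀ η : Sp n,
    ∑ i, ∑ j, A.a x i j * η i * η j ≤ K * θ x * ‖η‖ ^ 2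
  bound_d : ∀ᵐ x ∂volume.restrict O, ∀ η : Sp n, |inner ℝ (A.d x) η| ≤ K * θ x * ‖η‖
  bound_b : ∀ᵐ x ∂volume.restrict O, ∀ η : Sp n, |inner ℝ (A.b x) η| ≤ K * θ x * ‖η‖
  bound_c : ∀ᵐ x ∂volume.restrict O, |A.c x| ≤ K * (1 + θ x)

lemma Coeffs.form_congr (A : Coeffs n) {u v v' : Sp n → ℝ} {Du Dv Dv' : Sp n → Sp n}
    (hv : v =ᵐ[volume.restrict O] v') (hDv : Dv =ᵐ[volume.restrict O] Dv') :
    A.form O w u Du v Dv = A.form O w u Du v' Dv' := by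
  refine integral_congr_ae ?_
  filter_upwards [hv, hDv] with x hx hx'
  simp only [hx, hx']

/-- A quadratic form bound used as an integrable majorant. -/
def majorant (θ w v : Sp n → ℝ) (Dv : Sp n → Sp n) (x : Sp n) : ℝ :=
  (1 + θ x) * w x * (1 + v x ^ 2) + θ x * w x * ‖Dv x‖ ^ 2

lemma IsSobolev.integrable_majorant {v : Sp n → ℝ} {Dv : Sp n → Sp n}
    (h : IsSobolev O T θ w v Dv) (W : NormWeights O θ w) :
    IntegrableOn (majorant θ w v Dv) O := by
  have := W.fst.isFiniteMeasure
  have h1 : Integrable (fun x => 1 + v x ^ 2)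
      (weightedMeasure O (fun x => (1 + θ x) * w x)) :=
    (integrable_const 1).add (h.memLp_fst W).integrable_sq
  have h2 : Integrable (fun x => ‖Dv x‖ ^ 2) (weightedMeasure O (fun x => θ x * w x)) :=
    (h.memLp_snd W).norm.integrable_sq
  exact ((W.fst.integrable_iff W.isOpen).1 h1).add ((W.snd.integrable_iff W.isOpen).1 h2)

lemma real_inner_eq_sum (x y : Sp n) : inner ℝ x y = ∑ i, x i * y i := by
  simp [PiLp.inner_apply, mul_comm]

/-- The integrand of `a(u, F(v))` for `u = v + k` on `{v > 0}`. -/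
lemma Coeffs.form_eq_of_truncation (A : Coeffs n) {u v : Sp n → ℝ} {Du Dv : Sp n → Sp n}
    {k : ℝ} {F g : ℝ → ℝ} (hF0 : F 0 = 0)
    (hcase : ∀ᵐ x ∂volume.restrict O, (u x = v x + k ∧ Du x = Dv x) ∨ (v x = 0 ∧ Dv x = 0)) :
    A.form O w u Du (fun x => F (v x)) (fun x => g (v x) • Dv x) =
      ∫ x in O, (g (v x) * (∑ i, ∑ j, A.a x i j * Dv x i * Dv x j) +
        (v x + k) * g (v x) * inner ℝ (A.d x) (Dv x) - F (v x) * inner ℝ (A.b x) (Dv x) +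
        A.c x * ((v x + k) * F (v x))) * w x := by
  refine integral_congr_ae ?_
  filter_upwards [hcase] with x hx
  rcases hx with ⟨hu, hDu⟩ | ⟨hv, hDv⟩
  · simp only [hu, hDu, real_inner_eq_sum, Finset.mul_sum, PiLp.smul_apply, smul_eq_mul]
    congr 2
    · congr 1
      · congr 1
        · refine Finset.sum_congr rfl fun i _ => Finset.sum_congr rfl fun j _ => by ring
        · refine Finset.sum_congr rfl fun i _ => by ring
      · refine Finset.sum_congr rfl fun i _ => by ring
    · ring
  · simp [hv, hDv, hF0]

lemma Coeffs.form_one_eq (A : Coeffs n) {h h' : Sp n → ℝ} {Dv : Sp n → Sp n} :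
    A.form O w (fun _ => 1) (fun _ => 0) h (fun x => h' x • Dv x) =
      ∫ x in O, (h' x * inner ℝ (A.d x) (Dv x) + A.c x * h x) * w x := by
  refine integral_congr_ae (Eventually.of_forall fun x => ?_)
  simp only [real_inner_eq_sum, Finset.mul_sum, PiLp.smul_apply, smul_eq_mul]
  congr 2
  · simp only [PiLp.zero_apply, mul_zero, zero_mul, Finset.sum_const_zero, sub_zero, zero_add]
    refine Finset.sum_congr rfl fun i _ => by ring
  · ring

end Energy

/-! ### Energy estimate with a bounded truncation -/

section Caccioppoli

variable {n : ℕ} {O S T : Set (Sp n)} {θ w : Sp n → ℝ} {A : Coeffs n} {K : ℝ}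

lemma NormWeights.aemeasurable_weight (W : NormWeights O θ w) :
    AEMeasurable w (volume.restrict O) := by
  have : ContinuousOn w O :=
    (W.fst.continuousOn.sub W.snd.continuousOn).congr fun x _ => by
      simp only [Pi.sub_apply]; ring
  exact this.aemeasurable W.isOpen.measurableSet

lemma Coeffs.IsAdmissible.aemeasurable_quadratic (hA : A.IsAdmissible O θ K) {Dv : Sp n → Sp n}
    (hDv : AEMeasurable Dv (volume.restrict O)) :
    AEMeasurable (fun x => ∑ i, ∑ j, A.a x i j * Dv x i * Dv x j) (volume.restrict O) := by
  have hc : ∀ i, AEMeasurable (fun x => Dv x i) (volume.restrict O) := fun i =>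
    (EuclideanSpace.proj (𝕜 := ℝ) i).continuous.measurable.comp_aemeasurable hDv
  exact Finset.aemeasurable_fun_sum _ fun i _ => Finset.aemeasurable_fun_sum _ fun j _ =>
    ((hA.measurable_a i j).mul (hc i)).mul (hc j)

lemma integrableOn_of_le_majorant {v f : Sp n → ℝ} {Dv : Sp n → Sp n}
    (h : IsSobolev O T θ w v Dv) (W : NormWeights O θ w) (C : ℝ)
    (hf : AEMeasurable f (volume.restrict O))
    (hle : ∀ᵐ x ∂volume.restrict O, |f x| ≤ C * majorant θ w v Dv x) : IntegrableOn f O :=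
  ((h.integrable_majorant W).const_mul C).mono' hf.aestronglyMeasurable hle

/-- The energy estimate obtained by testing the subsolution inequality with `F(v)` and the
inequality for the constant function `1` with `(v + k) F(v)`. -/
lemma truncated_energy_le (W : NormWeights O θ w) (hθ : ∀ x ∈ O, 0 < θ x) (hw : ∀ x ∈ O, 0 < w x)
    (hA : A.IsAdmissible O θ K) {u v : Sp n → ℝ} {Du Dv : Sp n → Sp n} {k : ℝ} (hk : 0 ≤ k)
    (hv : IsSobolev O T θ w v Dv) (hv0 : ∀ x, 0 ≤ v x)
    (hcase : ∀ᵐ x ∂volume.restrict O, (u x = v x + k ∧ Du x = Dv x) ∨ (v x = 0 ∧ Dv x = 0))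
    (hsub : ∀ f G, IsSobolev O T θ w f G → (∀ᵐ x ∂volume.restrict O, 0 ≤ f x) →
      A.form O w u Du f G ≤ 0)
    (hone : ∀ f G, IsSobolev O T θ w f G → (∀ᵐ x ∂volume.restrict O, 0 ≤ f x) →
      0 ≤ A.form O w (fun _ => 1) (fun _ => 0) f G)
    {F g : ℝ → ℝ} {B : ℝ} (hF : ∀ s, HasDerivAt F (g s) s) (hg : Continuous g) (hF0 : F 0 = 0)
    (hg0 : ∀ s, 0 ≤ g s) (hg1 : ∀ s, g s ≤ 1) (hFB : ∀ s, |F s| ≤ B) (hgB : ∀ s, |s * g s| ≤ B)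
    (hFnn : ∀ s, 0 ≤ s → 0 ≤ F s) (hFle : ∀ s, 0 ≤ s → F s ≤ s) :
    ∫ x in O, g (v x) * (θ x * w x * ‖Dv x‖ ^ 2) ≤
      2 * K * ∫ x in O, θ x * w x * (v x * ‖Dv x‖) := by
  have hO := W.isOpen
  have hK := hA.pos
  have hFc : Continuous F := continuous_iff_continuousAt.2 fun s => (hF s).continuousAt
  have hFv : IsSobolev O T θ w (fun x => F (v x)) (fun x => g (v x) • Dv x) :=
    hv.comp W hF hF0 hg (L := 1) fun t => by rw [abs_of_nonneg (hg0 t)]; exact hg1 t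
  have hB : 0 ≤ B := (abs_nonneg _).trans (hFB 0)
  -- This is the derivative of `(s + k) * F s`. The bounds on `F` and on `s * g s` serve exactly to
  -- make this product Lipschitz, so that `(v + k) F(v)` is admissible.
  have hhb : ∀ s, |F s + (s + k) * g s| ≤ 2 * B + k := by
    intro s
    have h1 : |k * g s| ≤ k := by
      rw [abs_of_nonneg (mul_nonneg hk (hg0 s))]
      exact mul_le_of_le_one_right hk (hg1 s)
    calc |F s + (s + k) * g s| = |F s + s * g s + k * g s| := by ring_nf
      _ ≤ |F s + s * g s| + |k * g s| := abs_add_le _ _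
      _ ≤ (|F s| + |s * g s|) + |k * g s| := by gcongr; exact abs_add_le _ _
      _ ≤ 2 * B + k := by linarith [hFB s, hgB s]
  have hhv : IsSobolev O T θ w (fun x => (v x + k) * F (v x))
      (fun x => (F (v x) + (v x + k) * g (v x)) • Dv x) := by
    refine hv.comp W (F := fun s => (s + k) * F s) (g := fun s => F s + (s + k) * g s)
      (L := 2 * B + k) (fun s => ?_) (by simp [hF0]) (by fun_prop) hhb
    simpa using ((hasDerivAt_id s).add_const k).fun_mul (hF s)
  have e1 := hsub _ _ hFv (Eventually.of_forall fun x => hFnn _ (hv0 x))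
  have e2 := hone _ _ hhv (Eventually.of_forall fun x =>
    mul_nonneg (add_nonneg (hv0 x) hk) (hFnn _ (hv0 x)))
  rw [A.form_eq_of_truncation hF0 hcase] at e1
  rw [A.form_one_eq] at e2
  have mv : AEMeasurable v (volume.restrict O) := (hv.aesm_fst W).aemeasurable
  have mD : AEMeasurable Dv (volume.restrict O) := (hv.aesm_snd W).aemeasurable
  have mw := W.aemeasurable_weight
  have mθw : AEMeasurable (fun x => θ x * w x) (volume.restrict O) :=
    W.snd.continuousOn.aemeasurable hO.measurableSet
  have mQ := hA.aemeasurable_quadratic mD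
  have md : AEMeasurable (fun x => inner ℝ (A.d x) (Dv x)) (volume.restrict O) :=
    hA.measurable_d.inner mD
  have mF : AEMeasurable (fun x => F (v x)) (volume.restrict O) :=
    hFc.measurable.comp_aemeasurable mv
  have mg : AEMeasurable (fun x => g (v x)) (volume.restrict O) :=
    hg.measurable.comp_aemeasurable mv
  have mc := hA.measurable_c
  -- pointwise estimates by the majorant
  have base : ∀ x ∈ O, 0 < θ x * w x ∧ 0 < w x ∧ 0 ≤ w x * (1 + v x ^ 2) ∧
      majorant θ w v Dv x = θ x * w x * (1 + v x ^ 2 + ‖Dv x‖ ^ 2) + w x * (1 + v x ^ 2) := by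
    intro x hx
    refine ⟨mul_pos (hθ x hx) (hw x hx), hw x hx,
      mul_nonneg (hw x hx).le (by positivity), ?_⟩
    rw [majorant]; ring
  have maj : ∀ x ∈ O, ∀ C, 0 ≤ C → ∀ q, q ≤ C * (1 + v x ^ 2 + ‖Dv x‖ ^ 2) →
      q * (θ x * w x) ≤ C * majorant θ w v Dv x := by
    intro x hx C hC q hq
    obtain ⟨h1, h2, h3, h4⟩ := base x hx
    rw [h4]
    nlinarith [mul_le_mul_of_nonneg_right hq h1.le, mul_nonneg hC h3]
  have hvD : ∀ x, v x * ‖Dv x‖ ≤ 1 + v x ^ 2 + ‖Dv x‖ ^ 2 := fun x => by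
    nlinarith [sq_nonneg (v x - ‖Dv x‖), sq_nonneg (v x + ‖Dv x‖)]
  have hD1 : ∀ x, ‖Dv x‖ ≤ 1 + v x ^ 2 + ‖Dv x‖ ^ 2 := fun x => by
    nlinarith [sq_nonneg (‖Dv x‖ - 1), sq_nonneg (v x)]
  have iQ : IntegrableOn
      (fun x => g (v x) * (∑ i, ∑ j, A.a x i j * Dv x i * Dv x j) * w x) O := by
    refine integrableOn_of_le_majorant hv W K ((mg.mul mQ).mul mw) ?_
    filter_upwards [ae_restrict_mem hO.measurableSet, hA.lower, hA.upper] with x hx hl hu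
    obtain ⟨h1, h2, h3, h4⟩ := base x hx
    have hQ0 := (mul_nonneg (hθ x hx).le (sq_nonneg ‖Dv x‖)).trans (hl (Dv x))
    rw [abs_of_nonneg (mul_nonneg (mul_nonneg (hg0 _) hQ0) h2.le)]
    calc g (v x) * (∑ i, ∑ j, A.a x i j * Dv x i * Dv x j) * w x
        ≤ 1 * (K * θ x * ‖Dv x‖ ^ 2) * w x := by
          gcongr
          · exact hg1 _
          · exact hu _
      _ = K * ‖Dv x‖ ^ 2 * (θ x * w x) := by ring
      _ ≤ _ := maj x hx K hK.le _ (by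
          gcongr; nlinarith [sq_nonneg (v x)])
  have idg : IntegrableOn (fun x => (v x + k) * g (v x) * inner ℝ (A.d x) (Dv x) * w x) O := by
    refine integrableOn_of_le_majorant hv W (K * (1 + k))
      ((((mv.add_const k).mul mg).mul md).mul mw) ?_
    filter_upwards [ae_restrict_mem hO.measurableSet, hA.bound_d] with x hx hd
    obtain ⟨h1, h2, h3, h4⟩ := base x hx
    have hvk := add_nonneg (hv0 x) hk
    rw [abs_mul, abs_mul, abs_mul, abs_of_nonneg hvk, abs_of_nonneg (hg0 _), abs_of_pos h2]
    calc (v x + k) * g (v x) * |inner ℝ (A.d x) (Dv x)| * w x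
        ≤ (v x + k) * 1 * (K * θ x * ‖Dv x‖) * w x := by
          gcongr
          · exact hg1 _
          · exact hd _
      _ = K * (v x * ‖Dv x‖ + k * ‖Dv x‖) * (θ x * w x) := by ring
      _ ≤ _ := maj x hx _ (by positivity) _ (by
          rw [mul_assoc]
          gcongr
          nlinarith [hvD x, mul_le_mul_of_nonneg_left (hD1 x) hk])
  have iFd : ∀ e : Sp n → Sp n, AEMeasurable e (volume.restrict O) →
      (∀ᵐ x ∂volume.restrict O, ∀ η : Sp n, |inner ℝ (e x) η| ≤ K * θ x * ‖η‖) →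
      IntegrableOn (fun x => F (v x) * inner ℝ (e x) (Dv x) * w x) O := by
    intro e me he
    refine integrableOn_of_le_majorant hv W K ((mF.mul (me.inner mD)).mul mw) ?_
    filter_upwards [ae_restrict_mem hO.measurableSet, he] with x hx hd
    obtain ⟨h1, h2, h3, h4⟩ := base x hx
    rw [abs_mul, abs_mul, abs_of_nonneg (hFnn _ (hv0 x)), abs_of_pos h2]
    calc F (v x) * |inner ℝ (e x) (Dv x)| * w x
        ≤ v x * (K * θ x * ‖Dv x‖) * w x := by
          gcongr
          · exact hv0 x
          · exact hFle _ (hv0 x)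
          · exact hd _
      _ = K * (v x * ‖Dv x‖) * (θ x * w x) := by ring
      _ ≤ _ := maj x hx _ hK.le _ (by gcongr; exact hvD x)
  have iFd' := iFd A.d hA.measurable_d hA.bound_d
  have iFb := iFd A.b hA.measurable_b hA.bound_b
  have ic : IntegrableOn (fun x => A.c x * ((v x + k) * F (v x)) * w x) O := by
    refine integrableOn_of_le_majorant hv W (K * (2 + k ^ 2))
      ((mc.mul ((mv.add_const k).mul mF)).mul mw) ?_
    filter_upwards [ae_restrict_mem hO.measurableSet, hA.bound_c] with x hx hc
    obtain ⟨h1, h2, h3, h4⟩ := base x hx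
    have hvk := add_nonneg (hv0 x) hk
    rw [abs_mul, abs_mul, abs_of_nonneg (mul_nonneg hvk (hFnn _ (hv0 x))), abs_of_pos h2]
    have hp : 0 ≤ (1 + θ x) * w x := mul_nonneg (by linarith [hθ x hx]) h2.le
    calc |A.c x| * ((v x + k) * F (v x)) * w x
        ≤ (K * (1 + θ x)) * ((v x + k) * v x) * w x := by
          gcongr
          · exact mul_nonneg hvk (hFnn _ (hv0 x))
          · exact mul_nonneg hK.le (by linarith [hθ x hx])
          · exact hFle _ (hv0 x)
      _ = K * ((1 + θ x) * w x * ((v x + k) * v x)) := by ring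
      _ ≤ K * ((1 + θ x) * w x * ((2 + k ^ 2) * (1 + v x ^ 2))) := by
          refine mul_le_mul_of_nonneg_left (mul_le_mul_of_nonneg_left ?_ hp) hK.le
          nlinarith [sq_nonneg (v x - k), sq_nonneg (v x), sq_nonneg (v x * k), sq_nonneg k]
      _ = K * (2 + k ^ 2) * ((1 + θ x) * w x * (1 + v x ^ 2)) := by ring
      _ ≤ K * (2 + k ^ 2) * majorant θ w v Dv x := by
          gcongr
          rw [majorant]
          exact le_add_of_nonneg_right (mul_nonneg h1.le (sq_nonneg _))
  have iE : IntegrableOn (fun x => g (v x) * (θ x * w x * ‖Dv x‖ ^ 2)) O := by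
    refine integrableOn_of_le_majorant hv W 1 (mg.mul (mθw.mul (mD.norm.pow_const 2))) ?_
    filter_upwards [ae_restrict_mem hO.measurableSet] with x hx
    obtain ⟨h1, h2, h3, h4⟩ := base x hx
    have hq := mul_nonneg h1.le (sq_nonneg ‖Dv x‖)
    rw [abs_of_nonneg (mul_nonneg (hg0 _) hq)]
    calc g (v x) * (θ x * w x * ‖Dv x‖ ^ 2) ≤ 1 * (θ x * w x * ‖Dv x‖ ^ 2) := by
          gcongr; exact hg1 _
      _ = ‖Dv x‖ ^ 2 * (θ x * w x) := by ring
      _ ≤ _ := maj x hx 1 zero_le_one _ (by nlinarith [sq_nonneg (v x)])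
  have iR : IntegrableOn (fun x => θ x * w x * (v x * ‖Dv x‖)) O := by
    refine integrableOn_of_le_majorant hv W 1 (mθw.mul (mv.mul mD.norm)) ?_
    filter_upwards [ae_restrict_mem hO.measurableSet] with x hx
    obtain ⟨h1, h2, h3, h4⟩ := base x hx
    rw [abs_of_nonneg (mul_nonneg h1.le (mul_nonneg (hv0 x) (norm_nonneg _))), mul_comm]
    exact maj x hx 1 zero_le_one _ (by simpa using hvD x)
  set I₁ : Sp n → ℝ := fun x => (g (v x) * (∑ i, ∑ j, A.a x i j * Dv x i * Dv x j) +
        (v x + k) * g (v x) * inner ℝ (A.d x) (Dv x) - F (v x) * inner ℝ (A.b x) (Dv x) +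
        A.c x * ((v x + k) * F (v x))) * w x with hI₁
  set I₂ : Sp n → ℝ := fun x => ((F (v x) + (v x + k) * g (v x)) * inner ℝ (A.d x) (Dv x) +
        A.c x * ((v x + k) * F (v x))) * w x with hI₂
  have i1 : IntegrableOn I₁ O := by
    refine (((iQ.add idg).sub iFb).add ic).congr (Eventually.of_forall fun x => ?_)
    simp only [hI₁, Pi.add_apply, Pi.sub_apply]; ring
  have i2 : IntegrableOn I₂ O := by
    refine ((iFd'.add idg).add ic).congr (Eventually.of_forall fun x => ?_)
    simp only [hI₂, Pi.add_apply]; ring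
  -- In `I₁ - I₂` the `c` terms and the terms `(v + k) g(v) d · Dv` cancel. What remains is `g(v)`
  -- times the quadratic form, minus `F(v) (b + d) · Dv`; ellipticity bounds the first part below,
  -- and `F(v) ≤ v` bounds the second by `2 K θ v |Dv|`.
  have hmono : ∫ x in O, (g (v x) * (θ x * w x * ‖Dv x‖ ^ 2) -
      2 * K * (θ x * w x * (v x * ‖Dv x‖))) ≤ ∫ x in O, (I₁ x - I₂ x) := by
    refine integral_mono_ae (iE.sub (iR.const_mul _)) (i1.sub i2) ?_
    filter_upwards [ae_restrict_mem hO.measurableSet, hA.lower, hA.bound_d, hA.bound_b]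
      with x hx hl hd hb
    obtain ⟨h1, h2, -, -⟩ := base x hx
    have q1 : g (v x) * (θ x * ‖Dv x‖ ^ 2) ≤
        g (v x) * ∑ i, ∑ j, A.a x i j * Dv x i * Dv x j :=
      mul_le_mul_of_nonneg_left (hl _) (hg0 _)
    have hFx := hFnn _ (hv0 x)
    have q0 : 0 ≤ K * θ x * ‖Dv x‖ :=
      mul_nonneg (mul_nonneg hK.le (hθ x hx).le) (norm_nonneg _)
    have q2 : F (v x) * inner ℝ (A.d x) (Dv x) ≤ v x * (K * θ x * ‖Dv x‖) :=
      (mul_le_mul_of_nonneg_left ((le_abs_self _).trans (hd _)) hFx).trans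
        (mul_le_mul_of_nonneg_right (hFle _ (hv0 x)) q0)
    have q3 : F (v x) * inner ℝ (A.b x) (Dv x) ≤ v x * (K * θ x * ‖Dv x‖) :=
      (mul_le_mul_of_nonneg_left ((le_abs_self _).trans (hb _)) hFx).trans
        (mul_le_mul_of_nonneg_right (hFle _ (hv0 x)) q0)
    simp only [hI₁, hI₂]
    have : g (v x) * (θ x * ‖Dv x‖ ^ 2) - 2 * (v x * (K * θ x * ‖Dv x‖)) ≤
        g (v x) * (∑ i, ∑ j, A.a x i j * Dv x i * Dv x j) -
          F (v x) * inner ℝ (A.b x) (Dv x) - F (v x) * inner ℝ (A.d x) (Dv x) := by linarith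
    have := mul_le_mul_of_nonneg_right this h2.le
    linarith
  rw [integral_sub i1 i2, integral_sub iE (iR.const_mul _), integral_const_mul] at hmono
  linarith

end Caccioppoli

/-! ### Removal of the truncation and the Caccioppoli inequality -/

section Comparison

variable {n : ℕ} {O S T : Set (Sp n)} {θ w : Sp n → ℝ} {A : Coeffs n} {K : ℝ}

/-- A bounded approximation of the identity function, with derivative `1 / (1 + (e s)²)`. -/
def damped (e s : ℝ) : ℝ := Real.arctan (e * s) / e

lemma hasDerivAt_damped {e : ℝ} (he : 0 < e) (s : ℝ) :
    HasDerivAt (damped e) (1 / (1 + (e * s) ^ 2)) s := by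
  have h1 : HasDerivAt (fun s => e * s) e s := by simpa using (hasDerivAt_id s).const_mul e
  have h2 := (h1.arctan).div_const e
  rwa [mul_div_assoc, div_self he.ne', mul_one] at h2

lemma abs_damped_le {e : ℝ} (he : 0 < e) (s : ℝ) : |damped e s| ≤ 2 / e := by
  rw [damped, abs_div, abs_of_pos he]
  gcongr
  have h1 := Real.arctan_lt_pi_div_two (e * s)
  have h2 := Real.neg_pi_div_two_lt_arctan (e * s)
  rw [abs_le]
  constructor <;> linarith [Real.pi_le_four]

lemma abs_mul_deriv_damped_le {e : ℝ} (he : 0 < e) (s : ℝ) :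
    |s * (1 / (1 + (e * s) ^ 2))| ≤ 2 / e := by
  have hp : 0 < 1 + (e * s) ^ 2 := by positivity
  rw [mul_one_div, abs_div, abs_of_pos hp, div_le_div_iff₀ hp he]
  have : |s| * e = |e * s| := by rw [abs_mul, abs_of_pos he, mul_comm]
  rw [this]
  nlinarith [sq_nonneg (|e * s| - 1), sq_abs (e * s)]

lemma damped_nonneg {e : ℝ} (he : 0 < e) {s : ℝ} (hs : 0 ≤ s) : 0 ≤ damped e s :=
  div_nonneg (Real.arctan_nonneg.2 (mul_nonneg he.le hs)) he.le

lemma damped_le_self {e : ℝ} (he : 0 < e) {s : ℝ} (hs : 0 ≤ s) : damped e s ≤ s := by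
  rw [damped, div_le_iff₀ he, mul_comm s e]
  have := Real.le_tan (Real.arctan_nonneg.2 (mul_nonneg he.le hs))
    (Real.arctan_lt_pi_div_two (e * s))
  rwa [Real.tan_arctan] at this

/-- Apply the truncated estimate to `damped e` and let `e = 1 / (j + 1) → 0`. The right side does
not depend on `e`; on the left the derivative factors increase to `1`, and dominated convergence
applies. -/
lemma energy_le (W : NormWeights O θ w) (hθ : ∀ x ∈ O, 0 < θ x) (hw : ∀ x ∈ O, 0 < w x)
    (hA : A.IsAdmissible O θ K) {u v : Sp n → ℝ} {Du Dv : Sp n → Sp n} {k : ℝ} (hk : 0 ≤ k)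
    (hv : IsSobolev O T θ w v Dv) (hv0 : ∀ x, 0 ≤ v x)
    (hcase : ∀ᵐ x ∂volume.restrict O, (u x = v x + k ∧ Du x = Dv x) ∨ (v x = 0 ∧ Dv x = 0))
    (hsub : ∀ f G, IsSobolev O T θ w f G → (∀ᵐ x ∂volume.restrict O, 0 ≤ f x) →
      A.form O w u Du f G ≤ 0)
    (hone : ∀ f G, IsSobolev O T θ w f G → (∀ᵐ x ∂volume.restrict O, 0 ≤ f x) →
      0 ≤ A.form O w (fun _ => 1) (fun _ => 0) f G) :
    ∫ x in O, θ x * w x * ‖Dv x‖ ^ 2 ≤ 2 * K * ∫ x in O, θ x * w x * (v x * ‖Dv x‖) := by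
  have hO := W.isOpen
  have hJ : IntegrableOn (fun x => θ x * w x * ‖Dv x‖ ^ 2) O :=
    (W.snd.integrable_iff hO).1 (hv.memLp_snd W).norm.integrable_sq
  have mv : AEMeasurable v (volume.restrict O) := (hv.aesm_fst W).aemeasurable
  have hcont : ∀ e : ℝ, Continuous fun s : ℝ => 1 / (1 + (e * s) ^ 2) := fun e =>
    continuous_const.div (by fun_prop) fun s => by positivity
  have hlim : Tendsto (fun j : ℕ => ∫ x in O,
      1 / (1 + (1 / (j + 1 : ℝ) * v x) ^ 2) * (θ x * w x * ‖Dv x‖ ^ 2)) atTop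
      (𝓝 (∫ x in O, θ x * w x * ‖Dv x‖ ^ 2)) := by
    refine tendsto_integral_of_dominated_convergence (fun x => θ x * w x * ‖Dv x‖ ^ 2)
      (fun j => ?_) hJ (fun j => ?_) (Eventually.of_forall fun x => ?_)
    · exact (((hcont _).measurable.comp_aemeasurable mv).aestronglyMeasurable).mul hJ.1
    · filter_upwards [ae_restrict_mem hO.measurableSet] with x hx
      have h1 : 0 ≤ θ x * w x * ‖Dv x‖ ^ 2 :=
        mul_nonneg (mul_nonneg (hθ x hx).le (hw x hx).le) (sq_nonneg _)
      have h2 : 1 / (1 + (1 / (j + 1 : ℝ) * v x) ^ 2) ≤ 1 := by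
        rw [div_le_one (by positivity)]
        linarith [sq_nonneg (1 / (j + 1 : ℝ) * v x)]
      rw [Real.norm_eq_abs, abs_of_nonneg (mul_nonneg (by positivity) h1)]
      exact mul_le_of_le_one_left h1 h2
    · have h1 : Tendsto (fun j : ℕ => 1 / (j + 1 : ℝ)) atTop (𝓝 0) :=
        tendsto_one_div_add_atTop_nhds_zero_nat
      have h2 : Continuous fun e : ℝ => 1 / (1 + (e * v x) ^ 2) * (θ x * w x * ‖Dv x‖ ^ 2) :=
        (continuous_const.div (by fun_prop) fun s => by positivity).mul continuous_const
      simpa [Function.comp_def] using (h2.tendsto 0).comp h1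
  refine le_of_tendsto hlim (Eventually.of_forall fun j => ?_)
  have he : 0 < 1 / (j + 1 : ℝ) := by positivity
  exact truncated_energy_le W hθ hw hA hk hv hv0 hcase hsub hone (hasDerivAt_damped he)
    (hcont _) (by simp [damped]) (fun s => by positivity)
    (fun s => by
      rw [div_le_one (by positivity)]
      linarith [sq_nonneg (1 / (j + 1 : ℝ) * s)])
    (abs_damped_le he) (abs_mul_deriv_damped_le he) (fun s => damped_nonneg he)
    (fun s => damped_le_self he)

/-- Caccioppoli inequality, localized to a set that carries the gradient. -/
lemma caccioppoli (W : NormWeights O θ w) (hθ : ∀ x ∈ O, 0 < θ x) (hw : ∀ x ∈ O, 0 < w x)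
    (hA : A.IsAdmissible O θ K) {u v : Sp n → ℝ} {Du Dv : Sp n → Sp n} {k : ℝ} (hk : 0 ≤ k)
    (hv : IsSobolev O T θ w v Dv) (hv0 : ∀ x, 0 ≤ v x)
    (hcase : ∀ᵐ x ∂volume.restrict O, (u x = v x + k ∧ Du x = Dv x) ∨ (v x = 0 ∧ Dv x = 0))
    (hsub : ∀ f G, IsSobolev O T θ w f G → (∀ᵐ x ∂volume.restrict O, 0 ≤ f x) →
      A.form O w u Du f G ≤ 0)
    (hone : ∀ f G, IsSobolev O T θ w f G → (∀ᵐ x ∂volume.restrict O, 0 ≤ f x) →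
      0 ≤ A.form O w (fun _ => 1) (fun _ => 0) f G)
    {E : Set (Sp n)} (hE : MeasurableSet E) (hEv : ∀ x, x ∉ E → v x * ‖Dv x‖ = 0) :
    ∫⁻ x, ‖Dv x‖ₑ ^ 2 ∂weightedMeasure O (fun x => θ x * w x) ≤ ENNReal.ofReal (4 * K ^ 2) *
      ∫⁻ x in E, ‖v x‖ₑ ^ 2 ∂weightedMeasure O (fun x => θ x * w x) := by
  have hO := W.isOpen
  have hK := hA.pos
  have h := energy_le W hθ hw hA hk hv hv0 hcase hsub hone
  rw [← W.snd.integral_eq hO, ← W.snd.integral_eq hO] at h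
  set μ := weightedMeasure O (fun x => θ x * w x) with hμ
  have mv : MemLp v 2 μ := by
    have hle : μ ≤ weightedMeasure O (fun x => (1 + θ x) * w x) := by
      refine Measure.le_iff.2 fun s hs => ?_
      rw [hμ, weightedMeasure, weightedMeasure, withDensity_apply _ hs, withDensity_apply _ hs,
        Measure.restrict_restrict hs]
      refine setLIntegral_mono' (hs.inter hO.measurableSet) fun x hx => ?_
      exact ENNReal.ofReal_le_ofReal (by linarith [hw x hx.2])
    exact (hv.memLp_fst W).mono_measure hle
  have iD : Integrable (fun x => ‖Dv x‖ ^ 2) μ := (hv.memLp_snd W).norm.integrable_sq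
  have iv : Integrable (fun x => v x ^ 2) μ := mv.integrable_sq
  have ivE : Integrable (E.indicator fun x => v x ^ 2) μ := iv.indicator hE
  -- Young's inequality with weight `1 / 2`, so that half of the energy can be absorbed. Off `E` the
  -- left side is zero, which is why only `E` enters on the right.
  have hpt : ∀ x, 2 * K * (v x * ‖Dv x‖) ≤
      1 / 2 * ‖Dv x‖ ^ 2 + 2 * K ^ 2 * E.indicator (fun x => v x ^ 2) x := by
    intro x
    by_cases hx : x ∈ E
    · rw [indicator_of_mem hx]
      nlinarith [sq_nonneg (‖Dv x‖ - 2 * K * v x)]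
    · rw [hEv x hx, indicator_of_notMem hx]
      nlinarith [sq_nonneg ‖Dv x‖]
  have h2 : 2 * K * ∫ x, v x * ‖Dv x‖ ∂μ ≤
      1 / 2 * ∫ x, ‖Dv x‖ ^ 2 ∂μ + 2 * K ^ 2 * ∫ x, E.indicator (fun x => v x ^ 2) x ∂μ := by
    rw [← integral_const_mul, ← integral_const_mul, ← integral_const_mul,
      ← integral_add (iD.const_mul _) (ivE.const_mul _)]
    exact integral_mono ((mv.integrable_mul (hv.memLp_snd W).norm).const_mul _)
      ((iD.const_mul _).add (ivE.const_mul _)) hpt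
  have h3 : ∫ x, ‖Dv x‖ ^ 2 ∂μ ≤ 4 * K ^ 2 * ∫ x, E.indicator (fun x => v x ^ 2) x ∂μ := by
    linarith
  have c1 : ∫⁻ x, ‖Dv x‖ₑ ^ 2 ∂μ = ENNReal.ofReal (∫ x, ‖Dv x‖ ^ 2 ∂μ) := by
    rw [ofReal_integral_eq_lintegral_ofReal iD (Eventually.of_forall fun x => sq_nonneg _)]
    refine lintegral_congr fun x => ?_
    rw [ENNReal.ofReal_pow (norm_nonneg _), ofReal_norm]
  have c2 : ∫⁻ x in E, ‖v x‖ₑ ^ 2 ∂μ =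
      ENNReal.ofReal (∫ x, E.indicator (fun x => v x ^ 2) x ∂μ) := by
    rw [integral_indicator hE, ofReal_integral_eq_lintegral_ofReal iv.integrableOn
      (Eventually.of_forall fun x => sq_nonneg _)]
    refine lintegral_congr fun x => ?_
    rw [ENNReal.ofReal_pow (hv0 x), Real.enorm_eq_ofReal (hv0 x)]
  rw [c1, c2, ← ENNReal.ofReal_mul (by positivity)]
  exact ENNReal.ofReal_le_ofReal h3

end Comparison

/-! ### Level sets and the maximum principle -/

section MaximumPrinciple

variable {n : ℕ} {O S T : Set (Sp n)} {θ w : Sp n → ℝ} {A : Coeffs n} {K : ℝ}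

/-- The boundary condition supplies `(u - l)⁺` as a function only, and `(u - m)⁺ = ((u - l)⁺ - (m -
l))⁺`. Its gradient is identified with `1_{u > m} Du` by uniqueness, since `(u - m)⁺` also arises
from `u` itself in the larger space. -/
lemma LeOnBoundary.isSobolev_posPart (W : NormWeights O θ w) {u : Pairs O θ w}
    (hu : u ∈ H1 O θ w) {l m : ℝ} (h : LeOnBoundary S u l) (hlm : l ≤ m) (hm : 0 ≤ m) :
    IsSobolev O (O ∪ S) θ w (fun x => max (u.fst x - m) 0)
      (fun x => (Ioi m).indicator (fun _ => (1 : ℝ)) (u.fst x) • u.snd x) := by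
  obtain ⟨v, hv, hvu⟩ := h
  have h1 := (IsSobolev.of_mem hv).posPart W (m := m - l) (by linarith)
  have h2 := h1.congr (f' := fun x => max (u.fst x - m) 0) (by
    filter_upwards [hvu] with x hx
    rw [hx]
    rcases le_total (u.fst x) l with hc | hc
    · rw [max_eq_right (by linarith : u.fst x - l ≤ 0), max_eq_right (by linarith),
        max_eq_right (by linarith)]
    · rw [max_eq_left (by linarith : 0 ≤ u.fst x - l)]
      congr 1
      ring) EventuallyEq.rfl
  exact h2.congr EventuallyEq.rfl
    (h2.gradient_unique ((IsSobolev.of_mem hu).posPart W hm) W)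

lemma IsSubsolution.form_nonpos {u : Pairs O θ w} (h : IsSubsolution S A.bilin u)
    {f : Sp n → ℝ} {G : Sp n → Sp n} (hf : IsSobolev O (O ∪ S) θ w f G)
    (hf0 : ∀ᵐ x ∂volume.restrict O, 0 ≤ f x) : A.form O w u.fst u.snd f G ≤ 0 := by
  obtain ⟨p, hp, h1, h2⟩ := hf
  rw [← A.form_congr h1 h2]
  refine h p hp ?_
  filter_upwards [h1, hf0] with x hx hx'
  rwa [hx]

lemma form_one_nonneg (hone : ∀ v ∈ H10 O S θ w, NonnegAE v →
      0 ≤ A.form O w (fun _ => 1) (fun _ => 0) v.fst v.snd)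
    {f : Sp n → ℝ} {G : Sp n → Sp n} (hf : IsSobolev O (O ∪ S) θ w f G)
    (hf0 : ∀ᵐ x ∂volume.restrict O, 0 ≤ f x) :
    0 ≤ A.form O w (fun _ => 1) (fun _ => 0) f G := by
  obtain ⟨p, hp, h1, h2⟩ := hf
  rw [← A.form_congr h1 h2]
  refine hone p hp ?_
  filter_upwards [h1, hf0] with x hx hx'
  rwa [hx]

/-- If the gradient of a subsolution is carried by a small enough set above the level `m`, then the
level `m` is an upper bound. -/
lemma exists_forall_le_of_measure_le (W : NormWeights O θ w) {γ c M : ℝ}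
    (P : IsPowerWeight O (fun x => θ x * w x) γ c M) (hSH : ∀ x ∈ S, lastCoord x = 0)
    (hθ : ∀ x ∈ O, 0 < θ x) (hw : ∀ x ∈ O, 0 < w x) (hA : A.IsAdmissible O θ K)
    (hone : ∀ v ∈ H10 O S θ w, NonnegAE v →
      0 ≤ A.form O w (fun _ => 1) (fun _ => 0) v.fst v.snd)
    {u : Pairs O θ w} (hu : u ∈ H1 O θ w) (hsub : IsSubsolution S A.bilin u) {l : ℝ}
    (hl : LeOnBoundary S u l) :
    ∃ η : ℝ≥0∞, η ≠ 0 ∧ ∀ m, 0 ≤ m → l ≤ m →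
      weightedMeasure O (fun x => θ x * w x) {x | m < u.fst x ∧ u.snd x ≠ 0} ≤ η →
      ∀ᵐ x ∂volume.restrict O, u.fst x ≤ m := by
  have hO := W.isOpen
  have hK := hA.pos
  -- With this `ε` the Caccioppoli constant `4 * K ^ 2` becomes `1 / 2`, giving `D ≤ D / 2` for the
  -- finite energy `D`.
  have hε : ENNReal.ofReal (1 / (8 * K ^ 2)) ≠ 0 := by
    rw [Ne, ENNReal.ofReal_eq_zero, not_le]; positivity
  obtain ⟨η, hη, hUI⟩ := P.exists_uniformIntegrable hSH hε
  obtain ⟨C, hC, hCP⟩ := P.exists_poincare hSH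
  refine ⟨η, hη, fun m hm hlm hmeas => ?_⟩
  set E : Set (Sp n) := {x | m < u.fst x ∧ u.snd x ≠ 0} with hE
  have hmE : MeasurableSet E :=
    (measurableSet_lt measurable_const (Lp.stronglyMeasurable u.fst).measurable).inter
      ((Lp.stronglyMeasurable u.snd).measurable (measurableSet_singleton 0).compl)
  have hv := hl.isSobolev_posPart W hu hlm hm
  set v : Sp n → ℝ := fun x => max (u.fst x - m) 0 with hvdef
  set Dv : Sp n → Sp n :=
    fun x => (Ioi m).indicator (fun _ => (1 : ℝ)) (u.fst x) • u.snd x with hDv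
  have hcase : ∀ x, (u.fst x = v x + m ∧ u.snd x = Dv x) ∨ (v x = 0 ∧ Dv x = 0) := by
    intro x
    rcases lt_or_ge m (u.fst x) with hx | hx
    · refine Or.inl ⟨?_, ?_⟩
      · simp only [hvdef]
        rw [max_eq_left (by linarith)]; ring
      · simp only [hDv]
        rw [indicator_of_mem (show u.fst x ∈ Ioi m from hx), one_smul]
    · refine Or.inr ⟨max_eq_right (by linarith), ?_⟩
      simp only [hDv]
      rw [indicator_of_notMem (show u.fst x ∉ Ioi m from not_lt.2 hx), zero_smul]
  have hEv : ∀ x, x ∉ E → v x * ‖Dv x‖ = 0 := by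
    intro x hx
    by_cases h1 : m < u.fst x
    · have h2 : u.snd x = 0 := by
        by_contra h2
        exact hx ⟨h1, h2⟩
      simp [hDv, h2]
    · have : v x = 0 := max_eq_right (by linarith [not_lt.1 h1])
      rw [this, zero_mul]
  have hcac := caccioppoli W hθ hw hA hm hv (fun x => le_max_right _ _)
    (Eventually.of_forall hcase) (fun f G hf hf0 => hsub.form_nonpos hf hf0)
    (fun f G hf hf0 => form_one_nonneg hone hf hf0) hmE hEv
  have hui := hv.lintegral_sq_le W (E := E) ENNReal.ofReal_ne_top
    fun φ hφ => hUI φ hφ E hmE hmeas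
  have hpoin := hv.lintegral_sq_le W (E := univ) hC fun φ hφ => by
    rw [Measure.restrict_univ, W.snd.lintegral_eq hO, W.snd.lintegral_eq hO]
    exact hCP φ hφ
  set μ := weightedMeasure O (fun x => θ x * w x) with hμ
  set D := ∫⁻ x, ‖Dv x‖ₑ ^ 2 ∂μ with hD
  have hDfin : D ≠ ⊤ := by
    have := eLpNorm_nnreal_pow_eq_lintegral (f := Dv) (μ := μ) (p := 2) (by norm_num)
    simp only [ENNReal.coe_ofNat, NNReal.coe_ofNat, ENNReal.rpow_ofNat] at this
    rw [hD, ← this]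
    exact ENNReal.pow_ne_top (hv.memLp_snd W).2.ne
  have hhalf : D ≤ ENNReal.ofReal (1 / 2) * D := by
    refine hcac.trans ((mul_le_mul_right hui _).trans (le_of_eq ?_))
    rw [← mul_assoc, ← ENNReal.ofReal_mul (by positivity)]
    congr 2
    field_simp
    norm_num
  have hD0 : D = 0 := by
    by_contra hne
    have hlt : ENNReal.ofReal (1 / 2) * D < 1 * D := by
      refine ENNReal.mul_lt_mul_left hne hDfin ?_
      rw [← ENNReal.ofReal_one, ENNReal.ofReal_lt_ofReal_iff one_pos]
      norm_num
    rw [one_mul] at hlt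
    exact absurd hhalf (not_le.2 hlt)
  -- The energy is zero, so the Poincaré inequality forces `v = 0` a.e.
  rw [hD0, mul_zero, Measure.restrict_univ, nonpos_iff_eq_zero,
    lintegral_eq_zero_iff' ((hv.memLp_fst W).1.enorm.pow_const 2 |>.mono_ac ?_)] at hpoin
  · filter_upwards [(W.snd.ae_iff hO).1 hpoin] with x hx
    have h1 : ‖v x‖ₑ = 0 := (pow_eq_zero_iff two_ne_zero).1 hx
    have h2 : max (u.fst x - m) 0 = 0 := enorm_eq_zero.1 h1
    have := le_max_left (u.fst x - m) 0
    linarith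
  · refine Measure.ae_le_iff_absolutelyContinuous.1 ?_
    rw [hμ, W.snd.ae_eq hO, W.fst.ae_eq hO]

/-- A subsolution is bounded by `max l 0` if it is at most `l` on the boundary. -/
lemma ae_le_of_leOnBoundary (W : NormWeights O θ w) {γ c M : ℝ}
    (P : IsPowerWeight O (fun x => θ x * w x) γ c M) (hSH : ∀ x ∈ S, lastCoord x = 0)
    (hθ : ∀ x ∈ O, 0 < θ x) (hw : ∀ x ∈ O, 0 < w x) (hA : A.IsAdmissible O θ K)
    (hone : ∀ v ∈ H10 O S θ w, NonnegAE v →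
      0 ≤ A.form O w (fun _ => 1) (fun _ => 0) v.fst v.snd)
    {u : Pairs O θ w} (hu : u ∈ H1 O θ w) (hsub : IsSubsolution S A.bilin u) {l : ℝ}
    (hl : LeOnBoundary S u l) : ∀ᵐ x ∂volume.restrict O, u.fst x ≤ max l 0 := by
  have hO := W.isOpen
  obtain ⟨η, hη, hlevel⟩ := exists_forall_le_of_measure_le W P hSH hθ hw hA hone hu hsub hl
  set l₀ := max l 0
  set μ := weightedMeasure O (fun x => θ x * w x) with hμ
  have : IsFiniteMeasure μ := W.snd.isFiniteMeasure
  set E : ℝ → Set (Sp n) := fun m => {x | m < u.fst x ∧ u.snd x ≠ 0} with hE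
  have hmE : ∀ m, MeasurableSet (E m) := fun m =>
    (measurableSet_lt measurable_const (Lp.stronglyMeasurable u.fst).measurable).inter
      ((Lp.stronglyMeasurable u.snd).measurable (measurableSet_singleton 0).compl)
  -- Continuity from above of the finite measure `μ` makes some `μ (E (m j))` fall below the
  -- threshold `η`. It is used twice: for levels tending to infinity and for levels increasing to
  -- `m₀`.
  have hseq : ∀ m : ℕ → ℝ, Monotone m → (∀ j, l₀ ≤ m j) → μ (⋂ j, E (m j)) = 0 →
      ∃ j, ∀ᵐ x ∂volume.restrict O, u.fst x ≤ m j := by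
    intro m hmono hml hnull
    have hanti : Antitone fun j => E (m j) := fun i j hij x hx => ⟨(hmono hij).trans_lt hx.1, hx.2⟩
    have ht := tendsto_measure_iInter_atTop (μ := μ) (s := fun j => E (m j))
      (fun j => (hmE _).nullMeasurableSet) hanti ⟨0, measure_ne_top _ _⟩
    rw [hnull] at ht
    obtain ⟨j, hj⟩ := (ht.eventually (gt_mem_nhds (pos_iff_ne_zero.2 hη))).exists
    exact ⟨j, hlevel (m j) ((le_max_right _ _).trans (hml j)) ((le_max_left _ _).trans (hml j))
      hj.le⟩
  set B : Set ℝ := {m | l₀ ≤ m ∧ ∀ᵐ x ∂volume.restrict O, u.fst x ≤ m} with hB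
  have hne : B.Nonempty := by
    obtain ⟨j, hj⟩ := hseq (fun j => l₀ + j) (fun i j hij => by
      have : (i : ℝ) ≤ j := Nat.cast_le.2 hij
      simpa using this) (fun j => by simp) (by
      have : ⋂ j : ℕ, E (l₀ + j) = ∅ := by
        refine eq_empty_of_forall_notMem fun x hx => ?_
        obtain ⟨j, hj⟩ := exists_nat_gt (u.fst x - l₀)
        have := (mem_iInter.1 hx j).1
        linarith
      rw [this, measure_empty])
    exact ⟨_, by simp, hj⟩
  have hbdd : BddBelow B := ⟨l₀, fun m hm => hm.1⟩
  set m₀ := sInf B with hm₀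
  have hlm₀ : l₀ ≤ m₀ := le_csInf hne fun m hm => hm.1
  have hle : ∀ᵐ x ∂volume.restrict O, u.fst x ≤ m₀ := by
    have hj : ∀ j : ℕ, ∀ᵐ x ∂volume.restrict O, u.fst x ≤ m₀ + 1 / (j + 1 : ℝ) := by
      intro j
      obtain ⟨m, hm, hlt⟩ := exists_lt_of_csInf_lt hne
        (show sInf B < m₀ + 1 / (j + 1 : ℝ) from lt_add_of_pos_right _ (by positivity))
      filter_upwards [hm.2] with x hx using hx.trans hlt.le
    filter_upwards [ae_all_iff.2 hj] with x hx
    have ht : Tendsto (fun j : ℕ => m₀ + 1 / (j + 1 : ℝ)) atTop (𝓝 m₀) := by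
      simpa using (tendsto_one_div_add_atTop_nhds_zero_nat (𝕜 := ℝ)).const_add m₀
    exact ge_of_tendsto' ht hx
  rcases hlm₀.eq_or_lt with heq | hlt
  · rwa [heq]
  exfalso
  have hlevel0 := (IsSobolev.of_mem hu).gradient_eq_zero_of_eq W
    ((le_max_right l 0).trans hlm₀)
  have hpos : 0 < m₀ - l₀ := sub_pos.2 hlt
  -- These levels start at `l₀` for `j = 0`, increase to `m₀` and stay strictly below it. A point in
  -- all the sets `E` satisfies `u ≥ m₀`, hence `u = m₀` a.e., with nonzero gradient, which is
  -- excluded a.e.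
  obtain ⟨j, hj⟩ := hseq (fun j => m₀ - (m₀ - l₀) * (1 / (j + 1 : ℝ))) (fun i j hij => by
      have : 1 / (j + 1 : ℝ) ≤ 1 / (i + 1 : ℝ) := one_div_le_one_div_of_le (by positivity)
        (by have : (i : ℝ) ≤ j := Nat.cast_le.2 hij
            linarith)
      have := mul_le_mul_of_nonneg_left this hpos.le
      simp only
      linarith) (fun j => by
      have h1 : 1 / (j + 1 : ℝ) ≤ 1 := by
        rw [div_le_one (by positivity)]; linarith [(Nat.cast_nonneg j : (0 : ℝ) ≤ j)]
      nlinarith) (by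
      have hz : ∀ᵐ x ∂μ, x ∉ ⋂ j : ℕ, E (m₀ - (m₀ - l₀) * (1 / (j + 1 : ℝ))) := by
        rw [hμ, W.snd.ae_iff hO]
        filter_upwards [hle, hlevel0] with x hx hx0 hmem
        have ht : Tendsto (fun j : ℕ => m₀ - (m₀ - l₀) * (1 / (j + 1 : ℝ))) atTop (𝓝 m₀) := by
          simpa using ((tendsto_one_div_add_atTop_nhds_zero_nat (𝕜 := ℝ)).const_mul
            (m₀ - l₀)).const_sub m₀
        have hge : m₀ ≤ u.fst x := le_of_tendsto' ht fun j => (mem_iInter.1 hmem j).1.le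
        exact (mem_iInter.1 hmem 0).2 (hx0 (le_antisymm hx hge))
      simpa using measure_eq_zero_iff_ae_notMem.2 hz)
  have hmem : m₀ - (m₀ - l₀) * (1 / (j + 1 : ℝ)) ∈ B := by
    refine ⟨?_, hj⟩
    have h1 : 1 / (j + 1 : ℝ) ≤ 1 := by
      rw [div_le_one (by positivity)]; linarith [(Nat.cast_nonneg j : (0 : ℝ) ≤ j)]
    nlinarith
  have h1 := csInf_le hbdd hmem
  have h2 : 0 < (m₀ - l₀) * (1 / (j + 1 : ℝ)) := by positivity
  linarith

/-- A bounded open subset of the half-space has boundary points in the open half-space. -/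
lemma eq_empty_of_frontier_diff_eq_empty (hO : IsOpen O) (hOb : Bornology.IsBounded O)
    (hOH : O ⊆ halfSpace n) (hSH : ∀ x ∈ S, lastCoord x = 0) (h : frontier O \ S = ∅) :
    O = ∅ := by
  by_contra hne
  obtain ⟨x, hx⟩ := nonempty_iff_ne_empty.2 hne
  have hconv : Convex ℝ (halfSpace n) := by
    intro x hx y hy a b ha hb hab
    have hx' : 0 < lastCoord x := hx
    have hy' : 0 < lastCoord y := hy
    change 0 < a * lastCoord x + b * lastCoord y
    rcases ha.eq_or_lt with rfl | ha'
    · have : b = 1 := by linarith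
      subst this
      linarith
    · nlinarith [mul_pos ha' hx', mul_nonneg hb hy'.le]
  -- If all boundary points were in `S`, then `O` would be relatively closed as well as open in the
  -- connected half-space, hence all of it, contradicting boundedness.
  have hsub : halfSpace n ⊆ O := by
    refine hconv.isPreconnected.subset_of_closure_inter_subset hO ⟨x, hOH hx, hx⟩ ?_
    rintro y ⟨hy, hyH⟩
    by_contra hyO
    have hyf : y ∈ frontier O := ⟨hy, by rwa [hO.interior_eq]⟩
    have hyS : y ∈ S := by
      by_contra hyS
      exact (h ▸ (⟨hyf, hyS⟩ : y ∈ frontier O \ S) : y ∈ (∅ : Set (Sp n)))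
    exact hyH.ne' (hSH y hyS)
  obtain ⟨R, hR, hOR⟩ := hOb.subset_ball_lt 0 0
  have hmem : R • vertical n ∈ O := hsub (by
    change 0 < R * lastCoord (vertical n)
    simpa using hR)
  have h1 : ‖R • vertical n‖ < R := by simpa using hOR hmem
  have h2 := abs_lastCoord_le (R • vertical n)
  rw [lastCoord_smul, lastCoord_vertical, mul_one, abs_of_pos hR] at h2
  linarith

end MaximumPrinciple

end

end WeightedWMP

theorem mainTheorem7 (n : ℕ) (O S : Set (Sp n)) (hO : IsOpen O) (hOb : Bornology.IsBounded O)
    (hOH : O ⊆ halfSpace n)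
    (hS : S ⊆ frontier O) (hSH : ∀ x ∈ S, lastCoord x = 0)
    (θ w : Sp n → ℝ) (hw : IsWeight O w) (hθ : IsDegeneracyCoeff O θ)
    (hθw : IntegrableOn (fun x => θ x * w x) O)
    (α β cθ cw : ℝ) (hα0 : 0 ≤ α) (hα2 : α < 2) (hβ : 0 < β)
    (hcθ0 : 0 < cθ) (hcθ1 : cθ < 1) (hcw0 : 0 < cw) (hcw1 : cw < 1)
    (hθα : ∀ x ∈ O, cθ * lastCoord x ^ α ≤ θ x ∧ θ x ≤ cθ⁻¹ * lastCoord x ^ α)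
    (hwβ : ∀ x ∈ O, cw * lastCoord x ^ (β - 1) ≤ w x ∧ w x ≤ cw⁻¹ * lastCoord x ^ (β - 1))
    (A : Coeffs n) (K : ℝ) (hK : 0 < K)
    (ham : ∀ i j, AEMeasurable (fun x => A.a x i j) (volume.restrict O))
    (hbm : AEMeasurable A.b (volume.restrict O))
    (hdm : AEMeasurable A.d (volume.restrict O))
    (hcm : AEMeasurable A.c (volume.restrict O))
    (hapsd : ∀ᵐ x ∂volume.restrict O, (A.a x).PosSemidef)
    (halow : ∀ᵐ x ∂volume.restrict O, ∀ η : Sp n,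
      θ x * ‖η‖ ^ 2 ≤ ∑ i, ∑ j, A.a x i j * η i * η j)
    (haupp : ∀ᵐ x ∂volume.restrict O, ∀ η : Sp n,
      ∑ i, ∑ j, A.a x i j * η i * η j ≤ K * θ x * ‖η‖ ^ 2)
    (hdbd : ∀ᵐ x ∂volume.restrict O, ∀ η : Sp n, |inner ℝ (A.d x) η| ≤ K * θ x * ‖η‖)
    (hbbd : ∀ᵐ x ∂volume.restrict O, ∀ η : Sp n, |inner ℝ (A.b x) η| ≤ K * θ x * ‖η‖)
    (hcbd : ∀ᵐ x ∂volume.restrict O, |A.c x| ≤ K * (1 + θ x))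
    (hone : ∀ v ∈ H10 O S θ w, NonnegAE v →
      0 ≤ A.form O w (fun _ => 1) (fun _ => 0) v.fst v.snd) :
    (∀ u ∈ H1 O θ w, IsSubsolution S A.bilin u →
      essSup (fun x => (u.fst x : EReal)) (volume.restrict O) ≤ zeroMaxBoundarySup S u) ∧
    WeakMaxPrinciple S A.bilin (H1 O θ w) := by
  have hθpos := hθ.pos
  have hwpos := hw.pos
  have W : NormWeights O θ w := by
    refine ⟨hO, ⟨?_, ?_, fun x hx => ?_⟩, ⟨?_, hθw, fun x hx => mul_pos (hθpos x hx) (hwpos x hx)⟩⟩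
    · exact (continuousOn_const.add (hθ.continuousOn.mono subset_closure)).mul hw.continuousOn
    · refine (hw.integrableOn.add hθw).congr (Eventually.of_forall fun x => ?_)
      simp only [Pi.add_apply]
      ring
    · exact mul_pos (by linarith [hθpos x hx]) (hwpos x hx)
    · exact (hθ.continuousOn.mono subset_closure).mul hw.continuousOn
  have hA : A.IsAdmissible O θ K :=
    ⟨hK, ham, hbm, hdm, hcm, halow, haupp, hdbd, hbbd, hcbd⟩
  obtain ⟨M, hM, hOM⟩ := hOb.subset_ball_lt 0 0
  -- The exponent exceeds `-1` because `α ≥ 0` and `β > 0`.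
  have P : IsPowerWeight O (fun x => θ x * w x) (α + (β - 1)) (cθ * cw) M := by
    have hpow : ∀ x ∈ O, lastCoord x ^ (α + (β - 1)) = lastCoord x ^ α * lastCoord x ^ (β - 1) :=
      fun x hx => Real.rpow_add (hOH hx) _ _
    have hnn : ∀ x ∈ O, ∀ e : ℝ, 0 ≤ lastCoord x ^ e := fun x hx e =>
      Real.rpow_nonneg (le_of_lt (hOH hx)) e
    refine ⟨W.snd, hO, hOH, mul_pos hcθ0 hcw0, hM, fun x hx => ?_, by linarith,
      fun x hx => ?_, fun x hx => ?_⟩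
    · have h1 : ‖x‖ < M := by simpa using hOM hx
      exact (le_abs_self _).trans_lt ((abs_lastCoord_le x).trans_lt h1)
    · rw [hpow x hx]
      calc cθ * cw * (lastCoord x ^ α * lastCoord x ^ (β - 1))
          = (cθ * lastCoord x ^ α) * (cw * lastCoord x ^ (β - 1)) := by ring
        _ ≤ θ x * w x := mul_le_mul (hθα x hx).1 (hwβ x hx).1
            (mul_nonneg hcw0.le (hnn x hx _)) (hθpos x hx).le
    · rw [hpow x hx, mul_inv]
      calc θ x * w x ≤ (cθ⁻¹ * lastCoord x ^ α) * (cw⁻¹ * lastCoord x ^ (β - 1)) :=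
            mul_le_mul (hθα x hx).2 (hwβ x hx).2 (hwpos x hx).le
              (mul_nonneg (inv_pos.2 hcθ0).le (hnn x hx _))
        _ = cθ⁻¹ * cw⁻¹ * (lastCoord x ^ α * lastCoord x ^ (β - 1)) := by ring
  have key : ∀ u ∈ H1 O θ w, IsSubsolution S A.bilin u → ∀ l : ℝ, LeOnBoundary S u l →
      ∀ᵐ x ∂volume.restrict O, u.fst x ≤ max l 0 := fun u hu hsub l hl =>
    ae_le_of_leOnBoundary W P hSH hθpos hwpos hA hone hu hsub hl
  refine ⟨fun u hu hsub => ?_, fun u hu hsub hl => ?_⟩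
  · rw [zeroMaxBoundarySup]
    split_ifs with hfr
    -- An empty boundary part forces `O` to be empty, so the bound by `0` holds vacuously.
    · have hzero : volume.restrict O = 0 := by
        rw [eq_empty_of_frontier_diff_eq_empty hO hOb hOH hSH hfr, Measure.restrict_empty]
      refine essSup_le_of_ae_le _ ?_
      have hbot : ae (volume.restrict O) = ⊥ := by rw [hzero, ae_zero]
      exact hbot ▸ eventually_bot
    -- The infimum defining the boundary supremum need not be attained, so the bound is proved
    -- against every `c` strictly above it, for which an admissible `l < c` exists.
    · refine le_of_forall_gt fun c hc => ?_
      obtain ⟨h0, h1⟩ := max_lt_iff.1 hc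
      obtain ⟨L, ⟨l, rfl, hl⟩, hlc⟩ := sInf_lt_iff.1 h1
      have hle : essSup (fun x => (u.fst x : EReal)) (volume.restrict O) ≤
          ((max l 0 : ℝ) : EReal) := by
        refine essSup_le_of_ae_le _ ?_
        filter_upwards [key u hu hsub l hl] with x hx
        exact EReal.coe_le_coe_iff.2 hx
      refine hle.trans_lt ?_
      rcases max_choice l 0 with h | h <;> rw [h]
      · exact hlc
      · exact_mod_cast h0
  · filter_upwards [key u hu hsub 0 hl] with x hx
    simpa using hx
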